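/- Theorem. Let $K$ be an algebraically closed field of characteristic zero (for instance $K=\mathbb C$). Conventions. For integers $0<k<n$, a partition for $\mathrm{Gr}(k,n)$ is a weakly decreasing sequence $n-k\ge\lambda_1\ge\dots\ge\lambda_k\ge 0$ (with $\lambda_j=0$ for $j>k$), and a Schubert problem in $\mathrm{Gr}(k,n)$ is a list $\boldsymbol\lambda=(\lambda^1,\dots,\lambda^s)$ of such partitions (zero partitions are allowed) with $\sum_i|\lambda^i|=k(n-k)$. An instance of $\boldsymbol\lambda$ in an $n$-dimensional vector space $X$ is a list $\mathcal F=(F^1_\bullet,\dots,F^s_\bullet)$ of complete flags in $X$; its set of solutions $\Omega_{\boldsymbol\lambda}\mathcal F\subset\mathrm{Gr}(k,X)$ consists of the $k$-planes $H\subset X$ with $\dim(H\cap F^i_{n-k+j-\lambda^i_j})\ge j$ for all $i=1,\dots,s$ and $j=1,\dots,k$. "General" means: in some nonempty Zariski open (hence dense) subset of the product of flag varieties. Write $\lambda+\mu$ for the componentwise sum of partitions, $c^m$ for the partition with $m$ parts equal to $c$, $(c,d^m)$ for the partition with first part $c$ followed by $m$ parts equal to $d$, and $\square=(1)$, so that $\square^4=(\square,\square,\square,\square)$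 is a Schubert problem in $\mathrm{Gr}(2,4)$. Let $\boldsymbol\lambda$, $\boldsymbol\mu$, $\boldsymbol\nu$ be Schubert problems in $\mathrm{Gr}(k+a,n+b)$, $\mathrm{Gr}(k,n)$, $\mathrm{Gr}(a,b)$, consisting of $s$, $r$, $t$ partitions. We say that $\boldsymbol\lambda$ is fibered over $\boldsymbol\mu$ with fiber $\boldsymbol\nu$ if there are a nonempty Zariski open set $U$ of $s$-tuples of complete flags in $K^{n+b}$ and an assignment to each $\mathcal F\in U$ of a subspace $V\subset K^{n+b}$ of dimension $n$, of an $r$-tuple $\mathcal E$ of complete flags in $V$, and, for every $h\in\Omega_{\boldsymbol\mu}\mathcal E\subset\mathrm{Gr}(k,V)$, of a $t$-tuple $\mathcal G(h)$ of complete flags in $W:=K^{n+b}/V$, such that: 1. for $\mathcal F\in U$ and every $H\in\Omega_{\boldsymbol\lambda}\mathcal F$ we have $H\cap V\in\Omega_{\boldsymbol\mu}\mathcal E$; 2. for $\mathcal F\in U$, $h\in\Omega_{\boldsymbol\mu}\mathcal E$ and $H\in\Omega_{\boldsymbol\lambda}\mathcal F$ with $H\cap V=h$, we have $H/h\in\Omega_{\boldsymbol\nu}\mathcal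 G(h)\subset\mathrm{Gr}(a,W)$, where $H/h=H/(H\cap V)$ is identified with the image of $H$ in $W$; 3. for $\mathcal F\in U$, the map $H\mapsto(h,H/h)$ with $h=H\cap V$ is a bijection from $\Omega_{\boldsymbol\lambda}\mathcal F$ onto the set of pairs $(h,M)$ with $h\in\Omega_{\boldsymbol\mu}\mathcal E$ and $M\in\Omega_{\boldsymbol\nu}\mathcal G(h)$; 4. for every subspace $V\subset K^{n+b}$ of dimension $n$: every general $r$-tuple $\mathcal E$ of flags in $V$ is assigned, together with $V$, to some $\mathcal F\in U$; and for general $\mathcal E$ and every $h\in\Omega_{\boldsymbol\mu}\mathcal E$, every general $t$-tuple of flags in $K^{n+b}/V$ is $\mathcal G(h)$ for some $\mathcal F\in U$ to which $V$ and $\mathcal E$ are assigned. Statement. Let $0<a<b$ be integers with $b\ge 3$ (that is, $(a,b)\ne(1,2)$), and let $$\boldsymbol\nu=\bigl(2^{a-1},\,(b-a-1),\,\nu^3,\,\nu^4,\,\nu^5,\dots,\nu^s\bigr),\qquad s\ge 4,$$ be a Schubert problem in $\mathrm{Gr}(a,b)$. Then $$\boldsymbol\lambda=\bigl((b-a+1,2^a),\,(b-a-1)^2,\,1^{a+1}+\nu^3,\,1^{a+1}+\nu^4,\,\nu^5,\dots,\nu^s\bigr)$$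 is a Schubert problem in $\mathrm{Gr}(2+a,4+b)$, and it is fibered over $\square^4$ in $\mathrm{Gr}(2,4)$ with fiber $\boldsymbol\nu$. -/

import Mathlib

open Module

namespace Schubert

/-! Partitions are sequences `l : ℕ → ℕ`, where `l j` is the length of row `j + 1`.
The componentwise sum of partitions is the pointwise sum of functions. -/

/-- The sequence with the given rows, followed by zeros. -/
def ofRows (rows : List ℕ) : ℕ → ℕ := fun j => rows.getD j 0

/-- `l` is a partition for `Gr(k, n)`: weakly decreasing, at most `k` nonzero rows, and
rows of length at most `n - k`. -/
def IsPartitionFor (k n : ℕ) (l : ℕ → ℕ) : Prop :=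
  Antitone l ∧ l 0 ≤ n - k ∧ l k = 0

/-- A Schubert problem in `Gr(k, n)`: a list of partitions for `Gr(k, n)` whose sizes add up to
`k (n - k)` (used for `0 < k < n`). -/
def IsSchubertProblem (k n : ℕ) {s : ℕ} (lam : Fin s → ℕ → ℕ) : Prop :=
  (∀ i, IsPartitionFor k n (lam i)) ∧
    ∑ i, ∑ j ∈ Finset.range k, lam i j = k * (n - k)

/-- A complete flag in a finite-dimensional vector space `V`: subspaces
`F 0 ⊆ F 1 ⊆ ⋯ ⊆ F (dim V) = V` with `dim (F j) = j`. (Beyond `dim V` the sequence is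
constantly `V`, so that the sequence is determined by the flag.) -/
@[ext]
structure CompleteFlag (K V : Type*) [Field K] [AddCommGroup V] [Module K V] where
  /-- The subspaces of the flag. -/
  sub : ℕ → Submodule K V
  mono : Monotone sub
  finrank_sub : ∀ j, finrank K (sub j) = min j (finrank K V)

section

variable {K V : Type*} [Field K] [AddCommGroup V] [Module K V]

/-- The flag whose `j`-th subspace is spanned by the first `j` vectors of an ordered basis. -/
def CompleteFlag.ofBasis (f : Basis (Fin (finrank K V)) K V) : CompleteFlag K V where
  sub j := Submodule.span K (f '' {i | (i : ℕ) < j})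
  mono := fun _ _ h => Submodule.span_mono (Set.image_mono fun _ hi => lt_of_lt_of_le hi h)
  finrank_sub j := by
    classical
    have h : f '' {i | (i : ℕ) < j} =
        Set.range (f ∘ (Subtype.val : {i : Fin (finrank K V) // (i : ℕ) < j} → _)) := by
      ext x
      simp
    rw [h, finrank_span_eq_card (f.linearIndependent.comp _ Subtype.val_injective),
      Fintype.card_subtype, Fin.card_filter_val_lt, min_comm]

/-- The value of a polynomial in the coordinates (with respect to a reference basis of `V`) of
the vectors of `s` ordered bases of `V`. -/
noncomputable def evalFrames {s : ℕ}
    (p : MvPolynomial (Fin s × Fin (finrank K V) × Fin (finrank K V)) K)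
    [FiniteDimensional K V] (f : Fin s → Basis (Fin (finrank K V)) K V) : K :=
  MvPolynomial.eval (fun x => (finBasis K V).repr (f x.1 x.2.1) x.2.2) p

/-- Zariski open subsets of the product of `s` copies of the variety of complete flags in `V`.
This variety is the quotient of the variety of ordered bases of `V` (which is isomorphic to the
general linear group) by the upper triangular matrices; so a set of tuples of flags is open if and
only if its preimage among the tuples of ordered bases is open, that is, a union of
nonvanishing loci of polynomials in the coordinates. The choice of the reference basis does not
matter. -/
def IsZariskiOpen [FiniteDimensional K V] {s : ℕ}
    (U : Set (Fin s → CompleteFlag K V)) : Prop :=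
  ∀ f : Fin s → Basis (Fin (finrank K V)) K V, (fun i => CompleteFlag.ofBasis (f i)) ∈ U →
    ∃ p : MvPolynomial (Fin s × Fin (finrank K V) × Fin (finrank K V)) K,
      evalFrames p f ≠ 0 ∧
      ∀ g : Fin s → Basis (Fin (finrank K V)) K V, evalFrames p g ≠ 0 →
        (fun i => CompleteFlag.ofBasis (g i)) ∈ U

/-- `P` holds for general `s`-tuples of flags: it holds on a nonempty Zariski open set. (Over an
infinite field, such a set is dense, as the product of flag varieties is irreducible.) -/
def Generally [FiniteDimensional K V] {s : ℕ} (P : (Fin s → CompleteFlag K V) → Prop) : Prop :=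
  ∃ U : Set (Fin s → CompleteFlag K V), IsZariskiOpen U ∧ U.Nonempty ∧ ∀ F ∈ U, P F

/-- The Schubert variety in `Gr(k, V)` of a partition and a flag: with `n = dim V`, the
`k`-planes `H` with `dim (H ∩ F_{n - k + j - l_j}) ≥ j` for `j = 1, …, k`. -/
def schubertVariety (k : ℕ) (l : ℕ → ℕ) (F : CompleteFlag K V) : Set (Submodule K V) :=
  {H | finrank K H = k ∧
    ∀ j < k, j + 1 ≤ finrank K ↥(H ⊓ F.sub (finrank K V - k + (j + 1) - l j))}

/-- The set of solutions in `Gr(k, V)` of the instance of a Schubert problem given by flags. -/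
def solutions (k : ℕ) {s : ℕ} (lam : Fin s → ℕ → ℕ) (F : Fin s → CompleteFlag K V) :
    Set (Submodule K V) :=
  {H | finrank K H = k ∧ ∀ i, H ∈ schubertVariety k (lam i) (F i)}

end

/-- What a fibration attaches to an instance of a Schubert problem in `K^N`: a subspace `V`,
an `r`-tuple `E` of flags in `V`, and for every subspace `h` of `V` a `t`-tuple `G h` of flags in
the quotient `K^N / V` (only its values at the solutions `h` of the instance `E` matter). -/
structure FibrationDatum (K : Type*) [Field K] (N r t : ℕ) where
  V : Submodule K (Fin N → K)
  E : Fin r → CompleteFlag K V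
  G : Submodule K V → Fin t → CompleteFlag K ((Fin N → K) ⧸ V)

/-- The Schubert problem `lam` in `Gr(k + a, n + b)` is fibered over `mu` in `Gr(k, n)` with
fiber `nu` in `Gr(a, b)`. Here `U` is the set of general instances of `lam`. For a subspace `H`
of `K^(n + b)`, `H.comap V.subtype` is `h = H ∩ V` as a subspace of `V`, and `H.map V.mkQ`, the
image of `H` in `W = K^(n + b) / V`, is `H / h`. -/
def IsFibered (K : Type*) [Field K] (k n a b : ℕ) {s r t : ℕ}
    (lam : Fin s → ℕ → ℕ) (mu : Fin r → ℕ → ℕ) (nu : Fin t → ℕ → ℕ) : Prop :=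
  ∃ (U : Set (Fin s → CompleteFlag K (Fin (n + b) → K)))
    (D : (Fin s → CompleteFlag K (Fin (n + b) → K)) → FibrationDatum K (n + b) r t),
    IsZariskiOpen U ∧ U.Nonempty ∧
    -- solutions `H` give solutions `H ∩ V` of the base problem
    (∀ F ∈ U, finrank K (D F).V = n ∧
      ∀ H ∈ solutions (k + a) lam F, H.comap (D F).V.subtype ∈ solutions k mu (D F).E) ∧
    -- and solutions `H / h` of the problem in the fiber over `h = H ∩ V`
    (∀ F ∈ U, ∀ h ∈ solutions k mu (D F).E, ∀ H ∈ solutions (k + a) lam F,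
      H.comap (D F).V.subtype = h → H.map (D F).V.mkQ ∈ solutions a nu ((D F).G h)) ∧
    -- `H ↦ (h, H / h)` is a bijection
    (∀ F ∈ U, Set.BijOn (fun H => (H.comap (D F).V.subtype, H.map (D F).V.mkQ))
      (solutions (k + a) lam F)
      {p | p.1 ∈ solutions k mu (D F).E ∧ p.2 ∈ solutions a nu ((D F).G p.1)}) ∧
    -- for given `V`, all general `E` arise; for general `E` and each `h`, all general `G h` arise
    (∀ V : Submodule K (Fin (n + b) → K), finrank K V = n →
      Generally (fun E : Fin r → CompleteFlag K V => ∃ F ∈ U, ∃ G, D F = ⟨V, E, G⟩) ∧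
      Generally (fun E : Fin r → CompleteFlag K V => ∀ h ∈ solutions k mu E,
        Generally (fun G₀ : Fin t → CompleteFlag K ((Fin (n + b) → K) ⧸ V) =>
          ∃ F ∈ U, ∃ G, D F = ⟨V, E, G⟩ ∧ G h = G₀)))

end Schubert

open Schubert

/-!
Write `X = K^(4 + b)` and number the flags of an instance from `0`. The space of the fibration is
`V = F⁰₂ + (F¹₅ ∩ F⁰_(b + 1))`, of dimension four. A solution `H` meets `V` in a plane `h`, and the
flags `F⁰, …, F³` cut out of `V` four planes which `h` has to meet: this is an instance of `□⁴`.
Moreover `H` lies in `L = (F²_(b + 2) + h) ∩ (F³_(b + 2) + h)`. Since `L ∩ V = h` and `L + V = X`,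
the plane `h` and the image of `H` in `X / V` determine `H`, and the conditions on `H` become those
of the fiber problem for the flags which the traces on `L` of the `Fⁱ` induce on `X / V`.

All dimensions in this argument are controlled by one principle: Schubert conditions whose
codimensions sum to more than the dimension of the Grassmannian have no common solution for general
flags. Over an infinite field this follows by counting parameters: the coordinates of flags in
excess position are algebraically dependent.

For dominance, start from one general instance, and move its flags independently by automorphisms
of `X` which preserve `V`, respectively which fix `V` and preserve `L`. Neither `V` nor `L` moves,
whereas the induced flags on `V`, respectively on `X / V`, move by arbitrary automorphisms.
-/

namespace Schubert

section Polynomials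

open MvPolynomial

variable {K τ κ : Type*} [Field K] [Fintype τ] [Fintype κ]

theorem card_le_of_algebraicIndependent {g : κ → MvPolynomial τ K}
    (hg : AlgebraicIndependent K g) : Fintype.card κ ≤ Fintype.card τ := by
  simpa [MvPolynomial.trdeg_of_isDomain] using hg.lift_cardinalMk_le_trdeg

theorem exists_ne_zero_aeval_eq_zero (g : κ → MvPolynomial τ K)
    (h : Fintype.card τ < Fintype.card κ) : ∃ r : MvPolynomial κ K, r ≠ 0 ∧ aeval g r = 0 := by
  have hg : ¬ AlgebraicIndependent K g := fun hg => h.not_ge (card_le_of_algebraicIndependent hg)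
  rw [algebraicIndependent_iff] at hg
  push Not at hg
  obtain ⟨r, hr, hr₀⟩ := hg
  exact ⟨r, hr₀, hr⟩

theorem exists_ne_zero_dvd_aeval (g : κ → MvPolynomial τ K)
    (h : Fintype.card τ ≤ Fintype.card κ) {q : MvPolynomial τ K} (hq : q ≠ 0) :
    ∃ r : MvPolynomial κ K, r ≠ 0 ∧ q ∣ aeval g r := by
  by_cases hg : AlgebraicIndependent K g
  · have hqg : ¬ AlgebraicIndependent K (fun o : Option κ => o.elim q g) := fun hqg => by
      have := card_le_of_algebraicIndependent hqg
      rw [Fintype.card_option] at this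
      lia
    have halg : IsAlgebraic (Algebra.adjoin K (Set.range g)) q := by
      by_contra htr
      exact hqg (AlgebraicIndependent.option_iff.mpr ⟨hg, htr⟩)
    obtain ⟨⟨_, hy⟩, hy₀, hdvd⟩ := halg.exists_nonzero_dvd (mem_nonZeroDivisors_of_ne_zero hq)
    obtain ⟨r, rfl⟩ := (Algebra.adjoin_range_eq_range_aeval K g).le hy
    exact ⟨r, fun hr => hy₀ (Subtype.ext (by simp [hr])), hdvd⟩
  · rw [algebraicIndependent_iff] at hg
    push Not at hg
    obtain ⟨r, hr, hr₀⟩ := hg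
    exact ⟨r, hr₀, hr ▸ dvd_zero q⟩

end Polynomials

section Flags

variable {K V : Type*} [Field K] [AddCommGroup V] [Module K V]

theorem CompleteFlag.sub_zero [FiniteDimensional K V] (F : CompleteFlag K V) : F.sub 0 = ⊥ := by
  rw [← Submodule.finrank_eq_zero (R := K), F.finrank_sub, Nat.zero_min]

theorem CompleteFlag.sub_eq_top [FiniteDimensional K V] (F : CompleteFlag K V) {j : ℕ}
    (hj : finrank K V ≤ j) : F.sub j = ⊤ :=
  Submodule.eq_top_of_finrank_eq (by rw [F.finrank_sub, min_eq_right hj])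

theorem CompleteFlag.sub_lt_sub_succ (F : CompleteFlag K V) {j : ℕ} (hj : j < finrank K V) :
    F.sub j < F.sub (j + 1) := by
  refine (F.mono j.le_succ).lt_of_ne fun h => ?_
  have := congrArg (fun W : Submodule K V => finrank K W) h
  simp only [F.finrank_sub] at this
  lia

theorem CompleteFlag.span_image_lt [FiniteDimensional K V] (F : CompleteFlag K V)
    {v : Fin (finrank K V) → V} (hv : ∀ j : Fin (finrank K V), v j ∈ F.sub (j + 1))
    (hv' : ∀ j : Fin (finrank K V), v j ∉ F.sub j) (m : ℕ) (hm : m ≤ finrank K V) :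
    Submodule.span K (v '' {i | (i : ℕ) < m}) = F.sub m := by
  induction m with
  | zero => simp [F.sub_zero]
  | succ m ih =>
    have ih := ih (by lia)
    have hle : Submodule.span K (v '' {i | (i : ℕ) < m + 1}) ≤ F.sub (m + 1) := by
      rw [Submodule.span_le]
      rintro _ ⟨i, hi, rfl⟩
      exact F.mono (Nat.succ_le_of_lt hi) (hv i)
    have hlt : F.sub m < Submodule.span K (v '' {i | (i : ℕ) < m + 1}) := by
      refine SetLike.lt_iff_le_and_exists.mpr ⟨?_, v ⟨m, hm⟩,
        Submodule.subset_span ⟨⟨m, hm⟩, Nat.lt_succ_self m, rfl⟩, hv' ⟨m, hm⟩⟩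
      rw [← ih]
      exact Submodule.span_mono (Set.image_mono fun i hi => Nat.lt_succ_of_lt hi)
    refine Submodule.eq_of_le_of_finrank_le hle ?_
    have := Submodule.finrank_lt_finrank_of_lt hlt
    rw [F.finrank_sub] at this ⊢
    lia

/-- The image of a complete flag under a linear automorphism. -/
def CompleteFlag.map (B : V ≃ₗ[K] V) (F : CompleteFlag K V) : CompleteFlag K V where
  sub j := (F.sub j).map (B : V →ₗ[K] V)
  mono := fun _ _ h => Submodule.map_mono (F.mono h)
  finrank_sub j := by rw [LinearEquiv.finrank_map_eq, F.finrank_sub]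

theorem CompleteFlag.map_sub (B : V ≃ₗ[K] V) (F : CompleteFlag K V) (j : ℕ) :
    (F.map B).sub j = (F.sub j).map (B : V →ₗ[K] V) := rfl

theorem CompleteFlag.map_map_symm (F : CompleteFlag K V) (B : V ≃ₗ[K] V) :
    (F.map B).map B.symm = F := by
  ext j : 2
  rw [map_sub, map_sub, ← Submodule.map_comp, LinearEquiv.symm_comp, Submodule.map_id]

theorem CompleteFlag.map_symm_map (F : CompleteFlag K V) (B : V ≃ₗ[K] V) :
    (F.map B.symm).map B = F :=
  F.map_map_symm B.symm

end Flags

section Frames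

/-- The frames (ordered bases) of `V`, the points of the general linear group that lies over the
flag variety. -/
abbrev Frame (K V : Type*) [Field K] [AddCommGroup V] [Module K V] : Type _ :=
  Basis (Fin (finrank K V)) K V

/-- Polynomials in the coordinates of the vectors of `s` frames of `V`. -/
abbrev FramePolynomial (K V : Type*) [Field K] [AddCommGroup V] [Module K V] (s : ℕ) : Type _ :=
  MvPolynomial (Fin s × Fin (finrank K V) × Fin (finrank K V)) K

variable {K V : Type*} [Field K] [AddCommGroup V] [Module K V] {r s : ℕ}

/-- The tuple of flags spanned by a tuple of frames. -/
def flagsOf (f : Fin s → Frame K V) : Fin s → CompleteFlag K V :=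
  fun i => CompleteFlag.ofBasis (f i)

theorem CompleteFlag.ofBasis_map (B : V ≃ₗ[K] V) (f : Frame K V) :
    ofBasis (f.map B) = (ofBasis f).map B := by
  ext m : 2
  rw [map_sub]
  simp only [ofBasis]
  rw [Submodule.map_span, ← Set.image_comp]
  rfl

theorem flagsOf_map (B : Fin s → V ≃ₗ[K] V) (f : Fin s → Frame K V) :
    flagsOf (fun i => (f i).map (B i)) = fun i => (flagsOf f i).map (B i) :=
  funext fun i => CompleteFlag.ofBasis_map (B i) (f i)

theorem map_equiv_refl (f g : Frame K V) : f.map (f.equiv g (Equiv.refl _)) = g :=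
  Basis.eq_of_apply_eq fun i => by simp

variable [FiniteDimensional K V]

theorem CompleteFlag.exists_ofBasis (F : CompleteFlag K V) : ∃ f : Frame K V, ofBasis f = F := by
  choose v hv hv' using fun j : Fin (finrank K V) =>
    SetLike.exists_of_lt (F.sub_lt_sub_succ j.isLt)
  have hspan := F.span_image_lt hv hv'
  have htop : ⊤ ≤ Submodule.span K (Set.range v) := by
    rw [← F.sub_eq_top le_rfl, ← hspan _ le_rfl]
    exact Submodule.span_mono (Set.image_subset_range _ _)
  refine ⟨basisOfTopLeSpanOfCardEqFinrank v htop (by simp), ?_⟩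
  ext m : 2
  rcases le_or_gt m (finrank K V) with hm | hm
  · simpa only [ofBasis, coe_basisOfTopLeSpanOfCardEqFinrank] using hspan m hm
  · rw [sub_eq_top _ hm.le, sub_eq_top _ hm.le]

theorem exists_flagsOf_eq (F : Fin s → CompleteFlag K V) :
    ∃ f : Fin s → Frame K V, flagsOf f = F := by
  choose f hf using fun i => (F i).exists_ofBasis
  exact ⟨f, funext hf⟩

theorem exists_frame_repr_eq {A : Matrix (Fin (finrank K V)) (Fin (finrank K V)) K}
    (hA : A.det ≠ 0) : ∃ f : Frame K V, ∀ m c, (finBasis K V).repr (f m) c = A m c := by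
  have hA' : IsUnit A.transpose.det := by rwa [Matrix.det_transpose, isUnit_iff_ne_zero]
  refine ⟨(finBasis K V).map (Matrix.toLinearEquiv (finBasis K V) A.transpose hA'),
    fun m c => ?_⟩
  rw [Basis.map_apply]
  change (finBasis K V).repr (Matrix.toLin (finBasis K V) (finBasis K V) _ _) c = _
  rw [Matrix.toLin_self, Basis.repr_sum_self, Matrix.transpose_apply]

theorem exists_evalFrames_ne_zero [Infinite K] {p : FramePolynomial K V s} (hp : p ≠ 0) :
    ∃ f : Fin s → Frame K V, evalFrames p f ≠ 0 := by
  let frameMatrix (i : Fin s) :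
      Matrix (Fin (finrank K V)) (Fin (finrank K V)) (FramePolynomial K V s) :=
    Matrix.of fun m c => MvPolynomial.X (i, m, c)
  have eval_det (x i) : MvPolynomial.eval x (frameMatrix i).det =
      (Matrix.of fun m c => x (i, m, c)).det := by
    rw [RingHom.map_det]
    congr 1
    ext m c
    simp [frameMatrix]
  have hdet (i : Fin s) : (frameMatrix i).det ≠ 0 := fun h => by
    have := eval_det (fun x => (1 : Matrix _ _ K) x.2.1 x.2.2) i
    rw [h, map_zero] at this
    exact one_ne_zero (Matrix.det_one.symm.trans this.symm)
  have hprod : p * ∏ i, (frameMatrix i).det ≠ 0 :=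
    mul_ne_zero hp (Finset.prod_ne_zero_iff.mpr fun i _ => hdet i)
  obtain ⟨x, hx⟩ : ∃ x, MvPolynomial.eval x (p * ∏ i, (frameMatrix i).det) ≠ 0 := by
    by_contra! h
    exact hprod (MvPolynomial.funext fun x => by rw [h x, map_zero])
  rw [map_mul, map_prod] at hx
  choose f hf using fun i => exists_frame_repr_eq (V := V) (eval_det x i ▸
    Finset.prod_ne_zero_iff.mp (right_ne_zero_of_mul hx) i (Finset.mem_univ i))
  refine ⟨f, ?_⟩
  convert left_ne_zero_of_mul hx using 1
  simp [evalFrames, hf]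

/-- The vector `v f`, which depends on a tuple `f` of frames, has polynomial coordinates. -/
def IsFramePolynomial {W : Type*} [AddCommGroup W] [Module K W]
    (v : (Fin r → Frame K V) → W) : Prop :=
  ∀ ℓ : W →ₗ[K] K, ∃ p : FramePolynomial K V r, ∀ f, evalFrames p f = ℓ (v f)

namespace IsFramePolynomial

variable {W : Type*} [AddCommGroup W] [Module K W]

theorem const (w : W) : IsFramePolynomial fun _ : Fin r → Frame K V => w :=
  fun ℓ => ⟨MvPolynomial.C (ℓ w), fun f => by simp [evalFrames]⟩

theorem add {v w : (Fin r → Frame K V) → W} (hv : IsFramePolynomial v)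
    (hw : IsFramePolynomial w) : IsFramePolynomial fun f => v f + w f := fun ℓ => by
  obtain ⟨p, hp⟩ := hv ℓ
  obtain ⟨q, hq⟩ := hw ℓ
  refine ⟨p + q, fun f => ?_⟩
  rw [map_add, ← hp, ← hq, evalFrames, map_add]
  rfl

theorem map {W' : Type*} [AddCommGroup W'] [Module K W'] {v : (Fin r → Frame K V) → W}
    (hv : IsFramePolynomial v) (T : W →ₗ[K] W') : IsFramePolynomial fun f => T (v f) :=
  fun ℓ => hv (ℓ ∘ₗ T)

theorem sum {ι : Type*} (t : Finset ι) {v : ι → (Fin r → Frame K V) → W}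
    (hv : ∀ i, IsFramePolynomial (v i)) : IsFramePolynomial fun f => ∑ i ∈ t, v i f := fun ℓ => by
  choose p hp using fun i => hv i ℓ
  refine ⟨∑ i ∈ t, p i, fun f => ?_⟩
  simp only [map_sum, ← hp]
  exact map_sum _ _ _

theorem vec (i : Fin r) (m : Fin (finrank K V)) :
    IsFramePolynomial fun f : Fin r → Frame K V => f i m := fun ℓ => by
  refine ⟨∑ c, MvPolynomial.C (ℓ (finBasis K V c)) * MvPolynomial.X (i, m, c), fun f => ?_⟩
  beta_reduce
  conv_rhs => rw [← (finBasis K V).sum_repr (f i m), map_sum]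
  simp [evalFrames, mul_comm]

theorem equiv (i : Fin r) (f₀ : Frame K V) (v : V) :
    IsFramePolynomial fun f : Fin r → Frame K V => f₀.equiv (f i) (Equiv.refl _) v := by
  have hv (f : Fin r → Frame K V) : f₀.equiv (f i) (Equiv.refl _) v =
      ∑ l, LinearMap.toSpanSingleton K (V →ₗ[K] V) LinearMap.id (f₀.repr v l) (f i l) := by
    conv_lhs => rw [← f₀.sum_repr v, map_sum]
    simp
  simp only [hv]
  exact sum _ fun l => (vec i l).map _

theorem evalFrames_comp {V₂ : Type*} [AddCommGroup V₂] [Module K V₂] [FiniteDimensional K V₂]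
    {Ψ : (Fin r → Frame K V) → Fin s → Frame K V₂} (hΨ : ∀ i m, IsFramePolynomial fun e => Ψ e i m)
    (p : FramePolynomial K V₂ s) :
    ∃ p' : FramePolynomial K V r, ∀ e, evalFrames p' e = evalFrames p (Ψ e) := by
  choose φ hφ using fun x : Fin s × Fin (finrank K V₂) × Fin (finrank K V₂) =>
    hΨ x.1 x.2.1 ((finBasis K V₂).coord x.2.2)
  refine ⟨MvPolynomial.bind₁ φ p, fun e => ?_⟩
  have : (fun x => (finBasis K V₂).repr (Ψ e x.1 x.2.1) x.2.2) = fun x => evalFrames (φ x) e :=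
    funext fun x => (hφ x e).symm
  rw [evalFrames, evalFrames, this]
  exact MvPolynomial.eval₂Hom_bind₁ _ _ _ _

end IsFramePolynomial

end Frames

section Generic

variable {K V : Type*} [Field K] [AddCommGroup V] [Module K V] [FiniteDimensional K V] {r s : ℕ}

theorem isZariskiOpen_image_flagsOf (p : FramePolynomial K V s) :
    IsZariskiOpen (flagsOf '' {f : Fin s → Frame K V | evalFrames p f ≠ 0}) := by
  rintro f ⟨f', hf', hff' : flagsOf f' = flagsOf f⟩
  let Ψ (g : Fin s → Frame K V) (i : Fin s) : Frame K V :=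
    (f' i).map ((f i).equiv (g i) (Equiv.refl _))
  have hΨ (i m) : IsFramePolynomial fun g => Ψ g i m := by
    simp only [Ψ, Basis.map_apply]
    exact .equiv i (f i) (f' i m)
  have flagsOf_Ψ (g) : flagsOf (Ψ g) = flagsOf g := by
    rw [flagsOf_map, hff', ← flagsOf_map]
    simp only [map_equiv_refl]
  have Ψ_self : Ψ f = f' := by
    funext i
    have : (f i).equiv (f i) (Equiv.refl _) = LinearEquiv.refl K V :=
      (f i).ext' fun j => by simp
    exact Basis.eq_of_apply_eq fun m => by simp [Ψ, this]
  obtain ⟨p', hp'⟩ := IsFramePolynomial.evalFrames_comp hΨ p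
  refine ⟨p', by rwa [hp', Ψ_self], fun g hg => ⟨Ψ g, ?_, flagsOf_Ψ g⟩⟩
  rwa [Set.mem_ofPred_eq, ← hp']

theorem generally_iff [Infinite K] {P : (Fin s → CompleteFlag K V) → Prop} :
    Generally P ↔ ∃ p : FramePolynomial K V s, p ≠ 0 ∧
      ∀ f : Fin s → Frame K V, evalFrames p f ≠ 0 → P (flagsOf f) := by
  constructor
  · rintro ⟨U, hU, ⟨F, hF⟩, hUP⟩
    obtain ⟨f, rfl⟩ := exists_flagsOf_eq F
    obtain ⟨p, hp, hpU⟩ := hU f hF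
    exact ⟨p, fun h => hp (by simp [h, evalFrames]), fun g hg => hUP _ (hpU g hg)⟩
  · rintro ⟨p, hp, hpP⟩
    obtain ⟨f, hf⟩ := exists_evalFrames_ne_zero hp
    refine ⟨_, isZariskiOpen_image_flagsOf p, ⟨_, f, hf, rfl⟩, ?_⟩
    rintro _ ⟨g, hg, rfl⟩
    exact hpP g hg

theorem Generally.mono {P Q : (Fin s → CompleteFlag K V) → Prop} (hP : Generally P)
    (h : ∀ F, P F → Q F) : Generally Q := by
  obtain ⟨U, hU, hne, hUP⟩ := hP
  exact ⟨U, hU, hne, fun F hF => h F (hUP F hF)⟩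

theorem Generally.forall [Infinite K] {ι : Type*} [Finite ι]
    {P : ι → (Fin s → CompleteFlag K V) → Prop} (hP : ∀ i, Generally (P i)) :
    Generally fun F => ∀ i, P i F := by
  have := Fintype.ofFinite ι
  choose p hp hpP using fun i => generally_iff.mp (hP i)
  refine generally_iff.mpr ⟨∏ i, p i, Finset.prod_ne_zero_iff.mpr fun i _ => hp i,
    fun f hf i => hpP i f ?_⟩
  rw [evalFrames, map_prod] at hf
  exact Finset.prod_ne_zero_iff.mp hf i (Finset.mem_univ i)

theorem Generally.and [Infinite K] {P Q : (Fin s → CompleteFlag K V) → Prop} (hP : Generally P)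
    (hQ : Generally Q) : Generally fun F => P F ∧ Q F := by
  have := Generally.forall (P := fun i : Bool => cond i P Q) (Bool.rec hQ hP)
  exact this.mono fun F hF => ⟨hF true, hF false⟩

/-- The Zariski interior of the set of tuples of flags with the property `P`. -/
def zariskiInterior (P : (Fin s → CompleteFlag K V) → Prop) : Set (Fin s → CompleteFlag K V) :=
  ⋃₀ {U | IsZariskiOpen U ∧ ∀ F ∈ U, P F}

theorem of_mem_zariskiInterior {P : (Fin s → CompleteFlag K V) → Prop}
    {F : Fin s → CompleteFlag K V} (hF : F ∈ zariskiInterior P) : P F := by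
  obtain ⟨U, hU, hFU⟩ := hF
  exact hU.2 F hFU

theorem isZariskiOpen_zariskiInterior (P : (Fin s → CompleteFlag K V) → Prop) :
    IsZariskiOpen (zariskiInterior P) := by
  rintro f ⟨U, hU, hf⟩
  obtain ⟨p, hp, hpU⟩ := hU.1 f hf
  exact ⟨p, hp, fun g hg => ⟨U, hU, hpU g hg⟩⟩

theorem Generally.nonempty_zariskiInterior {P : (Fin s → CompleteFlag K V) → Prop}
    (hP : Generally P) : (zariskiInterior P).Nonempty := by
  obtain ⟨U, hU, ⟨F, hF⟩, hUP⟩ := hP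
  exact ⟨F, U, ⟨hU, hUP⟩, hF⟩

theorem IsZariskiOpen.preimage_map {U : Set (Fin s → CompleteFlag K V)} (hU : IsZariskiOpen U)
    (B : V ≃ₗ[K] V) : IsZariskiOpen {F | (fun i => (F i).map B) ∈ U} := by
  intro f (hf : (fun i => (flagsOf f i).map B) ∈ U)
  rw [← flagsOf_map] at hf
  obtain ⟨p, hp, hpU⟩ := hU _ hf
  obtain ⟨p', hp'⟩ := IsFramePolynomial.evalFrames_comp
    (Ψ := fun (g : Fin s → Frame K V) i => (g i).map B)
    (fun i m => (IsFramePolynomial.vec i m).map (B : V →ₗ[K] V)) p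
  refine ⟨p', by rwa [hp'], fun g hg => ?_⟩
  change (fun i => (flagsOf g i).map B) ∈ U
  rw [← flagsOf_map]
  exact hpU _ (by rwa [← hp'])

theorem map_mem_zariskiInterior {P : (Fin s → CompleteFlag K V) → Prop}
    (B : V ≃ₗ[K] V) (hP : ∀ F, P F → P fun i => (F i).map B) {F : Fin s → CompleteFlag K V}
    (hF : F ∈ zariskiInterior P) : (fun i => (F i).map B) ∈ zariskiInterior P := by
  obtain ⟨U, ⟨hU, hUP⟩, hFU⟩ := hF
  refine ⟨_, ⟨hU.preimage_map B.symm, fun G hG => ?_⟩, ?_⟩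
  · simpa only [CompleteFlag.map_symm_map] using hP _ (hUP _ hG)
  · simpa only [Set.mem_ofPred_eq, CompleteFlag.map_map_symm] using hFU

theorem generally_of_isFramePolynomial {V₂ : Type*} [AddCommGroup V₂] [Module K V₂]
    [FiniteDimensional K V₂] {Ψ : (Fin r → Frame K V) → Fin s → Frame K V₂}
    (hΨ : ∀ i m, IsFramePolynomial fun e => Ψ e i m) {U : Set (Fin s → CompleteFlag K V₂)}
    (hU : IsZariskiOpen U) {e₀ : Fin r → Frame K V} (h₀ : flagsOf (Ψ e₀) ∈ U) :
    Generally fun E : Fin r → CompleteFlag K V => ∃ e, flagsOf e = E ∧ flagsOf (Ψ e) ∈ U := by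
  obtain ⟨p, hp, hpU⟩ := hU _ h₀
  obtain ⟨p', hp'⟩ := IsFramePolynomial.evalFrames_comp hΨ p
  refine ⟨_, isZariskiOpen_image_flagsOf p', ⟨_, e₀, by rwa [Set.mem_ofPred_eq, hp'], rfl⟩, ?_⟩
  rintro _ ⟨e, he, rfl⟩
  exact ⟨e, rfl, hpU _ (by rwa [← hp'])⟩

end Generic

section ExtendAut

variable {K V V₁ : Type*} [Field K] [AddCommGroup V] [Module K V] [AddCommGroup V₁] [Module K V₁]
  {ι : V₁ →ₗ[K] V} {π : V →ₗ[K] V₁}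

/-- The automorphism that acts by `θ` on the range of `ι` and trivially on the kernel of its
retraction `π`. -/
def extendAut (h : Function.LeftInverse π ι) (θ : V₁ ≃ₗ[K] V₁) : V ≃ₗ[K] V :=
  LinearEquiv.ofLinearMap (LinearMap.id - ι ∘ₗ π + ι ∘ₗ (θ : V₁ →ₗ[K] V₁) ∘ₗ π)
    (LinearMap.id - ι ∘ₗ π + ι ∘ₗ (θ.symm : V₁ →ₗ[K] V₁) ∘ₗ π)
    (by ext v; simp [h _]) (by ext v; simp [h _])

theorem extendAut_apply (h : Function.LeftInverse π ι) (θ : V₁ ≃ₗ[K] V₁) (v : V) :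
    extendAut h θ v = v - ι (π v) + ι (θ (π v)) := rfl

theorem extendAut_incl (h : Function.LeftInverse π ι) (θ : V₁ ≃ₗ[K] V₁) (v : V₁) :
    extendAut h θ (ι v) = ι (θ v) := by
  simp [extendAut_apply, h v]

theorem retract_extendAut (h : Function.LeftInverse π ι) (θ : V₁ ≃ₗ[K] V₁) (v : V) :
    π (extendAut h θ v) = θ (π v) := by
  simp [extendAut_apply, h _]

theorem extendAut_of_eq_zero (h : Function.LeftInverse π ι) (θ : V₁ ≃ₗ[K] V₁) {v : V}
    (hv : π v = 0) : extendAut h θ v = v := by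
  simp [extendAut_apply, hv]

theorem extendAut_refl (h : Function.LeftInverse π ι) :
    extendAut h (LinearEquiv.refl K V₁) = LinearEquiv.refl K V := by
  ext v
  simp [extendAut_apply]

theorem map_extendAut [FiniteDimensional K V] (h : Function.LeftInverse π ι) (θ : V₁ ≃ₗ[K] V₁)
    {L : Submodule K V} (hL : LinearMap.range ι ≤ L) :
    L.map (extendAut h θ : V →ₗ[K] V) = L := by
  refine Submodule.eq_of_le_of_finrank_eq ?_ (LinearEquiv.finrank_map_eq _ _)
  rintro _ ⟨v, hv, rfl⟩
  exact L.add_mem (L.sub_mem hv (hL ⟨_, rfl⟩)) (hL ⟨_, rfl⟩)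

theorem IsZariskiOpen.generally_extendAut [FiniteDimensional K V] [FiniteDimensional K V₁]
    {r s : ℕ} {U : Set (Fin s → CompleteFlag K V)} (hU : IsZariskiOpen U)
    (h : Function.LeftInverse π ι) {F : Fin s → CompleteFlag K V} (hF : F ∈ U)
    (ρ : Fin s → Option (Fin r)) (E : Fin r → CompleteFlag K V₁) :
    Generally fun E' : Fin r → CompleteFlag K V₁ => ∃ θ : Fin r → (V₁ ≃ₗ[K] V₁),
      (E' = fun j => (E j).map (θ j)) ∧
      (fun i => (F i).map ((ρ i).elim (LinearEquiv.refl K V) fun j => extendAut h (θ j))) ∈ U := by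
  obtain ⟨f, rfl⟩ := exists_flagsOf_eq F
  obtain ⟨e₀, rfl⟩ := exists_flagsOf_eq E
  let θ (e : Fin r → Frame K V₁) (j : Fin r) : V₁ ≃ₗ[K] V₁ := (e₀ j).equiv (e j) (Equiv.refl _)
  let A (e : Fin r → Frame K V₁) (i : Fin s) : V ≃ₗ[K] V :=
    (ρ i).elim (LinearEquiv.refl K V) fun j => extendAut h (θ e j)
  have hθ : θ e₀ = fun _ => LinearEquiv.refl K V₁ := by
    funext j
    exact (e₀ j).ext' fun l => by simp [θ]
  have hA : A e₀ = fun _ => LinearEquiv.refl K V := by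
    funext i
    cases hi : ρ i <;> simp [A, hi, hθ, extendAut_refl]
  have hpoly (i m) : IsFramePolynomial fun e => (f i).map (A e i) m := by
    cases hi : ρ i with
    | none => simpa [A, hi] using .const (f i m)
    | some j =>
      simp only [Basis.map_apply, A, hi, Option.elim_some, extendAut_apply]
      exact (IsFramePolynomial.const _).add ((IsFramePolynomial.equiv j (e₀ j) _).map ι)
  have hA₀ : flagsOf (fun i => (f i).map (A e₀ i)) ∈ U := by
    have (i : Fin s) : (f i).map (A e₀ i) = f i := Basis.eq_of_apply_eq fun m => by simp [hA]
    simpa only [this] using hF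
  refine (generally_of_isFramePolynomial hpoly hU hA₀).mono ?_
  rintro _ ⟨e, rfl, he⟩
  exact ⟨θ e, by simp only [← flagsOf_map, θ, map_equiv_refl], by rwa [flagsOf_map] at he⟩

end ExtendAut

section Positions

variable {d k : ℕ} {J : Finset (Fin d)}

theorem card_filter_lt_orderEmbOfFin (hJ : J.card = k) (j : Fin k) :
    (J.filter (· < J.orderEmbOfFin hJ j)).card = j := by
  have hfilter : J.filter (· < J.orderEmbOfFin hJ j) =
      (Finset.Iio j).map (J.orderEmbOfFin hJ).toEmbedding := by
    ext l
    constructor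
    · intro hl
      obtain ⟨hlJ, hlt⟩ := Finset.mem_filter.mp hl
      obtain ⟨i, rfl⟩ := (Finset.range_orderEmbOfFin J hJ).ge hlJ
      exact Finset.mem_map_of_mem _ (Finset.mem_Iio.mpr ((J.orderEmbOfFin hJ).lt_iff_lt.mp hlt))
    · intro hl
      obtain ⟨i, hi, rfl⟩ := Finset.mem_map.mp hl
      exact Finset.mem_filter.mpr ⟨J.orderEmbOfFin_mem hJ i,
        (J.orderEmbOfFin hJ).lt_iff_lt.mpr (Finset.mem_Iio.mp hi)⟩
  rw [hfilter, Finset.card_map, Fin.card_Iio]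

/-- The elements below `m` of the complement of `J`. If `J` is the position of a subspace with
respect to a flag, their number is the contribution of `m ∈ J` to the codimension of the set of
flags having this position. -/
def gaps (J : Finset (Fin d)) (m : Fin d) : Finset (Fin d) :=
  Finset.univ.filter fun l => l < m ∧ l ∉ J

theorem mem_gaps {l m : Fin d} : l ∈ gaps J m ↔ l < m ∧ l ∉ J := by
  simp [gaps]

theorem card_gaps_add (hJ : J.card = k) (j : Fin k) :
    (gaps J (J.orderEmbOfFin hJ j)).card + j = J.orderEmbOfFin hJ j := by
  set m := J.orderEmbOfFin hJ j
  have hgaps : gaps J m = (Finset.Iio m).filter (· ∉ J) := by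
    ext l
    simp [mem_gaps]
  have hbelow : J.filter (· < m) = (Finset.Iio m).filter (· ∈ J) := by
    ext l
    simp [and_comm]
  rw [← card_filter_lt_orderEmbOfFin hJ j, hbelow, hgaps, add_comm,
    Finset.card_filter_add_card_filter_not, Fin.card_Iio]

/-- Subspaces of dimension `k` with position `J` with respect to a flag satisfy the Schubert
condition `l`. -/
def IsSchubertPosition (k : ℕ) (l : ℕ → ℕ) (J : Finset (Fin d)) : Prop :=
  J.card = k ∧ ∀ j < k, j + 1 ≤ (J.filter fun m : Fin d => (m : ℕ) < d - k + (j + 1) - l j).card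

namespace IsSchubertPosition

variable {l : ℕ → ℕ}

theorem orderEmbOfFin_add_le (h : IsSchubertPosition k l J) (j : Fin k) :
    (J.orderEmbOfFin h.1 j : ℕ) + l j ≤ d - k + j := by
  by_contra! hlt
  have hsub : (J.filter fun m : Fin d => (m : ℕ) < d - k + (j + 1) - l j) ⊆
      J.filter (· < J.orderEmbOfFin h.1 j) :=
    Finset.monotone_filter_right J fun m _ hm => Fin.lt_def.mpr (by lia)
  have hcard := (h.2 j j.2).trans (Finset.card_le_card hsub)
  rw [card_filter_lt_orderEmbOfFin] at hcard
  lia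

theorem sum_card_gaps_add (h : IsSchubertPosition k l J) :
    ∑ m ∈ J, (gaps J m).card + ∑ j ∈ Finset.range k, l j =
      ∑ j : Fin k, ((gaps J (J.orderEmbOfFin h.1 j)).card + l j) := by
  conv_lhs => enter [1, 1]; rw [← Finset.map_orderEmbOfFin_univ J h.1]
  rw [Finset.sum_map, Finset.sum_range, Finset.sum_add_distrib]
  rfl

theorem card_gaps_add_le (h : IsSchubertPosition k l J) (j : Fin k) :
    (gaps J (J.orderEmbOfFin h.1 j)).card + l j ≤ d - k := by
  have := h.orderEmbOfFin_add_le j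
  have := card_gaps_add h.1 j
  lia

theorem sum_card_gaps_add_le (h : IsSchubertPosition k l J) :
    ∑ m ∈ J, (gaps J m).card + ∑ j ∈ Finset.range k, l j ≤ k * (d - k) := by
  rw [h.sum_card_gaps_add]
  exact (Finset.sum_le_card_nsmul _ _ _ fun j _ => h.card_gaps_add_le j).trans_eq (by simp)

theorem mem_iff (h : IsSchubertPosition k l J)
    (heq : ∑ m ∈ J, (gaps J m).card + ∑ j ∈ Finset.range k, l j = k * (d - k)) (m : Fin d) :
    m ∈ J ↔ ∃ j < k, (m : ℕ) + l j = d - k + j := by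
  have hconst : k * (d - k) = ∑ _j : Fin k, (d - k) := by simp
  rw [h.sum_card_gaps_add, hconst,
    Finset.sum_eq_sum_iff_of_le fun j _ => h.card_gaps_add_le j] at heq
  have hval (j : Fin k) : (J.orderEmbOfFin h.1 j : ℕ) + l j = d - k + j := by
    have := heq j (Finset.mem_univ j)
    have := card_gaps_add h.1 j
    lia
  rw [← Finset.mem_coe, ← Finset.range_orderEmbOfFin J h.1]
  constructor
  · rintro ⟨j, rfl⟩
    exact ⟨j, j.2, hval j⟩
  · rintro ⟨j, hj, hm⟩
    have := hval ⟨j, hj⟩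
    exact ⟨⟨j, hj⟩, Fin.ext (by lia)⟩

end IsSchubertPosition

end Positions

section Jumps

variable {K V : Type*} [Field K] [AddCommGroup V] [Module K V]

open Classical in
/-- The position of a subspace with respect to a flag: the indices at which the dimension of the
intersection jumps. -/
noncomputable def jumps (F : CompleteFlag K V) (H : Submodule K V) : Finset (Fin (finrank K V)) :=
  Finset.univ.filter fun m => finrank K ↥(H ⊓ F.sub m) < finrank K ↥(H ⊓ F.sub (m + 1))

theorem mem_jumps {F : CompleteFlag K V} {H : Submodule K V} {m : Fin (finrank K V)} :
    m ∈ jumps F H ↔ finrank K ↥(H ⊓ F.sub m) < finrank K ↥(H ⊓ F.sub (m + 1)) := by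
  simp [jumps]

theorem basis_mem_sub (f : Frame K V) {m : Fin (finrank K V)} {n : ℕ} (hmn : (m : ℕ) < n) :
    f m ∈ (CompleteFlag.ofBasis f).sub n :=
  Submodule.subset_span ⟨m, hmn, rfl⟩

theorem basis_notMem_sub (f : Frame K V) {m : Fin (finrank K V)} {n : ℕ} (hnm : n ≤ m) :
    f m ∉ (CompleteFlag.ofBasis f).sub n :=
  f.linearIndependent.notMem_span_image (s := {i | (i : ℕ) < n}) (by simpa using hnm)

theorem sub_succ_eq_span_sup (f : Frame K V) (m : Fin (finrank K V)) :
    (CompleteFlag.ofBasis f).sub (m + 1) = K ∙ f m ⊔ (CompleteFlag.ofBasis f).sub m := by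
  simp only [CompleteFlag.ofBasis]
  rw [← Submodule.span_union, Set.singleton_union, ← Set.image_insert_eq]
  congr 2
  ext i
  simp only [Set.mem_ofPred_eq, Set.mem_insert_iff, Fin.ext_iff]
  lia

theorem span_gaps_le_sub (f : Frame K V) (J : Finset (Fin (finrank K V)))
    (m : Fin (finrank K V)) :
    Submodule.span K (f '' gaps J m) ≤ (CompleteFlag.ofBasis f).sub m :=
  Submodule.span_mono (Set.image_mono fun _ hl => (mem_gaps.mp hl).1)

variable [FiniteDimensional K V]

theorem finrank_inf_add_le {A B : Submodule K V} (hAB : A ≤ B) (H : Submodule K V) :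
    finrank K ↥(H ⊓ B) + finrank K A ≤ finrank K ↥(H ⊓ A) + finrank K B := by
  have hadd := Submodule.finrank_sup_add_finrank_inf_eq (H ⊓ B) A
  rw [inf_assoc, inf_eq_right.mpr hAB] at hadd
  have hle : finrank K ↥((H ⊓ B) ⊔ A) ≤ finrank K B :=
    Submodule.finrank_mono (sup_le inf_le_right hAB)
  lia

theorem CompleteFlag.finrank_inf_sub_succ_le (F : CompleteFlag K V) (H : Submodule K V) (n : ℕ) :
    finrank K ↥(H ⊓ F.sub (n + 1)) ≤ finrank K ↥(H ⊓ F.sub n) + 1 := by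
  have := finrank_inf_add_le (F.mono n.le_succ) H
  simp only [F.finrank_sub] at this
  lia

theorem CompleteFlag.finrank_inf_sub_le_succ (F : CompleteFlag K V) (H : Submodule K V) (n : ℕ) :
    finrank K ↥(H ⊓ F.sub n) ≤ finrank K ↥(H ⊓ F.sub (n + 1)) :=
  Submodule.finrank_mono (inf_le_inf_left _ (F.mono n.le_succ))

theorem finrank_inf_sub_eq_card_jumps (F : CompleteFlag K V) (H : Submodule K V) (n : ℕ) :
    finrank K ↥(H ⊓ F.sub n) =
      ((jumps F H).filter fun m : Fin _ => (m : ℕ) < n).card := by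
  induction n with
  | zero => simp [F.sub_zero]
  | succ n ih =>
    rcases lt_or_ge n (finrank K V) with hn | hn
    · by_cases hjump : (⟨n, hn⟩ : Fin _) ∈ jumps F H
      · have hfilter : (jumps F H).filter (fun m : Fin _ => (m : ℕ) < n + 1) =
            insert ⟨n, hn⟩ ((jumps F H).filter fun m : Fin _ => (m : ℕ) < n) := by
          ext m
          simp only [Finset.mem_filter, Finset.mem_insert, Fin.ext_iff]
          grind
        rw [hfilter, Finset.card_insert_of_notMem (by simp), ← ih]
        exact (F.finrank_inf_sub_succ_le H n).antisymm (mem_jumps.mp hjump)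
      · have hfilter : (jumps F H).filter (fun m : Fin _ => (m : ℕ) < n + 1) =
            (jumps F H).filter fun m : Fin _ => (m : ℕ) < n := by
          refine Finset.filter_congr fun m hm => ?_
          have : (m : ℕ) ≠ n := by
            rintro rfl
            exact hjump hm
          lia
        rw [hfilter, ← ih]
        exact (not_lt.mp fun h => hjump (mem_jumps.mpr h)).antisymm (F.finrank_inf_sub_le_succ H n)
    · have hfilter : (jumps F H).filter (fun m : Fin _ => (m : ℕ) < n + 1) =
          (jumps F H).filter fun m : Fin _ => (m : ℕ) < n :=
        Finset.filter_congr fun m _ => by lia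
      rw [hfilter, ← ih, F.sub_eq_top hn, F.sub_eq_top (by lia)]

theorem card_jumps (F : CompleteFlag K V) (H : Submodule K V) :
    (jumps F H).card = finrank K H := by
  have := finrank_inf_sub_eq_card_jumps F H (finrank K V)
  rwa [F.sub_eq_top le_rfl, inf_top_eq, Finset.filter_true_of_mem fun m _ => m.2, eq_comm] at this

theorem isSchubertPosition_jumps {k : ℕ} {l : ℕ → ℕ} {F : CompleteFlag K V} {H : Submodule K V}
    (hH : H ∈ schubertVariety k l F) : IsSchubertPosition k l (jumps F H) :=
  ⟨(card_jumps F H).trans hH.1, fun j hj => by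
    rw [← finrank_inf_sub_eq_card_jumps]
    exact hH.2 j hj⟩

theorem mem_inf_sub_sup_of_mem_jumps {f : Frame K V} {H : Submodule K V} {m : Fin (finrank K V)}
    (hm : m ∈ jumps (CompleteFlag.ofBasis f) H) :
    f m ∈ (H ⊓ (CompleteFlag.ofBasis f).sub (m + 1)) ⊔ (CompleteFlag.ofBasis f).sub m := by
  set F := CompleteFlag.ofBasis f
  have hnle : ¬ H ⊓ F.sub (m + 1) ≤ H ⊓ F.sub m := fun hle =>
    (mem_jumps.mp hm).not_ge (Submodule.finrank_mono hle)
  obtain ⟨v, hv, hvm⟩ := SetLike.not_le_iff_exists.mp hnle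
  obtain ⟨_, hα, w, hw, rfl⟩ := Submodule.mem_sup.mp (sub_succ_eq_span_sup f m ▸ hv.2)
  obtain ⟨α, rfl⟩ := Submodule.mem_span_singleton.mp hα
  have hα₀ : α ≠ 0 := by
    rintro rfl
    exact hvm ⟨hv.1, by simpa using hw⟩
  have hαf : α • f m ∈ (H ⊓ F.sub (m + 1)) ⊔ F.sub m := by
    simpa using Submodule.sub_mem _ (Submodule.mem_sup_left hv) (Submodule.mem_sup_right hw)
  exact (Submodule.smul_mem_iff _ hα₀).mp hαf

theorem sub_le_inf_sup_span (f : Frame K V) (H : Submodule K V) (m : Fin (finrank K V)) :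
    (CompleteFlag.ofBasis f).sub m ≤ (H ⊓ (CompleteFlag.ofBasis f).sub m) ⊔
      Submodule.span K (f '' gaps (jumps (CompleteFlag.ofBasis f) H) m) := by
  set F := CompleteFlag.ofBasis f
  induction m using WellFoundedLT.induction with
  | ind m ih =>
    refine Submodule.span_le.mpr ?_
    rintro _ ⟨l, hlm, rfl⟩
    by_cases hl : l ∈ jumps F H
    · refine (sup_le ?_ ((ih l hlm).trans ?_)) (mem_inf_sub_sup_of_mem_jumps hl)
      · exact le_sup_of_le_left (inf_le_inf_left _ (F.mono hlm))
      · refine sup_le_sup (inf_le_inf_left _ (F.mono (le_of_lt hlm))) (Submodule.span_mono ?_)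
        exact Set.image_mono fun i hi => by
          rw [Finset.mem_coe, mem_gaps] at hi ⊢
          exact ⟨hi.1.trans hlm, hi.2⟩
    · exact Submodule.mem_sup_right
        (Submodule.subset_span ⟨l, Finset.mem_coe.mpr (mem_gaps.mpr ⟨hlm, hl⟩), rfl⟩)

theorem exists_mem_sub_mem_span_gaps {f : Frame K V} {H : Submodule K V} {m : Fin (finrank K V)}
    (hm : m ∈ jumps (CompleteFlag.ofBasis f) H) :
    ∃ h ∈ H, f m - h ∈ Submodule.span K (f '' gaps (jumps (CompleteFlag.ofBasis f) H) m) := by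
  obtain ⟨h, hh, w, hw, hhw⟩ := Submodule.mem_sup.mp (mem_inf_sub_sup_of_mem_jumps hm)
  obtain ⟨h', hh', y, hy, rfl⟩ := Submodule.mem_sup.mp (sub_le_inf_sup_span f H m hw)
  exact ⟨h + h', add_mem hh.1 hh'.1, by rwa [← hhw, ← add_assoc, add_sub_cancel_left]⟩

theorem span_range_eq_of_sub_mem_span_gaps {f : Frame K V} {H : Submodule K V}
    {J : Finset (Fin (finrank K V))} (hJ : J.card = finrank K H) {h : J → V}
    (hH : ∀ m, h m ∈ H) (hf : ∀ m : J, f m - h m ∈ Submodule.span K (f '' gaps J m)) :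
    Submodule.span K (Set.range h) = H := by
  set Z := Submodule.span K (f '' {l | l ∉ J})
  have hcomp : Z.mkQ ∘ h = Z.mkQ ∘ fun m : J => f m := by
    funext m
    refine ((Submodule.Quotient.eq Z).mpr ?_).symm
    exact Submodule.span_mono (Set.image_mono fun l hl => (mem_gaps.mp hl).2) (hf m)
  have hli : LinearIndependent K h := by
    apply LinearIndependent.of_comp Z.mkQ
    rw [hcomp]
    refine (f.linearIndependent.comp _ Subtype.val_injective).map ?_
    have hrange : Set.range (f ∘ (Subtype.val : J → _)) = f '' (J : Set _) := by
      ext y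
      simp
    rw [Submodule.ker_mkQ, hrange]
    exact f.linearIndependent.disjoint_span_image (Set.disjoint_left.mpr fun l hl hl' => hl' hl)
  refine Submodule.eq_of_le_of_finrank_le (Submodule.span_le.mpr ?_) ?_
  · rintro _ ⟨m, rfl⟩
    exact hH m
  · rw [finrank_span_eq_card hli, Fintype.card_coe, hJ]

end Jumps

section Cells

/-- Coordinates of the cell of pairs of an `s`-tuple of frames and a subspace having position
`J i` with respect to the `i`-th flag. The subspace is given by a basis indexed by `J i₀`, the
vectors of a frame at the indices outside `J i` are arbitrary, and those at the indices in `J i` are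
vectors of the subspace plus combinations of earlier arbitrary ones. The basis of the subspace is
chosen so that the coefficients of these vectors of the subspace are trivial for `i = i₀`. -/
inductive CellVar {s d : ℕ} (J : Fin s → Finset (Fin d)) (i₀ : Fin s) : Type
  | basisCoord (m : J i₀) (c : Fin d)
  | coeff (i : {i // i ≠ i₀}) (m : J i) (m' : J i₀)
  | freeCoord (i : Fin s) (m : ↥(J i)ᶜ) (c : Fin d)
  | corr (i : Fin s) (m : J i) (l : gaps (J i) m)

namespace CellVar

variable {s d : ℕ} {J : Fin s → Finset (Fin d)} {i₀ : Fin s}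

/-- `CellVar` as a sum of the argument types of its constructors, used to count it. -/
def equivSum : CellVar J i₀ ≃ (J i₀ × Fin d) ⊕ (Σ i : {i // i ≠ i₀}, J i × J i₀) ⊕
    (Σ i, ↥(J i)ᶜ × Fin d) ⊕ (Σ i, Σ m : J i, gaps (J i) m) where
  toFun
    | basisCoord m c => .inl (m, c)
    | coeff i m m' => .inr (.inl ⟨i, m, m'⟩)
    | freeCoord i m c => .inr (.inr (.inl ⟨i, m, c⟩))
    | corr i m l => .inr (.inr (.inr ⟨i, m, l⟩))
  invFun
    | .inl (m, c) => basisCoord m c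
    | .inr (.inl ⟨i, m, m'⟩) => coeff i m m'
    | .inr (.inr (.inl ⟨i, m, c⟩)) => freeCoord i m c
    | .inr (.inr (.inr ⟨i, m, l⟩)) => corr i m l
  left_inv := by rintro (_ | _ | _ | _) <;> rfl
  right_inv := by rintro (_ | _ | _ | _) <;> rfl

instance : Fintype (CellVar J i₀) := Fintype.ofEquiv _ equivSum.symm

theorem card_add {k : ℕ} (hJ : ∀ i, (J i).card = k) :
    Fintype.card (CellVar J i₀) + k * k =
      k * d + s * (k * k) + s * ((d - k) * d) + ∑ i, ∑ m ∈ J i, (gaps (J i) m).card := by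
  obtain ⟨s, rfl⟩ : ∃ s', s = s' + 1 := ⟨s - 1, by have := i₀.2; lia⟩
  simp only [Fintype.card_congr equivSum, Fintype.card_sum, Fintype.card_prod, Fintype.card_sigma,
    Fintype.card_coe, Finset.card_compl, hJ, Fintype.card_fin, Finset.card_univ, Finset.sum_const,
    Fintype.card_subtype_compl, Fintype.card_unique, smul_eq_mul, Nat.add_sub_cancel,
    ← Finset.sum_coe_sort (J _)]
  ring

theorem card_add_le {k : ℕ} {lam : Fin s → ℕ → ℕ}
    (hJ : ∀ i, IsSchubertPosition k (lam i) (J i)) :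
    Fintype.card (CellVar J i₀) + ∑ i, ∑ j ∈ Finset.range k, lam i j ≤
      s * (d * d) + k * (d - k) := by
  have hkd : k ≤ d := by simpa [(hJ i₀).1] using Finset.card_le_univ (J i₀)
  have hsum := Finset.sum_le_sum fun i (_ : i ∈ Finset.univ) => (hJ i).sum_card_gaps_add_le
  have hcard := card_add (i₀ := i₀) fun i => (hJ i).1
  simp only [Finset.sum_add_distrib, Finset.sum_const, Finset.card_univ, Fintype.card_fin,
    smul_eq_mul] at hsum
  obtain ⟨e, rfl⟩ := Nat.exists_eq_add_of_le hkd
  simp only [Nat.add_sub_cancel_left] at hsum hcard ⊢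
  have : s * ((k + e) * (k + e)) = s * (k * k) + s * (e * (k + e)) + s * (k * e) := by ring
  have : k * (k + e) = k * k + k * e := by ring
  lia

theorem mem_iff_of_card_add {k : ℕ} {lam : Fin s → ℕ → ℕ}
    (hJ : ∀ i, IsSchubertPosition k (lam i) (J i))
    (h : Fintype.card (CellVar J i₀) + ∑ i, ∑ j ∈ Finset.range k, lam i j =
      s * (d * d) + k * (d - k)) (i : Fin s) (m : Fin d) :
    m ∈ J i ↔ ∃ j < k, (m : ℕ) + lam i j = d - k + j := by
  have hkd : k ≤ d := by simpa [(hJ i₀).1] using Finset.card_le_univ (J i₀)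
  have hcard := card_add (i₀ := i₀) fun i => (hJ i).1
  have hsum : ∑ i, (∑ m ∈ J i, (gaps (J i) m).card + ∑ j ∈ Finset.range k, lam i j) =
      ∑ _i : Fin s, k * (d - k) := by
    simp only [Finset.sum_add_distrib, Finset.sum_const, Finset.card_univ, Fintype.card_fin,
      smul_eq_mul]
    obtain ⟨e, rfl⟩ := Nat.exists_eq_add_of_le hkd
    simp only [Nat.add_sub_cancel_left] at h hcard ⊢
    have : s * ((k + e) * (k + e)) = s * (k * k) + s * (e * (k + e)) + s * (k * e) := by ring
    have : k * (k + e) = k * k + k * e := by ring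
    lia
  exact (hJ i).mem_iff ((Finset.sum_eq_sum_iff_of_le fun i _ => (hJ i).sum_card_gaps_add_le).mp
    hsum i (Finset.mem_univ i)) m

variable {A B : Type*} [CommRing A] [CommRing B]

/-- The vectors of the basis of the subspace with the given cell coordinates. -/
def basis (x : CellVar J i₀ → A) (m : J i₀) : Fin d → A := fun c => x (.basisCoord m c)

/-- The vector of the subspace used for the frame vector at `m ∈ J i`. -/
def solution (x : CellVar J i₀ → A) (i : Fin s) (m : J i) : Fin d → A :=
  if hi : i = i₀ then basis x ⟨m, hi ▸ m.2⟩ else ∑ m', x (.coeff ⟨i, hi⟩ m m') • basis x m'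

/-- The frame vectors with the given cell coordinates. -/
def frame (x : CellVar J i₀ → A) (i : Fin s) (m : Fin d) : Fin d → A :=
  if hm : m ∈ J i then
    solution x i ⟨m, hm⟩ + ∑ l : gaps (J i) m,
      x (.corr i ⟨m, hm⟩ l) • fun c => x (.freeCoord i ⟨l, by simp [(mem_gaps.mp l.2).2]⟩ c)
  else fun c => x (.freeCoord i ⟨m, by simpa using hm⟩ c)

theorem frame_of_notMem (x : CellVar J i₀ → A) {i : Fin s} {m : Fin d} (hm : m ∉ J i) (c : Fin d) :
    frame x i m c = x (.freeCoord i ⟨m, by simpa using hm⟩ c) := by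
  rw [frame, dif_neg hm]

theorem frame_of_mem (x : CellVar J i₀ → A) {i : Fin s} (m : J i) :
    frame x i m = solution x i m + ∑ l : gaps (J i) m, x (.corr i m l) • frame x i l := by
  rw [frame, dif_pos m.2]
  congr 1
  refine Finset.sum_congr rfl fun l _ => congrArg _ (funext fun c => ?_)
  rw [frame_of_notMem x (mem_gaps.mp l.2).2]

theorem solution_self (x : CellVar J i₀ → A) (m : J i₀) : solution x i₀ m = basis x m := by
  rw [solution, dif_pos rfl]

theorem solution_of_ne (x : CellVar J i₀ → A) {i : Fin s} (hi : i ≠ i₀) (m : J i) :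
    solution x i m = ∑ m', x (.coeff ⟨i, hi⟩ m m') • basis x m' := by
  rw [solution, dif_neg hi]

theorem map_solution (φ : A →+* B) (x : CellVar J i₀ → A) (i : Fin s) (m : J i) (c : Fin d) :
    φ (solution x i m c) = solution (φ ∘ x) i m c := by
  by_cases hi : i = i₀
  · subst hi
    simp only [solution_self, basis, Function.comp_apply]
  · simp [solution_of_ne _ hi, basis]

theorem map_frame (φ : A →+* B) (x : CellVar J i₀ → A) (i : Fin s) (m c : Fin d) :
    φ (frame x i m c) = frame (φ ∘ x) i m c := by
  by_cases hm : m ∈ J i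
  · simp [frame, hm, map_solution]
  · simp [frame_of_notMem _ hm]

theorem aeval_aeval_frame {K : Type*} [Field K] (x : CellVar J i₀ → K)
    (p : MvPolynomial (Fin s × Fin d × Fin d) K) :
    MvPolynomial.aeval x (MvPolynomial.aeval
      (fun y => frame (MvPolynomial.X : _ → MvPolynomial (CellVar J i₀) K) y.1 y.2.1 y.2.2) p) =
      MvPolynomial.eval (fun y => frame x y.1 y.2.1 y.2.2) p := by
  rw [← AlgHom.comp_apply, MvPolynomial.comp_aeval, ← MvPolynomial.coe_aeval_eq_eval]
  simp only [RingHom.coe_coe]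
  congr 2
  funext y
  refine (map_frame (MvPolynomial.aeval x : _ →ₐ[K] K).toRingHom _ _ _ _).trans ?_
  congr 1
  funext t
  simp

end CellVar

variable {K V : Type*} [Field K] [AddCommGroup V] [Module K V] [FiniteDimensional K V] {s : ℕ}
  {J : Fin s → Finset (Fin (finrank K V))} {i₀ : Fin s}

variable (K V) in
/-- The vector of `V` with the given coordinates with respect to the reference basis. -/
noncomputable def ofCoords : (Fin (finrank K V) → K) ≃ₗ[K] V :=
  (finBasis K V).equivFun.symm

theorem repr_ofCoords (v : Fin (finrank K V) → K) (c : Fin (finrank K V)) :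
    (finBasis K V).repr (ofCoords K V v) c = v c :=
  congrFun ((finBasis K V).equivFun.apply_symm_apply v) c

/-- `x` are the coordinates of the tuple of frames `f` and the subspace `H` in the cell in which
`H` has position `J i` with respect to the `i`-th flag. -/
structure IsCell (x : CellVar J i₀ → K) (f : Fin s → Frame K V) (H : Submodule K V) : Prop where
  finrank_inf : ∀ i n, finrank K ↥(H ⊓ (flagsOf f i).sub n) =
    ((J i).filter fun m : Fin _ => (m : ℕ) < n).card
  span_eq : Submodule.span K (Set.range fun m => ofCoords K V (CellVar.basis x m)) = H
  frame_eq : ∀ i m, f i m = ofCoords K V (CellVar.frame x i m)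

theorem exists_isCell (i₀ : Fin s) (f : Fin s → Frame K V) (H : Submodule K V) :
    ∃ x : CellVar (fun i => jumps (flagsOf f i) H) i₀ → K, IsCell x f H := by
  set J := fun i => jumps (flagsOf f i) H
  choose h hH hgaps using fun i (m : J i) => exists_mem_sub_mem_span_gaps m.2
  have hgaps (i) (m : J i) : f i m - h i m ∈ Submodule.span K (f i '' gaps (J i) m) := hgaps i m
  choose c hc using fun i m => (Submodule.mem_span_image_finset_iff_exists_fun K).mp (hgaps i m)
  have hspan : Submodule.span K (Set.range (h i₀)) = H :=
    span_range_eq_of_sub_mem_span_gaps (card_jumps _ H) (hH i₀) (hgaps i₀)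
  choose T hT using fun i m =>
    (Submodule.mem_span_range_iff_exists_fun K).mp (hspan.symm ▸ hH i m)
  let x : CellVar J i₀ → K
    | .basisCoord m c => (finBasis K V).repr (h i₀ m) c
    | .coeff i m m' => T i m m'
    | .freeCoord i m c => (finBasis K V).repr (f i m) c
    | .corr i m l => c i m l
  have hbasis (m) : ofCoords K V (CellVar.basis x m) = h i₀ m :=
    (finBasis K V).equivFun.symm_apply_apply _
  have hsolution (i m) : ofCoords K V (CellVar.solution x i m) = h i m := by
    by_cases hi : i = i₀
    · subst hi
      rw [CellVar.solution_self, hbasis]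
    · simp only [CellVar.solution_of_ne x hi, map_sum, map_smul, hbasis]
      exact hT i m
  have hfree {i m} (hm : m ∉ J i) : ofCoords K V (CellVar.frame x i m) = f i m :=
    (finBasis K V).repr.injective (Finsupp.ext fun c => by
      rw [repr_ofCoords, CellVar.frame_of_notMem x hm])
  refine ⟨x, fun i n => finrank_inf_sub_eq_card_jumps _ H n, ?_, fun i m => ?_⟩
  · simp only [hbasis, hspan]
  · by_cases hm : m ∈ J i
    · have hcorr : ∑ l : gaps (J i) m, c i ⟨m, hm⟩ l • ofCoords K V (CellVar.frame x i l) =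
          f i m - h i ⟨m, hm⟩ := by
        refine .trans (Finset.sum_congr rfl fun l _ => ?_) (hc i ⟨m, hm⟩)
        rw [hfree (mem_gaps.mp l.2).2]
      rw [CellVar.frame_of_mem x ⟨m, hm⟩, map_add, hsolution, map_sum]
      simp only [map_smul]
      exact (eq_add_of_sub_eq' hcorr.symm)
    · exact (hfree hm).symm

namespace IsCell

variable {x : CellVar J i₀ → K} {f : Fin s → Frame K V} {H : Submodule K V} (hx : IsCell x f H)

include hx

theorem evalFrames_eq (p : FramePolynomial K V s) :
    evalFrames p f = MvPolynomial.aeval x (MvPolynomial.aeval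
      (fun y => CellVar.frame (.X : _ → MvPolynomial (CellVar J i₀) K) y.1 y.2.1 y.2.2) p) := by
  simp only [CellVar.aeval_aeval_frame, evalFrames, hx.frame_eq, repr_ofCoords]

theorem basis_mem (m : J i₀) : ofCoords K V (CellVar.basis x m) ∈ H :=
  hx.span_eq.le (Submodule.subset_span (Set.mem_range_self m))

theorem solution_mem (i : Fin s) (m : J i) : ofCoords K V (CellVar.solution x i m) ∈ H := by
  by_cases hi : i = i₀
  · subst hi
    exact CellVar.solution_self x m ▸ hx.basis_mem m
  · simp only [CellVar.solution_of_ne x hi, map_sum, map_smul]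
    exact sum_mem fun m' _ => Submodule.smul_mem _ _ (hx.basis_mem m')

theorem sub_solution_mem_span_gaps (i : Fin s) (m : J i) :
    f i m - ofCoords K V (CellVar.solution x i m) ∈ Submodule.span K (f i '' gaps (J i) m) := by
  rw [hx.frame_eq, CellVar.frame_of_mem, map_add, add_sub_cancel_left, map_sum]
  refine sum_mem fun l _ => ?_
  rw [map_smul, ← hx.frame_eq]
  exact Submodule.smul_mem _ _ (Submodule.subset_span ⟨l, l.2, rfl⟩)

theorem solution_mem_sub_iff {i : Fin s} {m : J i} {n : ℕ} :
    ofCoords K V (CellVar.solution x i m) ∈ (flagsOf f i).sub n ↔ (m : ℕ) < n := by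
  have hm := span_gaps_le_sub _ _ _ (hx.sub_solution_mem_span_gaps i m)
  refine ⟨fun hmem => ?_, fun hmn => ?_⟩
  · by_contra! hnm
    exact basis_notMem_sub (f i) le_rfl
      ((Submodule.sub_mem_iff_left _ ((flagsOf f i).mono hnm hmem)).mp hm)
  · exact (Submodule.sub_mem_iff_right _ (basis_mem_sub (f i) hmn)).mp
      ((flagsOf f i).mono hmn.le hm)

theorem basis_mem_sub_iff {m : J i₀} {n : ℕ} :
    ofCoords K V (CellVar.basis x m) ∈ (flagsOf f i₀).sub n ↔ (m : ℕ) < n :=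
  CellVar.solution_self x m ▸ hx.solution_mem_sub_iff

end IsCell

variable [Infinite K] {k : ℕ} {lam : Fin s → ℕ → ℕ}
  {Bad : (Fin s → CompleteFlag K V) → Submodule K V → Prop}

theorem generally_forall_solutions_not (i₀ : Fin s)
    (hbad : ∀ J : Fin s → Finset (Fin (finrank K V)),
      (∀ i, IsSchubertPosition k (lam i) (J i)) → ∃ r : FramePolynomial K V s, r ≠ 0 ∧
        ∀ (x : CellVar J i₀ → K) f H, IsCell x f H → Bad (flagsOf f) H → evalFrames r f = 0) :
    Generally fun F : Fin s → CompleteFlag K V => ∀ H ∈ solutions k lam F, ¬ Bad F H := by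
  classical
  choose! r hr hr' using hbad
  refine generally_iff.mpr ⟨∏ J with ∀ i, IsSchubertPosition k (lam i) (J i), r J,
    Finset.prod_ne_zero_iff.mpr fun J hJ => hr J (Finset.mem_filter.mp hJ).2,
    fun f hf H hH hB => ?_⟩
  have hJ (i) : IsSchubertPosition k (lam i) (jumps (flagsOf f i) H) :=
    isSchubertPosition_jumps (hH.2 i)
  obtain ⟨x, hx⟩ := exists_isCell i₀ f H
  rw [evalFrames, map_prod] at hf
  exact Finset.prod_ne_zero_iff.mp hf _ (Finset.mem_filter.mpr ⟨Finset.mem_univ _, hJ⟩)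
    (hr' _ hJ x f H hx hB)

/-- If the Schubert conditions have codimension at least the dimension of the Grassmannian, the
cells of pairs of an instance and a solution map to the space of tuples of frames, whose dimension
is at least theirs; the only ones that can dominate it are those of generic position. So it
suffices that the bad locus is a proper closed subset of these. -/
theorem generally_forall_solutions_not_of_le_sum (i₀ : Fin s)
    (hsum : k * (finrank K V - k) ≤ ∑ i, ∑ j ∈ Finset.range k, lam i j)
    (hbad : ∑ i, ∑ j ∈ Finset.range k, lam i j = k * (finrank K V - k) →
      ∀ J : Fin s → Finset (Fin (finrank K V)), (∀ i, (J i).card = k) →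
        (∀ i m, m ∈ J i ↔ ∃ j < k, (m : ℕ) + lam i j = finrank K V - k + j) →
        ∃ q : MvPolynomial (CellVar J i₀) K, q ≠ 0 ∧
          ∀ x f H, IsCell x f H → Bad (flagsOf f) H → MvPolynomial.aeval x q = 0) :
    Generally fun F : Fin s → CompleteFlag K V => ∀ H ∈ solutions k lam F, ¬ Bad F H := by
  refine generally_forall_solutions_not i₀ fun J hJ => ?_
  have hcard := CellVar.card_add_le (i₀ := i₀) hJ
  rcases lt_or_ge (Fintype.card (CellVar J i₀)) (s * (finrank K V * finrank K V)) with hlt | hge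
  · obtain ⟨r, hr, hr0⟩ := exists_ne_zero_aeval_eq_zero
      (fun y : Fin s × Fin (finrank K V) × Fin (finrank K V) =>
        CellVar.frame (.X : _ → MvPolynomial (CellVar J i₀) K) y.1 y.2.1 y.2.2) (by simpa using hlt)
    refine ⟨r, hr, fun x f H hx _ => ?_⟩
    rw [hx.evalFrames_eq, hr0, map_zero]
  · have heq : ∑ i, ∑ j ∈ Finset.range k, lam i j = k * (finrank K V - k) := by lia
    obtain ⟨q, hq, hq0⟩ := hbad heq J (fun i => (hJ i).1)
      (CellVar.mem_iff_of_card_add (i₀ := i₀) hJ (by lia))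
    obtain ⟨r, hr, q', hq'⟩ := exists_ne_zero_dvd_aeval
      (fun y : Fin s × Fin (finrank K V) × Fin (finrank K V) =>
        CellVar.frame (.X : _ → MvPolynomial (CellVar J i₀) K) y.1 y.2.1 y.2.2)
      (by simp; lia) hq
    refine ⟨r, hr, fun x f H hx hB => ?_⟩
    rw [hx.evalFrames_eq, hq', map_mul, hq0 x f H hx hB, zero_mul]

theorem generally_solutions_eq_empty
    (hsum : k * (finrank K V - k) < ∑ i, ∑ j ∈ Finset.range k, lam i j) :
    Generally fun F : Fin s → CompleteFlag K V => solutions k lam F = ∅ := by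
  obtain ⟨i₀⟩ : Nonempty (Fin s) := by
    by_contra hs
    simp [not_nonempty_iff.mp hs] at hsum
  have := generally_forall_solutions_not_of_le_sum (K := K) (V := V) (Bad := fun _ _ => True) i₀
    hsum.le fun heq => absurd heq hsum.ne'
  exact this.mono fun F hF => Set.eq_empty_of_forall_notMem fun H hH => hF H hH trivial

end Cells

section GeneralPosition

variable {K V : Type*} [Field K] [AddCommGroup V] [Module K V] [FiniteDimensional K V] {s k : ℕ}
  {J : Fin s → Finset (Fin (finrank K V))} {i₀ i₁ : Fin s} {lam : Fin s → ℕ → ℕ}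

theorem IsCell.inf_sub_inf_sub_eq_bot {x : CellVar J i₀ → K} {f : Fin s → Frame K V}
    {H : Submodule K V} (hx : IsCell x f H) (hi : i₁ ≠ i₀) {a : J i₁} {b : J i₀} {m₀ m₁ : ℕ}
    (ha : ∀ m ∈ J i₁, (m : ℕ) < m₁ ↔ m = a) (hb : ∀ m ∈ J i₀, (m : ℕ) < m₀ ↔ m ≠ b)
    (hxab : x (.coeff ⟨i₁, hi⟩ a b) ≠ 0) :
    H ⊓ (flagsOf f i₁).sub m₁ ⊓ (flagsOf f i₀).sub m₀ = ⊥ := by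
  by_contra hne
  have hline : finrank K ↥(H ⊓ (flagsOf f i₁).sub m₁) = 1 := by
    rw [hx.finrank_inf, Finset.card_eq_one]
    refine ⟨a, Finset.ext fun m => ?_⟩
    rw [Finset.mem_filter, Finset.mem_singleton]
    exact ⟨fun h => (ha m h.1).mp h.2, fun h => h ▸ ⟨a.2, (ha a a.2).mpr rfl⟩⟩
  have hle : H ⊓ (flagsOf f i₁).sub m₁ ≤ (flagsOf f i₀).sub m₀ := by
    have hpos := Submodule.one_le_finrank_iff.mpr hne
    exact inf_eq_left.mp (Submodule.eq_of_le_of_finrank_le inf_le_left (hline.trans_le hpos))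
  have hsum : ofCoords K V (CellVar.solution x i₁ a) ∈ (flagsOf f i₀).sub m₀ :=
    hle ⟨hx.solution_mem i₁ a, hx.solution_mem_sub_iff.mpr ((ha a a.2).mpr rfl)⟩
  simp only [CellVar.solution_of_ne x hi, map_sum, map_smul] at hsum
  rw [← Finset.add_sum_erase _ _ (Finset.mem_univ b)] at hsum
  have hrest : ∑ m' ∈ Finset.univ.erase b,
      x (.coeff ⟨i₁, hi⟩ a m') • ofCoords K V (CellVar.basis x m') ∈ (flagsOf f i₀).sub m₀ :=
    sum_mem fun m' hm' => Submodule.smul_mem _ _ <| hx.basis_mem_sub_iff.mpr <|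
      (hb _ (Subtype.property m')).mpr (Subtype.coe_injective.ne (Finset.ne_of_mem_erase hm'))
  have hbterm := (Submodule.smul_mem_iff _ hxab).mp ((Submodule.add_mem_iff_left _ hrest).mp hsum)
  exact (hb b b.2).mp (hx.basis_mem_sub_iff.mp hbterm) rfl

theorem generally_inf_sub_inf_sub_eq_bot [Infinite K] (hk : k ≤ finrank K V) (hk2 : 2 ≤ k)
    (hi : i₁ ≠ i₀) (hlam : ∀ i, IsPartitionFor k (finrank K V) (lam i))
    (hsum : k * (finrank K V - k) ≤ ∑ i, ∑ j ∈ Finset.range k, lam i j) {m₀ m₁ : ℕ}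
    (hm₁ : m₁ + lam i₁ 0 = finrank K V - k + 1) (hm₀ : m₀ + lam i₀ (k - 2) = finrank K V - 1) :
    Generally fun F : Fin s → CompleteFlag K V => ∀ H ∈ solutions k lam F,
      H ⊓ (F i₁).sub m₁ ⊓ (F i₀).sub m₀ = ⊥ := by
  have hanti {i j j'} (h : j ≤ j') : lam i j' ≤ lam i j := (hlam i).1 h
  have hle (i) : lam i 0 ≤ finrank K V - k := (hlam i).2.1
  refine (generally_forall_solutions_not_of_le_sum (Bad := fun F H => H ⊓ (F i₁).sub m₁ ⊓
    (F i₀).sub m₀ ≠ ⊥) i₀ hsum fun _ J _ hJ => ?_).mono fun F hF H hH => not_not.mp (hF H hH)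
  have hlast : lam i₀ (k - 1) ≤ lam i₀ (k - 2) := hanti (by lia)
  have := hle i₀
  have := hle i₁
  obtain ⟨a, ha⟩ : ∃ a : Fin (finrank K V), (a : ℕ) + lam i₁ 0 = finrank K V - k :=
    ⟨⟨finrank K V - k - lam i₁ 0, by lia⟩, by simp only; lia⟩
  obtain ⟨b, hb⟩ : ∃ b : Fin (finrank K V), (b : ℕ) + lam i₀ (k - 1) = finrank K V - 1 :=
    ⟨⟨finrank K V - 1 - lam i₀ (k - 1), by lia⟩, by simp only; lia⟩
  have haJ : a ∈ J i₁ := (hJ i₁ a).mpr ⟨0, by lia, ha⟩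
  have hbJ : b ∈ J i₀ := (hJ i₀ b).mpr ⟨k - 1, by lia, by lia⟩
  refine ⟨.X (.coeff ⟨i₁, hi⟩ ⟨a, haJ⟩ ⟨b, hbJ⟩), MvPolynomial.X_ne_zero _,
    fun x f H hx hB => ?_⟩
  rw [MvPolynomial.aeval_X]
  by_contra hxab
  refine hB (hx.inf_sub_inf_sub_eq_bot hi (fun m hm => ?_) (fun m hm => ?_) hxab)
  · obtain ⟨j, -, hmj⟩ := (hJ i₁ m).mp hm
    have : lam i₁ j ≤ lam i₁ 0 := hanti j.zero_le
    rw [Fin.ext_iff]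
    lia
  · obtain ⟨j, hj, hmj⟩ := (hJ i₀ m).mp hm
    rw [Ne, Fin.ext_iff]
    rcases (Nat.le_sub_one_of_lt hj).eq_or_lt with rfl | hj'
    · lia
    · have : lam i₀ (k - 2) ≤ lam i₀ j := hanti (by lia)
      lia

/-- The basis of the subspace and frame vectors outside the positions are free coordinates, hence
linearly independent outside the zero locus of a determinant. -/
theorem exists_ne_zero_aeval_eq_zero_of_not_linearIndependent {ι : Type*} [Fintype ι]
    {e : ι → Σ i, ↥(J i)ᶜ} (he : Function.Injective e)
    (hcard : (J i₀).card + Fintype.card ι ≤ finrank K V) :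
    ∃ q : MvPolynomial (CellVar J i₀) K, q ≠ 0 ∧
      ∀ (x : CellVar J i₀ → K) (f : Fin s → Frame K V) (H : Submodule K V), IsCell x f H →
        ¬ LinearIndependent K (Sum.elim (fun m : J i₀ => ofCoords K V (CellVar.basis x m))
          fun t => f (e t).1 (e t).2) → MvPolynomial.aeval x q = 0 := by
  classical
  obtain ⟨col⟩ : Nonempty (J i₀ ⊕ ι ↪ Fin (finrank K V)) :=
    Function.Embedding.nonempty_of_card_le (by simpa)
  let v : (J i₀ ⊕ ι) × (J i₀ ⊕ ι) → CellVar J i₀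
    | (.inl m, c) => .basisCoord m (col c)
    | (.inr t, c) => .freeCoord (e t).1 (e t).2 (col c)
  have hv : Function.Injective v := by
    rintro ⟨m | t, c⟩ ⟨m' | t', c'⟩ h
    · simpa [v] using h
    · simp [v] at h
    · simp [v] at h
    · simp only [v, CellVar.freeCoord.injEq, EmbeddingLike.apply_eq_iff_eq] at h
      rw [he (Sigma.ext h.1 h.2.1), h.2.2]
  refine ⟨.rename v (Matrix.mvPolynomialX (J i₀ ⊕ ι) (J i₀ ⊕ ι) K).det,
    (map_ne_zero_iff _ (MvPolynomial.rename_injective v hv)).mpr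
      (Matrix.det_mvPolynomialX_ne_zero _ K), fun x f H hx hli => ?_⟩
  set w := Sum.elim (fun m : J i₀ => ofCoords K V (CellVar.basis x m)) fun t => f (e t).1 (e t).2
  let P : V →ₗ[K] (J i₀ ⊕ ι → K) := LinearMap.pi fun c => (finBasis K V).coord (col c)
  have hP : P ∘ w = (Matrix.of fun r c => x (v (r, c))).row := by
    funext r c
    rcases r with m | t
    · exact repr_ofCoords _ _
    · simp only [w, P, Function.comp_apply, Sum.elim_inr, hx.frame_eq, LinearMap.pi_apply,
        Basis.coord_apply, repr_ofCoords]
      exact CellVar.frame_of_notMem x (Finset.mem_compl.mp (e t).2.2) _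
  have hdet : MvPolynomial.aeval x (MvPolynomial.rename v
      (Matrix.mvPolynomialX (J i₀ ⊕ ι) (J i₀ ⊕ ι) K).det) =
      (Matrix.of fun r c => x (v (r, c))).det := by
    rw [MvPolynomial.aeval_rename, AlgHom.map_det]
    congr 1
    ext r c
    simp [Matrix.mvPolynomialX]
  rw [hdet]
  by_contra hne
  refine hli (LinearIndependent.of_comp P ?_)
  rw [hP, Matrix.linearIndependent_rows_iff_isUnit, Matrix.isUnit_iff_isUnit_det]
  exact Ne.isUnit hne

theorem IsCell.not_sub_le_sub_sup {x : CellVar J i₀ → K} {f : Fin s → Frame K V}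
    {H : Submodule K V} (hx : IsCell x f H) {z : Fin (finrank K V)} {m₀ m₁ : ℕ} (hz : (z : ℕ) < m₀)
    (hli : LinearIndependent K (Sum.elim (fun m : J i₀ => ofCoords K V (CellVar.basis x m))
      fun t : Option {m : ↥(J i₁)ᶜ // (m : ℕ) < m₁} => t.elim (f i₀ z) fun m => f i₁ m)) :
    ¬ (flagsOf f i₀).sub m₀ ≤ (flagsOf f i₁).sub m₁ ⊔ H := by
  set w := Sum.elim (fun m : J i₀ => ofCoords K V (CellVar.basis x m))
    fun t : Option {m : ↥(J i₁)ᶜ // (m : ℕ) < m₁} => t.elim (f i₀ z) fun m => f i₁ m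
  set S := Submodule.span K (w '' {r | r ≠ .inr none})
  have hHS : H ≤ S := hx.span_eq.ge.trans <| Submodule.span_mono <| by
    rintro _ ⟨m, rfl⟩
    exact ⟨.inl m, by simp, rfl⟩
  have hfree {m} (hmJ : m ∉ J i₁) (hm : (m : ℕ) < m₁) : f i₁ m ∈ S :=
    Submodule.subset_span
      ⟨.inr (some ⟨⟨m, Finset.mem_compl.mpr hmJ⟩, hm⟩), by simp, rfl⟩
  have hF : (flagsOf f i₁).sub m₁ ≤ S := Submodule.span_le.mpr <| by
    rintro _ ⟨m, hm, rfl⟩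
    by_cases hmJ : m ∈ J i₁
    · have hgaps : Submodule.span K (f i₁ '' gaps (J i₁) m) ≤ S := Submodule.span_le.mpr <| by
        rintro _ ⟨l, hl, rfl⟩
        have hl := mem_gaps.mp hl
        exact hfree hl.2 (lt_trans hl.1 hm)
      exact (Submodule.sub_mem_iff_left _ (hHS (hx.solution_mem i₁ ⟨m, hmJ⟩))).mp
        (hgaps (hx.sub_solution_mem_span_gaps i₁ ⟨m, hmJ⟩))
    · exact hfree hmJ hm
  exact fun hle => hli.notMem_span_image (s := {r | r ≠ .inr none}) (x := .inr none) (by simp)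
    (sup_le hF hHS (hle (basis_mem_sub (f i₀) hz)))

theorem generally_not_sub_two_le_sub_five_sup [Infinite K] (hk : k + 4 ≤ finrank K V)
    (hk2 : 2 ≤ k) (hi : i₁ ≠ i₀) (hlam : ∀ i, IsPartitionFor k (finrank K V) (lam i))
    (hsum : k * (finrank K V - k) ≤ ∑ i, ∑ j ∈ Finset.range k, lam i j)
    (h₀ : lam i₀ 0 < finrank K V - k) (h₁ : lam i₁ 0 + 3 = finrank K V - k)
    (h₁' : lam i₁ 1 + 3 = finrank K V - k) :
    Generally fun F : Fin s → CompleteFlag K V => ∀ H ∈ solutions k lam F,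
      ¬ (F i₀).sub 2 ≤ (F i₁).sub 5 ⊔ H := by
  refine generally_forall_solutions_not_of_le_sum i₀ hsum fun _ J hcard hJ => ?_
  have hle (i j) : lam i j ≤ lam i 0 := (hlam i).1 j.zero_le
  let z : Fin (finrank K V) := ⟨0, by lia⟩
  have hz : z ∈ (J i₀)ᶜ := by
    rw [Finset.mem_compl, hJ]
    rintro ⟨j, -, hj⟩
    have := hle i₀ j
    simp only [z] at hj
    lia
  have hthree (m : {m : ↥(J i₁)ᶜ // (m : ℕ) < 5}) : (m : ℕ) < 3 := by
    by_contra! h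
    refine Finset.mem_compl.mp m.1.2 ((hJ i₁ _).mpr ?_)
    rcases h.eq_or_lt with h | h
    · exact ⟨0, by lia, by lia⟩
    · exact ⟨1, by lia, by have := m.2; lia⟩
  have hcard₁ : Fintype.card {m : ↥(J i₁)ᶜ // (m : ℕ) < 5} ≤ 3 := by
    simpa using Fintype.card_le_of_injective
      (fun m : {m : ↥(J i₁)ᶜ // (m : ℕ) < 5} => (⟨_, hthree m⟩ : Fin 3))
      fun m m' h => Subtype.ext (Subtype.ext (Fin.ext (Fin.mk.inj h)))
  let e : Option {m : ↥(J i₁)ᶜ // (m : ℕ) < 5} → Σ i, ↥(J i)ᶜ :=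
    fun t => t.elim ⟨i₀, z, hz⟩ fun m => ⟨i₁, m.1⟩
  have he : Function.Injective e := by
    rintro (_ | m) (_ | m') h
    · rfl
    · exact absurd (congrArg Sigma.fst h) hi.symm
    · exact absurd (congrArg Sigma.fst h) hi
    · exact congrArg some (Subtype.ext (eq_of_heq (Sigma.mk.inj h).2))
  obtain ⟨q, hq, hq0⟩ := exists_ne_zero_aeval_eq_zero_of_not_linearIndependent (i₀ := i₀) he
    (by rw [Fintype.card_option, hcard]; lia)
  refine ⟨q, hq, fun x f H hx hB => hq0 x f H hx fun hli => ?_⟩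
  refine hx.not_sub_le_sub_sup (z := z) (i₁ := i₁) two_pos ?_ hB
  convert hli using 3 with t
  cases t <;> rfl

end GeneralPosition

section Induced

variable {K V : Type*} [Field K] [AddCommGroup V] [Module K V]

theorem finrank_comap_subtype (A W : Submodule K V) :
    finrank K (A.comap W.subtype) = finrank K ↥(W ⊓ A) := by
  rw [← Submodule.map_comap_subtype, Submodule.finrank_map_subtype_eq]

/-- The traces of a flag on a subspace. -/
def traceChain (F : CompleteFlag K V) (W : Submodule K V) (m : ℕ) : Submodule K W :=
  (F.sub m).comap W.subtype

/-- The images in the quotient by `W` of the traces of a flag on `L`. -/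
def quotChain (F : CompleteFlag K V) (W L : Submodule K V) (m : ℕ) : Submodule K (V ⧸ W) :=
  (L ⊓ F.sub m).map W.mkQ

theorem finrank_traceChain (F : CompleteFlag K V) (W : Submodule K V) (m : ℕ) :
    finrank K (traceChain F W m) = finrank K ↥(W ⊓ F.sub m) :=
  finrank_comap_subtype _ _

/-- The flag `E` consists of the members of the chain `C`. -/
def IsInduced (C : ℕ → Submodule K V) (E : CompleteFlag K V) : Prop :=
  ∀ m, C m = E.sub (finrank K (C m))

/-- A chain of subspaces from `⊥` to `⊤` whose dimension grows by at most one in each step: a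
complete flag with repetitions. -/
structure IsFlagChain (C : ℕ → Submodule K V) : Prop where
  mono : Monotone C
  zero : C 0 = ⊥
  exists_eq_top : ∃ n, C n = ⊤
  finrank_succ_le : ∀ m, finrank K (C (m + 1)) ≤ finrank K (C m) + 1

theorem IsFlagChain.exists_finrank_eq {C : ℕ → Submodule K V} (hC : IsFlagChain C) {j : ℕ}
    (hj : j ≤ finrank K V) : ∃ m, finrank K (C m) = j := by
  classical
  obtain ⟨n, hn⟩ := hC.exists_eq_top
  have hex : ∃ m, j ≤ finrank K (C m) := ⟨n, by rwa [hn, finrank_top]⟩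
  refine ⟨Nat.find hex, le_antisymm ?_ (Nat.find_spec hex)⟩
  rcases hm : Nat.find hex with _ | m
  · rw [hC.zero, finrank_bot]
    exact Nat.zero_le j
  · have := Nat.find_min hex (m := m) (by lia)
    have := hC.finrank_succ_le m
    lia

theorem finrank_map_add_finrank_inf_ker [FiniteDimensional K V] {V' : Type*} [AddCommGroup V']
    [Module K V'] (φ : V →ₗ[K] V') (A : Submodule K V) :
    finrank K (A.map φ) + finrank K ↥(A ⊓ LinearMap.ker φ) = finrank K A := by
  rw [← (φ.domRestrict A).finrank_range_add_finrank_ker, LinearMap.range_domRestrict,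
    LinearMap.ker_domRestrict, finrank_comap_subtype]

theorem finrank_map_mkQ_add [FiniteDimensional K V] (A W : Submodule K V) :
    finrank K (A.map W.mkQ) + finrank K ↥(W ⊓ A) = finrank K A := by
  rw [inf_comm, ← finrank_map_add_finrank_inf_ker W.mkQ A, Submodule.ker_mkQ]

theorem finrank_map_le_succ [FiniteDimensional K V] {V' : Type*} [AddCommGroup V'] [Module K V']
    (φ : V →ₗ[K] V') {A B : Submodule K V} (hAB : A ≤ B) (h : finrank K B ≤ finrank K A + 1) :
    finrank K (B.map φ) ≤ finrank K (A.map φ) + 1 := by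
  have hA := finrank_map_add_finrank_inf_ker φ A
  have hB := finrank_map_add_finrank_inf_ker φ B
  have hker := Submodule.finrank_mono (inf_le_inf_right (LinearMap.ker φ) hAB)
  lia

variable [FiniteDimensional K V] {C : ℕ → Submodule K V}

theorem IsFlagChain.eq_of_finrank_eq (hC : IsFlagChain C) {m n : ℕ}
    (h : finrank K (C m) = finrank K (C n)) : C m = C n := by
  rcases le_total m n with hmn | hmn
  · exact Submodule.eq_of_le_of_finrank_eq (hC.mono hmn) h
  · exact (Submodule.eq_of_le_of_finrank_eq (hC.mono hmn) h.symm).symm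

theorem IsFlagChain.exists_isInduced (hC : IsFlagChain C) : ∃ E, IsInduced C E := by
  choose idx hidx using fun j => hC.exists_finrank_eq (min_le_right j (finrank K V))
  refine ⟨⟨fun j => C (idx j), fun i j hij => ?_, hidx⟩, fun m => hC.eq_of_finrank_eq ?_⟩
  · rcases le_total (idx i) (idx j) with h | h
    · exact hC.mono h
    · refine (Submodule.eq_of_le_of_finrank_le (hC.mono h) ?_).ge
      rw [hidx, hidx]
      exact min_le_min_right _ hij
  · rw [hidx, min_eq_left (Submodule.finrank_le _)]

theorem IsInduced.unique (hC : IsFlagChain C) {E E' : CompleteFlag K V} (hE : IsInduced C E)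
    (hE' : IsInduced C E') : E = E' := by
  ext j : 2
  rcases le_total (finrank K V) j with hj | hj
  · rw [E.sub_eq_top hj, E'.sub_eq_top hj]
  · obtain ⟨m, rfl⟩ := hC.exists_finrank_eq hj
    rw [← hE, ← hE']

open Classical in
/-- The flag consisting of the members of the chain `C`, if there is one; otherwise an arbitrary
flag. -/
noncomputable def inducedFlag (C : ℕ → Submodule K V) : CompleteFlag K V :=
  if h : ∃ E, IsInduced C E then h.choose else CompleteFlag.ofBasis (finBasis K V)

theorem IsFlagChain.isInduced_inducedFlag (hC : IsFlagChain C) : IsInduced C (inducedFlag C) := by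
  rw [inducedFlag, dif_pos hC.exists_isInduced]
  exact hC.exists_isInduced.choose_spec

theorem IsFlagChain.inducedFlag_eq (hC : IsFlagChain C) {E : CompleteFlag K V}
    (hE : IsInduced C E) : inducedFlag C = E :=
  hC.isInduced_inducedFlag.unique hC hE

theorem isFlagChain_traceChain (F : CompleteFlag K V) (W : Submodule K V) :
    IsFlagChain (traceChain F W) where
  mono _ _ h := Submodule.comap_mono (F.mono h)
  zero := by simp [traceChain, F.sub_zero]
  exists_eq_top := ⟨finrank K V, by simp [traceChain, F.sub_eq_top le_rfl]⟩
  finrank_succ_le m := by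
    rw [finrank_traceChain, finrank_traceChain]
    exact F.finrank_inf_sub_succ_le W m

theorem isFlagChain_quotChain (F : CompleteFlag K V) {W L : Submodule K V} (hL : L ⊔ W = ⊤) :
    IsFlagChain (quotChain F W L) where
  mono _ _ h := Submodule.map_mono (inf_le_inf_left _ (F.mono h))
  zero := by simp [quotChain, F.sub_zero]
  exists_eq_top := by
    refine ⟨finrank K V, ?_⟩
    rw [quotChain, F.sub_eq_top le_rfl, inf_top_eq, Submodule.map_mkQ_eq_top, sup_comm, hL]
  finrank_succ_le m := finrank_map_le_succ _ (inf_le_inf_left _ (F.mono m.le_succ))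
    (F.finrank_inf_sub_succ_le L m)

end Induced

section Rows

variable {k n t : ℕ} {l l₀ l₁ l₂ l₃ : List ℕ} {x : Fin t → List ℕ}

/-- The list of partitions with the given rows: four special ones and further ones. -/
def rowsProblem (l₀ l₁ l₂ l₃ : List ℕ) (x : Fin t → List ℕ) : Fin (4 + t) → ℕ → ℕ :=
  Fin.append ![ofRows l₀, ofRows l₁, ofRows l₂, ofRows l₃] fun i => ofRows (x i)

/-- The rows `l` in one place and no rows elsewhere. -/
def singleRows (i : Fin t) (l : List ℕ) : Fin t → List ℕ := fun j => if j = i then l else []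

theorem forall_append_four {α : Type*} {P : Fin (4 + t) → α → Prop} {u₀ u₁ u₂ u₃ : α}
    {u : Fin t → α} :
    (∀ i, P i (Fin.append ![u₀, u₁, u₂, u₃] u i)) ↔
      P (Fin.castAdd t 0) u₀ ∧ P (Fin.castAdd t 1) u₁ ∧ P (Fin.castAdd t 2) u₂ ∧
        P (Fin.castAdd t 3) u₃ ∧ ∀ i, P (Fin.natAdd 4 i) (u i) := by
  simp only [Fin.forall_fin_add, Fin.append_left, Fin.append_right]
  rw [Fin.forall_fin_succ, Fin.forall_fin_succ, Fin.forall_fin_two]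
  simp only [and_assoc]
  rfl

theorem sum_append_four {α M : Type*} [AddCommMonoid M] (f : α → M) (u₀ u₁ u₂ u₃ : α)
    (u : Fin t → α) :
    ∑ i, f (Fin.append ![u₀, u₁, u₂, u₃] u i) = f u₀ + f u₁ + f u₂ + f u₃ + ∑ i, f (u i) := by
  simp only [Fin.sum_univ_add, Fin.append_left, Fin.append_right, Fin.sum_univ_four]
  rfl

theorem isPartitionFor_ofRows (hanti : l.Pairwise (· ≥ ·)) (hlen : l.length ≤ k)
    (hle : ∀ y ∈ l, y ≤ n - k) : IsPartitionFor k n (ofRows l) := by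
  refine ⟨fun i j hij => ?_, ?_, List.getD_eq_default _ _ hlen⟩
  · rcases le_or_gt l.length j with hj | hj
    · exact (List.getD_eq_default _ _ hj).trans_le (Nat.zero_le _)
    · rw [ofRows, ofRows, List.getD_eq_getElem _ _ hj, List.getD_eq_getElem _ _ (hij.trans_lt hj)]
      exact hanti.sortedGE hij
  · cases l with
    | nil => exact Nat.zero_le _
    | cons y l => exact hle y List.mem_cons_self

theorem isPartitionFor_rowsProblem (h₀ : IsPartitionFor k n (ofRows l₀))
    (h₁ : IsPartitionFor k n (ofRows l₁)) (h₂ : IsPartitionFor k n (ofRows l₂))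
    (h₃ : IsPartitionFor k n (ofRows l₃)) (hx : ∀ i, IsPartitionFor k n (ofRows (x i))) :
    ∀ i, IsPartitionFor k n (rowsProblem l₀ l₁ l₂ l₃ x i) :=
  (forall_append_four (P := fun _ => IsPartitionFor k n)).mpr ⟨h₀, h₁, h₂, h₃, hx⟩

theorem isPartitionFor_singleRows (hl : IsPartitionFor k n (ofRows l)) (i j : Fin t) :
    IsPartitionFor k n (ofRows (singleRows i l j)) := by
  rw [singleRows]
  split_ifs
  · exact hl
  · exact isPartitionFor_ofRows List.Pairwise.nil (Nat.zero_le _) (by simp)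

theorem sum_rowsProblem (k : ℕ) (l₀ l₁ l₂ l₃ : List ℕ) (x : Fin t → List ℕ) :
    ∑ i, ∑ j ∈ Finset.range k, rowsProblem l₀ l₁ l₂ l₃ x i j =
      ∑ j ∈ Finset.range k, ofRows l₀ j + ∑ j ∈ Finset.range k, ofRows l₁ j +
      ∑ j ∈ Finset.range k, ofRows l₂ j + ∑ j ∈ Finset.range k, ofRows l₃ j +
      ∑ i, ∑ j ∈ Finset.range k, ofRows (x i) j :=
  sum_append_four (fun l : ℕ → ℕ => ∑ j ∈ Finset.range k, l j) _ _ _ _ _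

theorem sum_singleRows (k : ℕ) (i : Fin t) (l : List ℕ) :
    ∑ i', ∑ j ∈ Finset.range k, ofRows (singleRows i l i') j =
      ∑ j ∈ Finset.range k, ofRows l j := by
  rw [Finset.sum_eq_single i]
  · simp [singleRows]
  · intro i' _ hi'
    simp [singleRows, hi', ofRows]
  · simp

end Rows

section General

variable {K X : Type*} [Field K] [AddCommGroup X] [Module K X] {a b t : ℕ}

/-- Certain auxiliary Schubert problems for lines, planes and spaces of dimension three, with more
conditions than unknowns, have no solutions. This excludes the coincidences that would change the
dimensions of the subspaces constructed from `F`. -/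
structure NoExcessSolutions (b : ℕ) {t : ℕ} (F : Fin (4 + t) → CompleteFlag K X) : Prop where
  line₁ : solutions 1 (rowsProblem [3] [b + 1] [] [] fun _ => []) F = ∅
  line₂ : solutions 1 (rowsProblem [b + 2] [b - 1] [] [] fun _ => []) F = ∅
  plane₂ : solutions 2 (rowsProblem [b + 1, 3] [b - 2] [2] [1] fun _ => []) F = ∅
  plane₃ : solutions 2 (rowsProblem [b + 1, 3] [b - 2] [1] [2] fun _ => []) F = ∅
  plane : ∀ i, solutions 2 (rowsProblem [b + 1, 3] [b - 2] [1] [1] (singleRows i [1])) F = ∅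
  space₁ : solutions 3 (rowsProblem [b, 2] [b, b - 2] [1, 1] [1, 1] fun _ => []) F = ∅

/-- The instances over which the fibration is constructed: the solutions of `lam` and of certain
auxiliary Schubert problems are not in special position. -/
structure IsGeneral (a b : ℕ) {t : ℕ} (lam : Fin (4 + t) → ℕ → ℕ)
    (F : Fin (4 + t) → CompleteFlag K X) : Prop extends NoExcessSolutions b F where
  inf_plane : ∀ H ∈ solutions 2 (rowsProblem [b + 1, 3] [b - 2] [1] [1] fun _ => []) F,
    H ⊓ (F (Fin.castAdd t 2)).sub (b + 2) ⊓ (F (Fin.castAdd t 3)).sub (b + 2) = ⊥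
  inf_space : ∀ i, ∀ H ∈ solutions 3
    (rowsProblem [b, 2] [b - 3] [1, 1] [1, 1] (singleRows i [b])) F,
    H ⊓ (F (Fin.castAdd t 1)).sub 5 ⊓ (F (Fin.castAdd t 0)).sub (b + 1) = ⊥
  inf_space₂ : ∀ H ∈ solutions 3 (rowsProblem [b, 2] [b - 3] [b + 1, 1] [1, 1] fun _ => []) F,
    H ⊓ (F (Fin.castAdd t 1)).sub 5 ⊓ (F (Fin.castAdd t 0)).sub (b + 1) = ⊥
  inf_space₃ : ∀ H ∈ solutions 3 (rowsProblem [b, 2] [b - 3] [1, 1] [b + 1, 1] fun _ => []) F,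
    H ⊓ (F (Fin.castAdd t 1)).sub 5 ⊓ (F (Fin.castAdd t 0)).sub (b + 1) = ⊥
  inf_main : ∀ H ∈ solutions (2 + a) lam F,
    H ⊓ (F (Fin.castAdd t 1)).sub 4 ⊓ (F (Fin.castAdd t 0)).sub (b + 1) = ⊥
  not_le_main : ∀ H ∈ solutions (2 + a) lam F,
    ¬ (F (Fin.castAdd t 0)).sub 2 ≤ (F (Fin.castAdd t 1)).sub 5 ⊔ H

theorem solutions_map {k s : ℕ} (lam : Fin s → ℕ → ℕ) (F : Fin s → CompleteFlag K X)
    (B : X ≃ₗ[K] X) :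
    solutions k lam (fun i => (F i).map B) =
      Submodule.map (B : X →ₗ[K] X) '' solutions k lam F := by
  ext H
  obtain ⟨H, rfl⟩ := Submodule.map_surjective_of_surjective (f := (B : X →ₗ[K] X)) B.surjective H
  rw [(Submodule.map_injective_of_injective (f := (B : X →ₗ[K] X)) B.injective).mem_set_image]
  simp only [solutions, schubertVariety, Set.mem_ofPred_eq, LinearEquiv.finrank_map_eq]
  refine and_congr .rfl (forall_congr' fun i => and_congr .rfl (forall₂_congr fun j _ => ?_))
  rw [CompleteFlag.map_sub, ← Submodule.map_inf _ B.injective, LinearEquiv.finrank_map_eq]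

theorem NoExcessSolutions.map {F : Fin (4 + t) → CompleteFlag K X} (hF : NoExcessSolutions b F)
    (B : X ≃ₗ[K] X) : NoExcessSolutions b fun i => (F i).map B := by
  refine ⟨?_, ?_, ?_, ?_, fun i => ?_, ?_⟩
  all_goals rw [solutions_map, Set.image_eq_empty]
  exacts [hF.line₁, hF.line₂, hF.plane₂, hF.plane₃, hF.plane i, hF.space₁]

theorem IsGeneral.map {lam : Fin (4 + t) → ℕ → ℕ} {F : Fin (4 + t) → CompleteFlag K X}
    (hF : IsGeneral a b lam F) (B : X ≃ₗ[K] X) : IsGeneral a b lam fun i => (F i).map B := by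
  have hinf {k : ℕ} {mu : Fin (4 + t) → ℕ → ℕ} {i j : Fin (4 + t)} {m n : ℕ}
      (h : ∀ H ∈ solutions k mu F, H ⊓ (F i).sub m ⊓ (F j).sub n = ⊥) :
      ∀ H ∈ solutions k mu (fun i => (F i).map B),
        H ⊓ ((F i).map B).sub m ⊓ ((F j).map B).sub n = ⊥ := by
    rw [solutions_map, Set.forall_mem_image]
    intro H hH
    rw [CompleteFlag.map_sub, CompleteFlag.map_sub, ← Submodule.map_inf _ B.injective,
      ← Submodule.map_inf _ B.injective, h H hH, Submodule.map_bot]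
  refine ⟨hF.toNoExcessSolutions.map B, hinf hF.inf_plane, fun i => hinf (hF.inf_space i),
    hinf hF.inf_space₂, hinf hF.inf_space₃, hinf hF.inf_main, ?_⟩
  rw [solutions_map, Set.forall_mem_image]
  intro H hH
  rw [CompleteFlag.map_sub, CompleteFlag.map_sub, ← Submodule.map_sup,
    Submodule.map_le_map_iff_of_injective B.injective]
  exact hF.not_le_main H hH

variable [FiniteDimensional K X] [Infinite K] {k : ℕ} {l₀ l₁ l₂ l₃ : List ℕ} {x : Fin t → List ℕ}

theorem generally_solutions_rowsProblem_eq_empty (hX : finrank K X = 4 + b)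
    (hsum : k * (4 + b - k) <
      ∑ j ∈ Finset.range k, ofRows l₀ j + ∑ j ∈ Finset.range k, ofRows l₁ j +
      ∑ j ∈ Finset.range k, ofRows l₂ j + ∑ j ∈ Finset.range k, ofRows l₃ j +
      ∑ i, ∑ j ∈ Finset.range k, ofRows (x i) j) :
    Generally fun F : Fin (4 + t) → CompleteFlag K X =>
      solutions k (rowsProblem l₀ l₁ l₂ l₃ x) F = ∅ :=
  generally_solutions_eq_empty (by rwa [hX, sum_rowsProblem])

theorem generally_rowsProblem_inf_sub_inf_sub_eq_bot (hX : finrank K X = 4 + b) {i₀ i₁ : Fin 4}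
    {m₀ m₁ : ℕ} (hk : k ≤ 4 + b) (hk2 : 2 ≤ k) (hi : i₁ ≠ i₀)
    (h₀ : IsPartitionFor k (4 + b) (ofRows l₀)) (h₁ : IsPartitionFor k (4 + b) (ofRows l₁))
    (h₂ : IsPartitionFor k (4 + b) (ofRows l₂)) (h₃ : IsPartitionFor k (4 + b) (ofRows l₃))
    (hx : ∀ i, IsPartitionFor k (4 + b) (ofRows (x i)))
    (hsum : k * (4 + b - k) ≤
      ∑ j ∈ Finset.range k, ofRows l₀ j + ∑ j ∈ Finset.range k, ofRows l₁ j +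
      ∑ j ∈ Finset.range k, ofRows l₂ j + ∑ j ∈ Finset.range k, ofRows l₃ j +
      ∑ i, ∑ j ∈ Finset.range k, ofRows (x i) j)
    (hm₁ : m₁ + (![ofRows l₀, ofRows l₁, ofRows l₂, ofRows l₃] : Fin 4 → ℕ → ℕ) i₁ 0 =
      4 + b - k + 1)
    (hm₀ : m₀ + (![ofRows l₀, ofRows l₁, ofRows l₂, ofRows l₃] : Fin 4 → ℕ → ℕ) i₀ (k - 2) =
      4 + b - 1) :
    Generally fun F : Fin (4 + t) → CompleteFlag K X =>
      ∀ H ∈ solutions k (rowsProblem l₀ l₁ l₂ l₃ x) F,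
        H ⊓ (F (Fin.castAdd t i₁)).sub m₁ ⊓ (F (Fin.castAdd t i₀)).sub m₀ = ⊥ := by
  rw [← hX] at hk h₀ h₁ h₂ h₃ hx hsum hm₀ hm₁
  refine generally_inf_sub_inf_sub_eq_bot hk hk2 (mt (Fin.castAdd_injective 4 t ·) hi)
    (isPartitionFor_rowsProblem h₀ h₁ h₂ h₃ hx) (by rwa [sum_rowsProblem]) ?_ ?_
  · rwa [rowsProblem, Fin.append_left]
  · rwa [rowsProblem, Fin.append_left]

theorem generally_noExcessSolutions (hX : finrank K X = 4 + b) (hb : 3 ≤ b) :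
    Generally fun F : Fin (4 + t) → CompleteFlag K X => NoExcessSolutions b F := by
  have line₁ : Generally fun F : Fin (4 + t) → CompleteFlag K X =>
      solutions 1 (rowsProblem [3] [b + 1] [] [] fun _ => []) F = ∅ :=
    generally_solutions_rowsProblem_eq_empty hX (by grind [ofRows, Finset.sum_range_succ])
  have line₂ : Generally fun F : Fin (4 + t) → CompleteFlag K X =>
      solutions 1 (rowsProblem [b + 2] [b - 1] [] [] fun _ => []) F = ∅ :=
    generally_solutions_rowsProblem_eq_empty hX (by grind [ofRows, Finset.sum_range_succ])
  have plane₂ : Generally fun F : Fin (4 + t) → CompleteFlag K X =>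
      solutions 2 (rowsProblem [b + 1, 3] [b - 2] [2] [1] fun _ => []) F = ∅ :=
    generally_solutions_rowsProblem_eq_empty hX (by grind [ofRows, Finset.sum_range_succ])
  have plane₃ : Generally fun F : Fin (4 + t) → CompleteFlag K X =>
      solutions 2 (rowsProblem [b + 1, 3] [b - 2] [1] [2] fun _ => []) F = ∅ :=
    generally_solutions_rowsProblem_eq_empty hX (by grind [ofRows, Finset.sum_range_succ])
  have plane : Generally fun F : Fin (4 + t) → CompleteFlag K X =>
      ∀ i, solutions 2 (rowsProblem [b + 1, 3] [b - 2] [1] [1] (singleRows i [1])) F = ∅ :=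
    .forall fun i => generally_solutions_rowsProblem_eq_empty hX
      (by rw [sum_singleRows]; grind [ofRows, Finset.sum_range_succ])
  have space₁ : Generally fun F : Fin (4 + t) → CompleteFlag K X =>
      solutions 3 (rowsProblem [b, 2] [b, b - 2] [1, 1] [1, 1] fun _ => []) F = ∅ :=
    generally_solutions_rowsProblem_eq_empty hX (by grind [ofRows, Finset.sum_range_succ])
  refine (line₁.and <| line₂.and <| plane₂.and <| plane₃.and <| plane.and space₁).mono ?_
  rintro F ⟨h₁, h₂, h₃, h₄, h₅, h₆⟩
  exact ⟨h₁, h₂, h₃, h₄, h₅, h₆⟩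

theorem generally_space_inf_sub_inf_sub_eq_bot (hX : finrank K X = 4 + b) (hb : 3 ≤ b)
    (h₂ : IsPartitionFor 3 (4 + b) (ofRows l₂)) (h₃ : IsPartitionFor 3 (4 + b) (ofRows l₃))
    (hx : ∀ i, IsPartitionFor 3 (4 + b) (ofRows (x i)))
    (hsum : b + 4 ≤ ∑ j ∈ Finset.range 3, ofRows l₂ j + ∑ j ∈ Finset.range 3, ofRows l₃ j +
      ∑ i, ∑ j ∈ Finset.range 3, ofRows (x i) j) :
    Generally fun F : Fin (4 + t) → CompleteFlag K X =>
      ∀ H ∈ solutions 3 (rowsProblem [b, 2] [b - 3] l₂ l₃ x) F,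
        H ⊓ (F (Fin.castAdd t 1)).sub 5 ⊓ (F (Fin.castAdd t 0)).sub (b + 1) = ⊥ := by
  refine generally_rowsProblem_inf_sub_inf_sub_eq_bot hX (by lia) (by lia) (by decide)
    (isPartitionFor_ofRows (by grind) (by grind) (by grind))
    (isPartitionFor_ofRows (by grind) (by grind) (by grind)) h₂ h₃ hx ?_ ?_ ?_
  · have h₀ : ∑ j ∈ Finset.range 3, ofRows [b, 2] j = b + 2 := by
      simp [ofRows, Finset.sum_range_succ]
    have h₁ : ∑ j ∈ Finset.range 3, ofRows [b - 3] j = b - 3 := by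
      simp [ofRows, Finset.sum_range_succ]
    lia
  · simp [ofRows]
    lia
  · simp [ofRows]
    lia

theorem generally_isGeneral (hX : finrank K X = 4 + b) (hab : a + 2 ≤ b) (ha : 0 < a)
    {lam : Fin (4 + t) → ℕ → ℕ} (hlam : IsSchubertProblem (2 + a) (4 + b) lam)
    (h₀ : lam (Fin.castAdd t 0) 0 = b - a + 1) (h₀' : lam (Fin.castAdd t 0) a = 2)
    (h₁ : lam (Fin.castAdd t 1) 0 = b - a - 1) (h₁' : lam (Fin.castAdd t 1) 1 = b - a - 1) :
    Generally fun F : Fin (4 + t) → CompleteFlag K X => IsGeneral a b lam F := by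
  have hne : Fin.castAdd t (1 : Fin 4) ≠ Fin.castAdd t 0 :=
    mt (Fin.castAdd_injective 4 t ·) (by decide)
  have rows {k : ℕ} {l : List ℕ} := isPartitionFor_ofRows (k := k) (n := 4 + b) (l := l)
  have norows {k : ℕ} (_ : Fin t) : IsPartitionFor k (4 + b) (ofRows []) :=
    rows .nil (Nat.zero_le k) (by simp)
  have inf_plane := generally_rowsProblem_inf_sub_inf_sub_eq_bot (K := K) (X := X) (t := t)
    (l₀ := [b + 1, 3]) (l₁ := [b - 2]) (l₂ := [1]) (l₃ := [1]) (x := fun _ => []) (i₀ := 3)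
    (i₁ := 2) (m₀ := b + 2) (m₁ := b + 2) hX (by lia) le_rfl (by decide)
    (rows (by grind) (by grind) (by grind)) (rows (by grind) (by grind) (by grind))
    (rows (by grind) (by grind) (by grind)) (rows (by grind) (by grind) (by grind)) norows
    (by grind [ofRows, Finset.sum_range_succ]) (by simp [ofRows]; lia) (by simp [ofRows]; lia)
  have h11 : IsPartitionFor 3 (4 + b) (ofRows [1, 1]) := rows (by grind) (by grind) (by grind)
  have hb1 : IsPartitionFor 3 (4 + b) (ofRows [b + 1, 1]) :=
    rows (by grind) (by grind) (by grind)
  have inf_space (i : Fin t) := generally_space_inf_sub_inf_sub_eq_bot (K := K) (X := X) hX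
    (by lia) h11 h11
    (isPartitionFor_singleRows (rows (l := [b]) (by grind) (by grind) (by grind)) i)
    (by rw [sum_singleRows]; grind [ofRows, Finset.sum_range_succ])
  have inf_space₂ := generally_space_inf_sub_inf_sub_eq_bot (K := K) (X := X) hX
    (by lia) hb1 h11 norows (by grind [ofRows, Finset.sum_range_succ])
  have inf_space₃ := generally_space_inf_sub_inf_sub_eq_bot (K := K) (X := X) hX
    (by lia) h11 hb1 norows (by grind [ofRows, Finset.sum_range_succ])
  rw [← hX] at hlam
  have inf_main := generally_inf_sub_inf_sub_eq_bot (m₀ := b + 1) (m₁ := 4) (by lia) (by lia) hne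
    hlam.1 hlam.2.ge (by lia) (by rw [Nat.add_sub_cancel_left]; lia)
  have not_le_main := generally_not_sub_two_le_sub_five_sup (by lia) (by lia) hne
    hlam.1 hlam.2.ge (by lia) (by lia) (by lia)
  refine ((generally_noExcessSolutions hX (by lia)).and <| inf_plane.and <|
    (Generally.forall inf_space).and <| inf_space₂.and <| inf_space₃.and <|
    inf_main.and not_le_main).mono ?_
  rintro F ⟨hF, h₁, h₂, h₃, h₄, h₅, h₆⟩
  exact ⟨hF, h₁, h₂, h₃, h₄, h₅, h₆⟩

end General

section Membership

variable {K X : Type*} [Field K] [AddCommGroup X] [Module K X]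

theorem notMem_of_inf_eq_bot {A B : Submodule K X} {v : X} (h : A ⊓ B = ⊥) (hv : v ∈ B)
    (h0 : v ≠ 0) : v ∉ A :=
  fun hA => h0 (Submodule.disjoint_def.mp (disjoint_iff.mpr h) v hA hv)

theorem mem_solutions_append_four_iff {t k : ℕ} {l₀ l₁ l₂ l₃ : ℕ → ℕ} {l : Fin t → ℕ → ℕ}
    {F : Fin (4 + t) → CompleteFlag K X} {H : Submodule K X} :
    H ∈ solutions k (Fin.append ![l₀, l₁, l₂, l₃] l) F ↔
      finrank K H = k ∧ H ∈ schubertVariety k l₀ (F (Fin.castAdd t 0)) ∧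
        H ∈ schubertVariety k l₁ (F (Fin.castAdd t 1)) ∧
        H ∈ schubertVariety k l₂ (F (Fin.castAdd t 2)) ∧
        H ∈ schubertVariety k l₃ (F (Fin.castAdd t 3)) ∧
        ∀ i, H ∈ schubertVariety k (l i) (F (Fin.natAdd 4 i)) :=
  and_congr_right fun _ => forall_append_four (P := fun i l => H ∈ schubertVariety k l (F i))

theorem mem_solutions_rowsProblem {t k : ℕ} {l₀ l₁ l₂ l₃ : List ℕ} {x : Fin t → List ℕ}
    {F : Fin (4 + t) → CompleteFlag K X} {H : Submodule K X} (hH : finrank K H = k)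
    (h₀ : H ∈ schubertVariety k (ofRows l₀) (F (Fin.castAdd t 0)))
    (h₁ : H ∈ schubertVariety k (ofRows l₁) (F (Fin.castAdd t 1)))
    (h₂ : H ∈ schubertVariety k (ofRows l₂) (F (Fin.castAdd t 2)))
    (h₃ : H ∈ schubertVariety k (ofRows l₃) (F (Fin.castAdd t 3)))
    (hx : ∀ i, H ∈ schubertVariety k (ofRows (x i)) (F (Fin.natAdd 4 i))) :
    H ∈ solutions k (rowsProblem l₀ l₁ l₂ l₃ x) F :=
  mem_solutions_append_four_iff.mpr ⟨hH, h₀, h₁, h₂, h₃, hx⟩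

variable [FiniteDimensional K X] {F : CompleteFlag K X} {H : Submodule K X} {j k m : ℕ}

theorem one_le_finrank_of_mem {v : X} (hv : v ∈ H) (h0 : v ≠ 0) : 1 ≤ finrank K H :=
  Submodule.one_le_finrank_iff.mpr (H.ne_bot_iff.mpr ⟨v, hv, h0⟩)

theorem CompleteFlag.finrank_add_le (F : CompleteFlag K X) (H : Submodule K X) {m : ℕ}
    (hm : m ≤ finrank K X) : finrank K H + m ≤ finrank K ↥(H ⊓ F.sub m) + finrank K X := by
  have h := finrank_inf_add_le (le_top : F.sub m ≤ ⊤) H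
  rwa [inf_top_eq, finrank_top, F.finrank_sub, min_eq_left hm] at h

theorem le_finrank_inf_sub_of_le {m' : ℕ} (h : j ≤ finrank K ↥(H ⊓ F.sub m)) (hm : m ≤ m') :
    j ≤ finrank K ↥(H ⊓ F.sub m') :=
  h.trans (Submodule.finrank_mono (inf_le_inf_left _ (F.mono hm)))

theorem le_finrank_inf_sub_of_le_add {i m' : ℕ} (h : j + i ≤ finrank K ↥(H ⊓ F.sub m))
    (hm : m ≤ m' + i) : j ≤ finrank K ↥(H ⊓ F.sub m') := by
  rcases le_total m m' with hmm | hmm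
  · exact le_finrank_inf_sub_of_le (by lia) hmm
  · have := finrank_inf_add_le (F.mono hmm) H
    rw [F.finrank_sub, F.finrank_sub] at this
    lia

theorem le_finrank_inf_sub_of_codim (hH : finrank K H = k) (hj : j ≤ k)
    (hm : finrank K X + j ≤ m + k) : j ≤ finrank K ↥(H ⊓ F.sub m) :=
  le_finrank_inf_sub_of_le_add (i := k - j) (m := finrank K X)
    (by rw [F.sub_eq_top le_rfl, inf_top_eq, hH]; lia) (by lia)

theorem mem_schubertVariety_ofRows_nil (hH : finrank K H = k) :
    H ∈ schubertVariety k (ofRows []) F := by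
  have := Submodule.finrank_le H
  exact ⟨hH, fun j hj => le_finrank_inf_sub_of_codim hH (by lia) (by simp [ofRows]; lia)⟩

theorem mem_schubertVariety_ofRows_singleton {p : ℕ} (hH : finrank K H = k)
    (h : 1 ≤ finrank K ↥(H ⊓ F.sub m)) (hm : m + p + k ≤ finrank K X + 1) :
    H ∈ schubertVariety k (ofRows [p]) F := by
  have := Submodule.finrank_le H
  refine ⟨hH, fun j hj => ?_⟩
  rcases j with _ | j
  · exact le_finrank_inf_sub_of_le h (by simp [ofRows]; lia)
  · exact le_finrank_inf_sub_of_codim hH (by lia) (by simp [ofRows]; lia)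

theorem mem_schubertVariety_ofRows_pair {p q m' : ℕ} (hH : finrank K H = k)
    (h : 1 ≤ finrank K ↥(H ⊓ F.sub m)) (hm : m + p + k ≤ finrank K X + 1)
    (h' : 2 ≤ finrank K ↥(H ⊓ F.sub m')) (hm' : m' + q + k ≤ finrank K X + 2) :
    H ∈ schubertVariety k (ofRows [p, q]) F := by
  have := Submodule.finrank_le H
  refine ⟨hH, fun j hj => ?_⟩
  rcases j with _ | _ | j
  · exact le_finrank_inf_sub_of_le h (by simp [ofRows]; lia)
  · exact le_finrank_inf_sub_of_le h' (by simp [ofRows]; lia)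
  · exact le_finrank_inf_sub_of_codim hH (by lia) (by simp [ofRows]; lia)

theorem finrank_inf_lt_of_mem_sup {A C : Submodule K X} {v : X} (hv : v ∉ A) (hvC : v ∈ C ⊔ A) :
    finrank K ↥(A ⊓ C) < finrank K ↥((A ⊔ K ∙ v) ⊓ C) := by
  obtain ⟨c, hc, y, hy, rfl⟩ := Submodule.mem_sup.mp hvC
  have hcA : c ∉ A := fun h => hv (A.add_mem h hy)
  have hcv : c ∈ A ⊔ K ∙ (c + y) := by
    rw [← Submodule.add_mem_iff_left _ (Submodule.mem_sup_left hy)]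
    exact Submodule.mem_sup_right (Submodule.mem_span_singleton_self _)
  refine Submodule.finrank_lt_finrank_of_lt (SetLike.lt_iff_le_and_exists.mpr
    ⟨inf_le_inf_right _ le_sup_left, c, Submodule.mem_inf.mpr ⟨hcv, hc⟩, ?_⟩)
  exact fun h => hcA (Submodule.mem_inf.mp h).1

theorem sub_inf_sub_eq_bot_of_solutions_eq_empty {t p q n : ℕ}
    {F : Fin (4 + t) → CompleteFlag K X}
    (h : solutions 1 (rowsProblem [p] [q] [] [] fun _ => []) F = ∅)
    (hm : m + p = finrank K X) (hn : n + q = finrank K X) :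
    (F (Fin.castAdd t 0)).sub m ⊓ (F (Fin.castAdd t 1)).sub n = ⊥ := by
  refine (Submodule.eq_bot_iff _).mpr fun v hv => by_contra fun h0 => ?_
  have hd : finrank K (K ∙ v) = 1 := finrank_span_singleton h0
  have hmem {A : Submodule K X} (hA : v ∈ A) : 1 ≤ finrank K ↥(K ∙ v ⊓ A) :=
    one_le_finrank_of_mem ⟨Submodule.mem_span_singleton_self v, hA⟩ h0
  exact Set.eq_empty_iff_forall_notMem.mp h (K ∙ v) (mem_solutions_rowsProblem hd
    (mem_schubertVariety_ofRows_singleton hd (hmem hv.1) (by lia))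
    (mem_schubertVariety_ofRows_singleton hd (hmem hv.2) (by lia))
    (mem_schubertVariety_ofRows_nil hd) (mem_schubertVariety_ofRows_nil hd)
    fun _ => mem_schubertVariety_ofRows_nil hd)

end Membership

section Comparison

theorem ofRows_replicate (n x j : ℕ) :
    ofRows (List.replicate n x) j = if j < n then x else 0 := by
  rw [ofRows, List.getD_eq_getElem?_getD, List.getElem?_replicate]
  split_ifs <;> rfl

theorem ofRows_cons_replicate_succ (y n x j : ℕ) :
    ofRows (y :: List.replicate n x) (j + 1) = if j < n then x else 0 :=
  ofRows_replicate n x j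

theorem IsPartitionFor.le_sub {k n : ℕ} {l : ℕ → ℕ} (hl : IsPartitionFor k n l) (j : ℕ) :
    l j ≤ n - k :=
  (hl.1 (Nat.zero_le j)).trans hl.2.1

theorem IsPartitionFor.eq_zero {k n j : ℕ} {l : ℕ → ℕ} (hl : IsPartitionFor k n l) (hj : k ≤ j) :
    l j = 0 :=
  Nat.le_zero.mp (hl.2.2 ▸ hl.1 hj)

variable {K X Y : Type*} [Field K] [AddCommGroup X] [Module K X] [FiniteDimensional K X]
  [AddCommGroup Y] [Module K Y] {a b : ℕ} {F : CompleteFlag K X}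
  {G : CompleteFlag K Y} {H : Submodule K X} {M : Submodule K Y}

theorem mem_schubertVariety_iff_of_partition (hX : finrank K X = 4 + b) (hY : finrank K Y = b)
    (hab : a ≤ b) (hH : finrank K H = 2 + a) (hM : finrank K M = a) {l : ℕ → ℕ}
    (hl : IsPartitionFor a b l)
    (hdim : ∀ m ≤ b, finrank K ↥(H ⊓ F.sub (m + 2)) = finrank K ↥(M ⊓ G.sub m)) :
    H ∈ schubertVariety (2 + a) l F ↔ M ∈ schubertVariety a l G := by
  have hrow : ∀ j < a, finrank K ↥(H ⊓ F.sub (finrank K X - (2 + a) + (j + 1) - l j)) =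
      finrank K ↥(M ⊓ G.sub (finrank K Y - a + (j + 1) - l j)) := by
    intro j hj
    have := hl.le_sub j
    have hm : finrank K X - (2 + a) + (j + 1) - l j = finrank K Y - a + (j + 1) - l j + 2 := by
      lia
    rw [hm, hdim _ (by lia)]
  constructor
  · intro h
    exact ⟨hM, fun j hj => hrow j hj ▸ h.2 j (by lia)⟩
  · intro h
    refine ⟨hH, fun j hj => ?_⟩
    rcases lt_or_ge j a with hja | hja
    · exact (hrow j hja).symm ▸ h.2 j hja
    · exact le_finrank_inf_sub_of_codim hH (by lia) (by rw [hl.eq_zero hja]; lia)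

theorem mem_schubertVariety_iff_of_column_add (hX : finrank K X = 4 + b) (hY : finrank K Y = b)
    (hab : a ≤ b) (hH : finrank K H = 2 + a) (hM : finrank K M = a) {l : ℕ → ℕ}
    (hl : IsPartitionFor a b l)
    (hdim : ∀ m ≤ b, finrank K ↥(H ⊓ F.sub (m + 1)) = finrank K ↥(M ⊓ G.sub m))
    (hcol : a + 1 ≤ finrank K ↥(H ⊓ F.sub (b + 2))) :
    H ∈ schubertVariety (2 + a) (ofRows (List.replicate (a + 1) 1) + l) F ↔
      M ∈ schubertVariety a l G := by
  have hrow : ∀ j < a, finrank K ↥(H ⊓ F.sub (finrank K X - (2 + a) + (j + 1) -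
      (ofRows (List.replicate (a + 1) 1) + l) j)) =
      finrank K ↥(M ⊓ G.sub (finrank K Y - a + (j + 1) - l j)) := by
    intro j hj
    have := hl.le_sub j
    have hm : finrank K X - (2 + a) + (j + 1) - (1 + l j) =
        finrank K Y - a + (j + 1) - l j + 1 := by
      lia
    rw [Pi.add_apply, ofRows_replicate, if_pos (by lia), hm, hdim _ (by lia)]
  constructor
  · intro h
    exact ⟨hM, fun j hj => hrow j hj ▸ h.2 j (by lia)⟩
  · intro h
    refine ⟨hH, fun j hj => ?_⟩
    rcases lt_or_ge j a with hja | hja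
    · exact (hrow j hja).symm ▸ h.2 j hja
    rw [Pi.add_apply, hl.eq_zero hja, ofRows_replicate]
    split_ifs with hja'
    · exact le_finrank_inf_sub_of_le (hcol.trans' (by lia)) (by lia)
    · exact le_finrank_inf_sub_of_codim hH (by lia) (by lia)

theorem finrank_inf_sub_of_mem_column_add (hX : finrank K X = 4 + b) (hab : a ≤ b)
    {l : ℕ → ℕ} (hH : H ∈ schubertVariety (2 + a) (ofRows (List.replicate (a + 1) 1) + l) F) :
    a + 1 ≤ finrank K ↥(H ⊓ F.sub (b + 2)) :=
  le_finrank_inf_sub_of_le (hH.2 a (by lia))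
    (by rw [Pi.add_apply, ofRows_replicate, if_pos (by lia)]; lia)

theorem finrank_inf_sub_of_mem_two_rows (hX : finrank K X = 4 + b) (hab : a + 2 ≤ b)
    (hH : H ∈ schubertVariety (2 + a) (ofRows [b - a - 1, b - a - 1]) F) :
    2 ≤ finrank K ↥(H ⊓ F.sub 5) :=
  le_finrank_inf_sub_of_le (hH.2 1 (by lia)) (by simp [ofRows]; lia)

variable [FiniteDimensional K Y]

theorem mem_schubertVariety_iff_of_two_rows (hX : finrank K X = 4 + b) (hY : finrank K Y = b)
    (hab : a + 2 ≤ b) (ha : 0 < a) (hH : finrank K H = 2 + a) (hM : finrank K M = a)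
    (hdim : finrank K ↥(H ⊓ F.sub 5) = finrank K ↥(M ⊓ G.sub 2) + 1) :
    H ∈ schubertVariety (2 + a) (ofRows [b - a - 1, b - a - 1]) F ↔
      M ∈ schubertVariety a (ofRows [b - a - 1]) G := by
  constructor
  · intro h
    have h₅ := finrank_inf_sub_of_mem_two_rows hX hab h
    exact mem_schubertVariety_ofRows_singleton hM (m := 2) (by lia) (by lia)
  · intro h
    have h₂ : 1 ≤ finrank K ↥(M ⊓ G.sub 2) :=
      le_finrank_inf_sub_of_le (h.2 0 (by lia)) (by simp [ofRows]; lia)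
    exact mem_schubertVariety_ofRows_pair hH (m := 4) (m' := 5)
      (le_finrank_inf_sub_of_le_add (i := 1) (m := 5) (by lia) (by lia)) (by lia) (by lia)
      (by lia)

theorem mem_schubertVariety_replicate_iff {k p : ℕ} (hM : finrank K M = k) (hpk : p ≤ k) {c : ℕ}
    (hc : c + k ≤ finrank K Y) :
    M ∈ schubertVariety k (ofRows (List.replicate p c)) G ↔
      p ≤ finrank K ↥(M ⊓ G.sub (finrank K Y - k + p - c)) := by
  constructor
  · intro h
    rcases p with _ | p
    · exact Nat.zero_le _
    · have hp := h.2 p hpk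
      rwa [ofRows_replicate, if_pos p.lt_succ_self] at hp
  · intro h
    refine ⟨hM, fun j hj => ?_⟩
    rw [ofRows_replicate]
    split_ifs with hjp
    · exact le_finrank_inf_sub_of_le_add (i := p - (j + 1)) (h.trans' (by lia)) (by lia)
    · exact le_finrank_inf_sub_of_codim hM (by lia) (by lia)

theorem mem_schubertVariety_cons_replicate_iff {k y p c : ℕ} (hH : finrank K H = k)
    (hpk : p + 1 ≤ k) (hc : c + k ≤ finrank K X) (hp : 0 < p) :
    H ∈ schubertVariety k (ofRows (y :: List.replicate p c)) F ↔
      1 ≤ finrank K ↥(H ⊓ F.sub (finrank K X - k + 1 - y)) ∧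
        p + 1 ≤ finrank K ↥(H ⊓ F.sub (finrank K X - k + (p + 1) - c)) := by
  constructor
  · intro h
    obtain ⟨p, rfl⟩ := Nat.exists_eq_add_one_of_ne_zero hp.ne'
    have hlast := h.2 (p + 1) hpk
    rw [ofRows_cons_replicate_succ, if_pos p.lt_succ_self] at hlast
    exact ⟨h.2 0 (by lia), hlast⟩
  · intro h
    refine ⟨hH, fun j hj => ?_⟩
    rcases j with _ | j
    · exact h.1
    rw [ofRows_cons_replicate_succ]
    split_ifs with hjp
    · exact le_finrank_inf_sub_of_le_add (i := p - (j + 1)) (h.2.trans' (by lia)) (by lia)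
    · exact le_finrank_inf_sub_of_codim hH (by lia) (by lia)

theorem mem_schubertVariety_hook_iff (hX : finrank K X = 4 + b) (hab : a + 2 ≤ b) (ha : 0 < a)
    (hH : finrank K H = 2 + a) :
    H ∈ schubertVariety (2 + a) (ofRows ((b - a + 1) :: List.replicate a 2)) F ↔
      1 ≤ finrank K ↥(H ⊓ F.sub 2) ∧ a + 1 ≤ finrank K ↥(H ⊓ F.sub (b + 1)) := by
  have h₂ : finrank K X - (2 + a) + 1 - (b - a + 1) = 2 := by lia
  have hb1 : finrank K X - (2 + a) + (a + 1) - 2 = b + 1 := by lia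
  rw [mem_schubertVariety_cons_replicate_iff hH (by lia) (by lia) ha, h₂, hb1]

theorem mem_schubertVariety_iff_of_hook (hX : finrank K X = 4 + b) (hY : finrank K Y = b)
    (hab : a + 2 ≤ b) (ha : 0 < a) (hH : finrank K H = 2 + a) (hM : finrank K M = a)
    (hline : 1 ≤ finrank K ↥(H ⊓ F.sub 2))
    (hdim : finrank K ↥(H ⊓ F.sub (b + 1)) = finrank K ↥(M ⊓ G.sub (b - 3)) + 2) :
    H ∈ schubertVariety (2 + a) (ofRows ((b - a + 1) :: List.replicate a 2)) F ↔
      M ∈ schubertVariety a (ofRows (List.replicate (a - 1) 2)) G := by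
  have hb3 : finrank K Y - a + (a - 1) - 2 = b - 3 := by lia
  rw [mem_schubertVariety_hook_iff hX hab ha hH, mem_schubertVariety_replicate_iff hM (by lia)
    (by lia), hb3, hdim, and_iff_right hline]
  lia

end Comparison

section BasePlanes

variable {K X : Type*} [Field K] [AddCommGroup X] [Module K X] {a b t : ℕ}
  {lam : Fin (4 + t) → ℕ → ℕ} {F : Fin (4 + t) → CompleteFlag K X} {h : Submodule K X} {v : X}

/-- The four-dimensional subspace `V` that the fibration attaches to the instance `F`. -/
def baseSpace (b : ℕ) {t : ℕ} (F : Fin (4 + t) → CompleteFlag K X) : Submodule K X :=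
  (F (Fin.castAdd t 0)).sub 2 ⊔
    ((F (Fin.castAdd t 1)).sub 5 ⊓ (F (Fin.castAdd t 0)).sub (b + 1))

theorem sub_two_le_baseSpace : (F (Fin.castAdd t 0)).sub 2 ≤ baseSpace b F := le_sup_left

theorem sub₁_inf_sub₀_le_baseSpace :
    (F (Fin.castAdd t 1)).sub 5 ⊓ (F (Fin.castAdd t 0)).sub (b + 1) ≤ baseSpace b F :=
  le_sup_right

/-- The subspace that contains the solutions of the instance `F` meeting `baseSpace b F` in `h`.
It is a complement of `baseSpace b F` modulo `h`, so its flags induce the flags in the fiber. -/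
def liftSpace (b : ℕ) {t : ℕ} (F : Fin (4 + t) → CompleteFlag K X) (h : Submodule K X) :
    Submodule K X :=
  ((F (Fin.castAdd t 2)).sub (b + 2) ⊔ h) ⊓ ((F (Fin.castAdd t 3)).sub (b + 2) ⊔ h)

/-- The solutions of the base problem `□⁴`, as subspaces of the whole space: `h` meets four
subspaces of `baseSpace b F` of dimension two nontrivially. For general `F`, the conditions `meet₀`,
`le₀` and `meet₁` imply that `h` is contained in `baseSpace b F`. -/
structure IsBasePlane (b : ℕ) {t : ℕ} (F : Fin (4 + t) → CompleteFlag K X) (h : Submodule K X) :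
    Prop where
  finrank_eq : finrank K h = 2
  meet₀ : 1 ≤ finrank K ↥(h ⊓ (F (Fin.castAdd t 0)).sub 2)
  le₀ : h ≤ (F (Fin.castAdd t 0)).sub (b + 1)
  meet₁ : 1 ≤ finrank K ↥(h ⊓ (F (Fin.castAdd t 1)).sub 5)
  meet₂ : 1 ≤ finrank K ↥(h ⊓ (F (Fin.castAdd t 2)).sub (b + 2))
  meet₃ : 1 ≤ finrank K ↥(h ⊓ (F (Fin.castAdd t 3)).sub (b + 2))

theorem IsBasePlane.finrank_inf_sub₀ (hh : IsBasePlane b F h) :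
    finrank K ↥(h ⊓ (F (Fin.castAdd t 0)).sub (b + 1)) = 2 := by
  rw [inf_eq_left.mpr hh.le₀, hh.finrank_eq]

theorem IsBasePlane.sup_span_inf_inf_ne_bot (hh : IsBasePlane b F h) (v : X) :
    (h ⊔ K ∙ v) ⊓ (F (Fin.castAdd t 1)).sub 5 ⊓ (F (Fin.castAdd t 0)).sub (b + 1) ≠ ⊥ := by
  intro hbot
  have hle : h ⊓ (F (Fin.castAdd t 1)).sub 5 ≤ ⊥ :=
    hbot ▸ le_inf (inf_le_inf_right _ le_sup_left) (inf_le_left.trans hh.le₀)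
  have := hh.meet₁
  rw [le_bot_iff.mp hle, finrank_bot] at this
  lia

variable [FiniteDimensional K X]

theorem mem_schubertVariety_singleRows {H : Submodule K X} {k : ℕ} {l : List ℕ} {i : Fin t}
    (hH : H ∈ schubertVariety k (ofRows l) (F (Fin.natAdd 4 i))) (j : Fin t) :
    H ∈ schubertVariety k (ofRows (singleRows i l j)) (F (Fin.natAdd 4 j)) := by
  unfold singleRows
  split_ifs with hj
  · exact hj ▸ hH
  · exact mem_schubertVariety_ofRows_nil hH.1

theorem NoExcessSolutions.sub_inf_sub_three_eq_bot (hX : finrank K X = 4 + b)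
    (hF : NoExcessSolutions b F) :
    (F (Fin.castAdd t 0)).sub (b + 1) ⊓ (F (Fin.castAdd t 1)).sub 3 = ⊥ :=
  sub_inf_sub_eq_bot_of_solutions_eq_empty hF.line₁ (by lia) (by lia)

theorem NoExcessSolutions.sub_two_inf_sub_five_eq_bot (hX : finrank K X = 4 + b) (hb : 3 ≤ b)
    (hF : NoExcessSolutions b F) :
    (F (Fin.castAdd t 0)).sub 2 ⊓ (F (Fin.castAdd t 1)).sub 5 = ⊥ :=
  sub_inf_sub_eq_bot_of_solutions_eq_empty hF.line₂ (by lia) (by lia)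

namespace IsBasePlane

theorem mem₀ (hX : finrank K X = 4 + b) (hh : IsBasePlane b F h) :
    h ∈ schubertVariety 2 (ofRows [b + 1, 3]) (F (Fin.castAdd t 0)) :=
  mem_schubertVariety_ofRows_pair hh.finrank_eq hh.meet₀ (by lia) hh.finrank_inf_sub₀.ge (by lia)

theorem mem₁ (hX : finrank K X = 4 + b) (hb : 3 ≤ b) (hh : IsBasePlane b F h) :
    h ∈ schubertVariety 2 (ofRows [b - 2]) (F (Fin.castAdd t 1)) :=
  mem_schubertVariety_ofRows_singleton hh.finrank_eq hh.meet₁ (by lia)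

theorem mem₂ (hX : finrank K X = 4 + b) (hh : IsBasePlane b F h) :
    h ∈ schubertVariety 2 (ofRows [1]) (F (Fin.castAdd t 2)) :=
  mem_schubertVariety_ofRows_singleton hh.finrank_eq hh.meet₂ (by lia)

theorem mem₃ (hX : finrank K X = 4 + b) (hh : IsBasePlane b F h) :
    h ∈ schubertVariety 2 (ofRows [1]) (F (Fin.castAdd t 3)) :=
  mem_schubertVariety_ofRows_singleton hh.finrank_eq hh.meet₃ (by lia)

theorem inf_inf_eq_bot (hX : finrank K X = 4 + b) (hb : 3 ≤ b) (hF : IsGeneral a b lam F)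
    (hh : IsBasePlane b F h) :
    h ⊓ (F (Fin.castAdd t 2)).sub (b + 2) ⊓ (F (Fin.castAdd t 3)).sub (b + 2) = ⊥ :=
  hF.inf_plane h (mem_solutions_rowsProblem hh.finrank_eq (hh.mem₀ hX) (hh.mem₁ hX hb)
    (hh.mem₂ hX) (hh.mem₃ hX) fun _ => mem_schubertVariety_ofRows_nil hh.finrank_eq)

theorem inf_sub₁_eq_bot (hX : finrank K X = 4 + b) (hF : NoExcessSolutions b F)
    (hh : IsBasePlane b F h) : h ⊓ (F (Fin.castAdd t 1)).sub 2 = ⊥ :=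
  le_bot_iff.mp ((inf_le_inf hh.le₀ ((F _).mono (by lia))).trans_eq
    (hF.sub_inf_sub_three_eq_bot hX))

theorem inf_sub₂_eq_bot (hX : finrank K X = 4 + b) (hb : 3 ≤ b) (hF : NoExcessSolutions b F)
    (hh : IsBasePlane b F h) : h ⊓ (F (Fin.castAdd t 2)).sub (b + 1) = ⊥ := by
  by_contra hne
  exact Set.eq_empty_iff_forall_notMem.mp hF.plane₂ h (mem_solutions_rowsProblem hh.finrank_eq
    (hh.mem₀ hX) (hh.mem₁ hX hb) (mem_schubertVariety_ofRows_singleton hh.finrank_eq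
      (Submodule.one_le_finrank_iff.mpr hne) (by lia))
    (hh.mem₃ hX) fun _ => mem_schubertVariety_ofRows_nil hh.finrank_eq)

theorem inf_sub₃_eq_bot (hX : finrank K X = 4 + b) (hb : 3 ≤ b) (hF : NoExcessSolutions b F)
    (hh : IsBasePlane b F h) : h ⊓ (F (Fin.castAdd t 3)).sub (b + 1) = ⊥ := by
  by_contra hne
  exact Set.eq_empty_iff_forall_notMem.mp hF.plane₃ h (mem_solutions_rowsProblem hh.finrank_eq
    (hh.mem₀ hX) (hh.mem₁ hX hb) (hh.mem₂ hX)
    (mem_schubertVariety_ofRows_singleton hh.finrank_eq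
      (Submodule.one_le_finrank_iff.mpr hne) (by lia))
    fun _ => mem_schubertVariety_ofRows_nil hh.finrank_eq)

theorem inf_sub_eq_bot (hX : finrank K X = 4 + b) (hb : 3 ≤ b) (hF : NoExcessSolutions b F)
    (hh : IsBasePlane b F h) (i : Fin t) : h ⊓ (F (Fin.natAdd 4 i)).sub (b + 2) = ⊥ := by
  by_contra hne
  exact Set.eq_empty_iff_forall_notMem.mp (hF.plane i) h (mem_solutions_rowsProblem hh.finrank_eq
    (hh.mem₀ hX) (hh.mem₁ hX hb) (hh.mem₂ hX) (hh.mem₃ hX)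
    (mem_schubertVariety_singleRows (mem_schubertVariety_ofRows_singleton hh.finrank_eq
      (Submodule.one_le_finrank_iff.mpr hne) (by lia))))

theorem finrank_sup_span (hh : IsBasePlane b F h) (hv : v ∉ h) : finrank K ↥(h ⊔ K ∙ v) = 3 := by
  rw [Submodule.finrank_sup_span_singleton hv, hh.finrank_eq]

theorem sup_span_mem₀ (hX : finrank K X = 4 + b) (hh : IsBasePlane b F h) (hv : v ∉ h) :
    h ⊔ K ∙ v ∈ schubertVariety 3 (ofRows [b, 2]) (F (Fin.castAdd t 0)) :=
  mem_schubertVariety_ofRows_pair (hh.finrank_sup_span hv)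
    (hh.meet₀.trans (Submodule.finrank_mono (inf_le_inf_right _ le_sup_left))) (by lia)
    (hh.finrank_inf_sub₀.ge.trans (Submodule.finrank_mono (inf_le_inf_right _ le_sup_left)))
    (by lia)

theorem sup_span_mem₁ (hX : finrank K X = 4 + b) (hb : 3 ≤ b) (hh : IsBasePlane b F h)
    (hv : v ∉ h) : h ⊔ K ∙ v ∈ schubertVariety 3 (ofRows [b - 3]) (F (Fin.castAdd t 1)) :=
  mem_schubertVariety_ofRows_singleton (hh.finrank_sup_span hv)
    (hh.meet₁.trans (Submodule.finrank_mono (inf_le_inf_right _ le_sup_left))) (by lia)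

theorem sup_span_mem_column (hX : finrank K X = 4 + b) (hh : IsBasePlane b F h) (hv : v ∉ h)
    {E : CompleteFlag K X} (hE : 1 ≤ finrank K ↥(h ⊓ E.sub (b + 2)))
    (hvE : v ∈ E.sub (b + 2) ⊔ h) : h ⊔ K ∙ v ∈ schubertVariety 3 (ofRows [1, 1]) E := by
  have h2 : 2 ≤ finrank K ↥((h ⊔ K ∙ v) ⊓ E.sub (b + 2)) :=
    hE.trans_lt (finrank_inf_lt_of_mem_sup hv hvE)
  exact mem_schubertVariety_ofRows_pair (hh.finrank_sup_span hv)
    (le_finrank_inf_sub_of_le_add (i := 1) (m' := b + 1) h2 le_rfl) (by lia) h2 (by lia)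

theorem sup_span_mem_hook (hX : finrank K X = 4 + b) (hh : IsBasePlane b F h) (hv : v ∉ h)
    {E : CompleteFlag K X} (hE : 1 ≤ finrank K ↥(h ⊓ E.sub (b + 2))) (hvE : v ∈ E.sub 1) :
    h ⊔ K ∙ v ∈ schubertVariety 3 (ofRows [b + 1, 1]) E := by
  have h0 : v ≠ 0 := ne_of_mem_of_not_mem h.zero_mem hv |>.symm
  have h2 : 2 ≤ finrank K ↥((h ⊔ K ∙ v) ⊓ E.sub (b + 2)) := hE.trans_lt
    (finrank_inf_lt_of_mem_sup hv (Submodule.mem_sup_left (E.mono (by lia) hvE)))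
  exact mem_schubertVariety_ofRows_pair (hh.finrank_sup_span hv) (one_le_finrank_of_mem
    ⟨Submodule.mem_sup_right (Submodule.mem_span_singleton_self v), hvE⟩ h0) (by lia) h2 (by lia)

theorem sub_two_inf_liftSpace_eq_bot (hX : finrank K X = 4 + b) (hb : 3 ≤ b)
    (hF : IsGeneral a b lam F) (hh : IsBasePlane b F h) (i : Fin t) :
    (F (Fin.natAdd 4 i)).sub 2 ⊓ liftSpace b F h = ⊥ := by
  refine (Submodule.eq_bot_iff _).mpr fun v hv => by_contra fun h0 => ?_
  have hvh : v ∉ h := notMem_of_inf_eq_bot (hh.inf_sub_eq_bot hX hb hF.toNoExcessSolutions i)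
    ((F _).mono (by lia) hv.1) h0
  exact hh.sup_span_inf_inf_ne_bot v (hF.inf_space i _ (mem_solutions_rowsProblem
    (hh.finrank_sup_span hvh) (hh.sup_span_mem₀ hX hvh) (hh.sup_span_mem₁ hX hb hvh)
    (hh.sup_span_mem_column hX hvh hh.meet₂ hv.2.1) (hh.sup_span_mem_column hX hvh hh.meet₃ hv.2.2)
    (mem_schubertVariety_singleRows <| mem_schubertVariety_ofRows_singleton
      (hh.finrank_sup_span hvh) (one_le_finrank_of_mem
        ⟨Submodule.mem_sup_right (Submodule.mem_span_singleton_self v), hv.1⟩ h0) (by lia))))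

theorem sub₁_two_inf_liftSpace_eq_bot (hX : finrank K X = 4 + b) (hb : 3 ≤ b)
    (hF : NoExcessSolutions b F) (hh : IsBasePlane b F h) :
    (F (Fin.castAdd t 1)).sub 2 ⊓ liftSpace b F h = ⊥ := by
  refine (Submodule.eq_bot_iff _).mpr fun v hv => by_contra fun h0 => ?_
  have hvh : v ∉ h := notMem_of_inf_eq_bot (hh.inf_sub₁_eq_bot hX hF) hv.1 h0
  have h5 : 2 ≤ finrank K ↥((h ⊔ K ∙ v) ⊓ (F (Fin.castAdd t 1)).sub 5) := hh.meet₁.trans_lt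
    (finrank_inf_lt_of_mem_sup hvh (Submodule.mem_sup_left ((F _).mono (by lia) hv.1)))
  exact Set.eq_empty_iff_forall_notMem.mp hF.space₁ _ (mem_solutions_rowsProblem
    (hh.finrank_sup_span hvh) (hh.sup_span_mem₀ hX hvh)
    (mem_schubertVariety_ofRows_pair (hh.finrank_sup_span hvh) (one_le_finrank_of_mem
      ⟨Submodule.mem_sup_right (Submodule.mem_span_singleton_self v), hv.1⟩ h0) (by lia) h5
      (by lia))
    (hh.sup_span_mem_column hX hvh hh.meet₂ hv.2.1) (hh.sup_span_mem_column hX hvh hh.meet₃ hv.2.2)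
    fun _ => mem_schubertVariety_ofRows_nil (hh.finrank_sup_span hvh))

theorem sub₂_one_inf_sup_eq_bot (hX : finrank K X = 4 + b) (hb : 3 ≤ b) (hF : IsGeneral a b lam F)
    (hh : IsBasePlane b F h) :
    (F (Fin.castAdd t 2)).sub 1 ⊓ ((F (Fin.castAdd t 3)).sub (b + 2) ⊔ h) = ⊥ := by
  refine (Submodule.eq_bot_iff _).mpr fun v hv => by_contra fun h0 => ?_
  have hvh : v ∉ h := notMem_of_inf_eq_bot (hh.inf_sub₂_eq_bot hX hb hF.toNoExcessSolutions)
    ((F _).mono (by lia) hv.1) h0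
  exact hh.sup_span_inf_inf_ne_bot v (hF.inf_space₂ _ (mem_solutions_rowsProblem
    (hh.finrank_sup_span hvh) (hh.sup_span_mem₀ hX hvh) (hh.sup_span_mem₁ hX hb hvh)
    (hh.sup_span_mem_hook hX hvh hh.meet₂ hv.1) (hh.sup_span_mem_column hX hvh hh.meet₃ hv.2)
    fun _ => mem_schubertVariety_ofRows_nil (hh.finrank_sup_span hvh)))

theorem sub₃_one_inf_sup_eq_bot (hX : finrank K X = 4 + b) (hb : 3 ≤ b) (hF : IsGeneral a b lam F)
    (hh : IsBasePlane b F h) :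
    (F (Fin.castAdd t 3)).sub 1 ⊓ ((F (Fin.castAdd t 2)).sub (b + 2) ⊔ h) = ⊥ := by
  refine (Submodule.eq_bot_iff _).mpr fun v hv => by_contra fun h0 => ?_
  have hvh : v ∉ h := notMem_of_inf_eq_bot (hh.inf_sub₃_eq_bot hX hb hF.toNoExcessSolutions)
    ((F _).mono (by lia) hv.1) h0
  exact hh.sup_span_inf_inf_ne_bot v (hF.inf_space₃ _ (mem_solutions_rowsProblem
    (hh.finrank_sup_span hvh) (hh.sup_span_mem₀ hX hvh) (hh.sup_span_mem₁ hX hb hvh)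
    (hh.sup_span_mem_column hX hvh hh.meet₂ hv.2) (hh.sup_span_mem_hook hX hvh hh.meet₃ hv.1)
    fun _ => mem_schubertVariety_ofRows_nil (hh.finrank_sup_span hvh)))

end IsBasePlane

end BasePlanes

section LinearAlgebra

variable {K X : Type*} [Field K] [AddCommGroup X] [Module K X]

theorem CompleteFlag.finrank_sub_of_le (E : CompleteFlag K X) {m : ℕ} (hm : m ≤ finrank K X) :
    finrank K (E.sub m) = m := by
  rw [E.finrank_sub, min_eq_left hm]

theorem IsInduced.finrank_inf_sub {E : CompleteFlag K X} {V : Submodule K X} {G : CompleteFlag K V}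
    (hG : IsInduced (traceChain E V) G) (h : Submodule K V) (m : ℕ) :
    finrank K ↥(h ⊓ G.sub (finrank K ↥(V ⊓ E.sub m))) =
      finrank K ↥(h.map V.subtype ⊓ E.sub m) := by
  have hGm := hG m
  rw [finrank_traceChain] at hGm
  rw [← hGm, traceChain, ← Submodule.finrank_map_subtype_eq V,
    Submodule.map_inf _ V.injective_subtype, Submodule.map_comap_subtype, ← inf_assoc,
    inf_eq_left.mpr (Submodule.map_subtype_le V h)]

theorem map_mkQ_inf {H L V : Submodule K X} (hHL : H ≤ L) (hLV : L ⊓ V ≤ H) (S : Submodule K X) :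
    (H ⊓ S).map V.mkQ = H.map V.mkQ ⊓ (L ⊓ S).map V.mkQ := by
  refine le_antisymm (le_inf (Submodule.map_mono inf_le_left)
    (Submodule.map_mono (inf_le_inf_right _ hHL))) ?_
  rintro _ ⟨⟨x, hx, rfl⟩, ⟨y, ⟨hyL, hyS⟩, hxy⟩⟩
  have hV : y - x ∈ V := (Submodule.Quotient.eq V).mp hxy
  have hH : y - x ∈ H := hLV ⟨L.sub_mem hyL (hHL hx), hV⟩
  exact ⟨y, ⟨sub_add_cancel y x ▸ H.add_mem hH hx, hyS⟩, hxy⟩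

theorem exists_mem_span_singleton {A : Submodule K X} (hA : A ≠ ⊥) {x : X} (hx : x ∈ A) :
    ∃ y ∈ A, y ≠ 0 ∧ x ∈ K ∙ y := by
  by_cases hx0 : x = 0
  · obtain ⟨y, hy, hy0⟩ := Submodule.exists_mem_ne_zero_of_ne_bot hA
    exact ⟨y, hy, hy0, hx0 ▸ Submodule.zero_mem _⟩
  · exact ⟨x, hx, hx0, Submodule.mem_span_singleton_self x⟩

variable [FiniteDimensional K X] {H A B L : Submodule K X}

theorem finrank_add_le_finrank_inf (hA : A ≤ H) (hB : B ≤ H) :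
    finrank K A + finrank K B ≤ finrank K ↥(A ⊓ B) + finrank K H := by
  have := Submodule.finrank_sup_add_finrank_inf_eq A B
  have := Submodule.finrank_mono (sup_le hA hB)
  lia

theorem CompleteFlag.finrank_inf_sub_add {E : CompleteFlag K X} {p m : ℕ}
    (hL : L ⊓ E.sub p = ⊥) (hp : finrank K L + p = finrank K X) (hpm : p ≤ m)
    (hm : m ≤ finrank K X) : finrank K ↥(L ⊓ E.sub m) + p = m := by
  have hge := E.finrank_add_le L hm
  have hle := finrank_inf_add_le (E.mono hpm) L
  rw [hL, finrank_bot, E.finrank_sub_of_le (hpm.trans hm), E.finrank_sub_of_le hm] at hle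
  lia

theorem mem_schubertVariety_two_ofRows_one_iff {E : CompleteFlag K X} (hX : finrank K X = 4)
    (hH : finrank K H = 2) :
    H ∈ schubertVariety 2 (ofRows [1]) E ↔ 1 ≤ finrank K ↥(H ⊓ E.sub 2) :=
  ⟨fun h => le_finrank_inf_sub_of_le (h.2 0 (by lia)) (by simp [ofRows, hX]),
    fun h => mem_schubertVariety_ofRows_singleton hH h (by lia)⟩

theorem CompleteFlag.finrank_inf_sub_succ_eq_one {E : CompleteFlag K X} {m : ℕ}
    (hm : H ⊓ E.sub m = ⊥) (hm' : 1 ≤ finrank K ↥(H ⊓ E.sub (m + 1))) :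
    finrank K ↥(H ⊓ E.sub (m + 1)) = 1 := by
  have := E.finrank_inf_sub_succ_le H m
  rw [hm, finrank_bot] at this
  exact le_antisymm this hm'

end LinearAlgebra

section BaseSpace

variable {K X : Type*} [Field K] [AddCommGroup X] [Module K X] {a b t : ℕ}
  {lam : Fin (4 + t) → ℕ → ℕ} {F : Fin (4 + t) → CompleteFlag K X} {h : Submodule K X}

theorem baseSpace_le_sub (hb : 3 ≤ b) : baseSpace b F ≤ (F (Fin.castAdd t 0)).sub (b + 1) :=
  sup_le ((F _).mono (by lia)) inf_le_right

theorem finrank_baseSpace_inf_sub₀ (hX : finrank K X = 4 + b) :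
    finrank K ↥(baseSpace b F ⊓ (F (Fin.castAdd t 0)).sub 2) = 2 := by
  have hle : (F (Fin.castAdd t 0)).sub 2 ≤ baseSpace b F := le_sup_left
  rw [inf_eq_right.mpr hle, CompleteFlag.finrank_sub_of_le _ (by lia)]

theorem baseSpace_inf_sub₁ (hb : 3 ≤ b) : baseSpace b F ⊓ (F (Fin.castAdd t 1)).sub 5 =
    (F (Fin.castAdd t 1)).sub 5 ⊓ (F (Fin.castAdd t 0)).sub (b + 1) :=
  le_antisymm (le_inf inf_le_right (inf_le_left.trans (baseSpace_le_sub hb)))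
    (le_inf le_sup_right inf_le_left)

variable [FiniteDimensional K X]

theorem NoExcessSolutions.finrank_sub₁_inf_sub₀ (hX : finrank K X = 4 + b) (hb : 3 ≤ b)
    (hF : NoExcessSolutions b F) :
    finrank K ↥((F (Fin.castAdd t 1)).sub 5 ⊓ (F (Fin.castAdd t 0)).sub (b + 1)) = 2 := by
  have := CompleteFlag.finrank_inf_sub_add (m := 5) (hF.sub_inf_sub_three_eq_bot hX)
    (by rw [CompleteFlag.finrank_sub_of_le _ (by lia)]; lia) (by lia) (by lia)
  rw [inf_comm]
  lia

theorem NoExcessSolutions.finrank_baseSpace (hX : finrank K X = 4 + b) (hb : 3 ≤ b)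
    (hF : NoExcessSolutions b F) : finrank K (baseSpace b F) = 4 := by
  have := Submodule.finrank_sup_add_finrank_inf_eq ((F (Fin.castAdd t 0)).sub 2)
    ((F (Fin.castAdd t 1)).sub 5 ⊓ (F (Fin.castAdd t 0)).sub (b + 1))
  rwa [hF.finrank_sub₁_inf_sub₀ hX hb, CompleteFlag.finrank_sub_of_le _ (by lia), ← inf_assoc,
    hF.sub_two_inf_sub_five_eq_bot hX hb, bot_inf_eq, finrank_bot] at this

theorem NoExcessSolutions.two_le_finrank_baseSpace_inf (hX : finrank K X = 4 + b) (hb : 3 ≤ b)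
    (hF : NoExcessSolutions b F) (E : CompleteFlag K X) :
    2 ≤ finrank K ↥(baseSpace b F ⊓ E.sub (b + 2)) := by
  have := E.finrank_add_le (baseSpace b F) (m := b + 2) (by lia)
  rw [hF.finrank_baseSpace hX hb] at this
  lia

theorem NoExcessSolutions.isBasePlane_span (hX : finrank K X = 4 + b) (hb : 3 ≤ b)
    (hF : NoExcessSolutions b F) {x y v : X} (hx : x ∈ (F (Fin.castAdd t 0)).sub 2) (hx0 : x ≠ 0)
    (hy : y ∈ (F (Fin.castAdd t 1)).sub 5 ⊓ (F (Fin.castAdd t 0)).sub (b + 1)) (hy0 : y ≠ 0)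
    (hv : v ∈ K ∙ x ⊔ K ∙ y) (hv₂ : v ∈ (F (Fin.castAdd t 2)).sub (b + 2))
    (hv₃ : v ∈ (F (Fin.castAdd t 3)).sub (b + 2)) (hv0 : v ≠ 0) :
    IsBasePlane b F (K ∙ x ⊔ K ∙ y) where
  finrank_eq := by
    have hyx : y ∉ K ∙ x := fun hyx => notMem_of_inf_eq_bot
      (hF.sub_two_inf_sub_five_eq_bot hX hb) hy.1 hy0
      ((Submodule.span_singleton_le_iff_mem _ _).mpr hx hyx)
    rw [Submodule.finrank_sup_span_singleton hyx, finrank_span_singleton hx0]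
  meet₀ := one_le_finrank_of_mem
    ⟨Submodule.mem_sup_left (Submodule.mem_span_singleton_self x), hx⟩ hx0
  le₀ := by
    rw [sup_le_iff, Submodule.span_singleton_le_iff_mem, Submodule.span_singleton_le_iff_mem]
    exact ⟨(F _).mono (by lia) hx, hy.2⟩
  meet₁ := one_le_finrank_of_mem
    ⟨Submodule.mem_sup_right (Submodule.mem_span_singleton_self y), hy.1⟩ hy0
  meet₂ := one_le_finrank_of_mem ⟨hv, hv₂⟩ hv0
  meet₃ := one_le_finrank_of_mem ⟨hv, hv₃⟩ hv0

namespace IsGeneral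

theorem baseSpace_inf_inf_eq_bot (hX : finrank K X = 4 + b) (hb : 3 ≤ b)
    (hF : IsGeneral a b lam F) :
    baseSpace b F ⊓ (F (Fin.castAdd t 2)).sub (b + 2) ⊓ (F (Fin.castAdd t 3)).sub (b + 2) = ⊥ := by
  refine (Submodule.eq_bot_iff _).mpr fun v hv => by_contra fun hv0 => ?_
  obtain ⟨x, hx, y, hy, rfl⟩ := Submodule.mem_sup.mp hv.1.1
  have hne₀ : (F (Fin.castAdd t 0)).sub 2 ≠ ⊥ := Submodule.one_le_finrank_iff.mp (by
    rw [CompleteFlag.finrank_sub_of_le _ (by lia)]; lia)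
  have hne₁ : (F (Fin.castAdd t 1)).sub 5 ⊓ (F (Fin.castAdd t 0)).sub (b + 1) ≠ ⊥ :=
    Submodule.one_le_finrank_iff.mp (by rw [hF.finrank_sub₁_inf_sub₀ hX hb]; lia)
  obtain ⟨x', hx', hx0, hxx⟩ := exists_mem_span_singleton hne₀ hx
  obtain ⟨y', hy', hy0, hyy⟩ := exists_mem_span_singleton hne₁ hy
  have hmem : x + y ∈ K ∙ x' ⊔ K ∙ y' := Submodule.add_mem_sup hxx hyy
  have hplane := hF.isBasePlane_span hX hb hx' hx0 hy' hy0 hmem hv.1.2 hv.2 hv0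
  exact notMem_of_inf_eq_bot (hplane.inf_inf_eq_bot hX hb hF) hv.2 hv0 ⟨hmem, hv.1.2⟩

theorem finrank_baseSpace_inf_add_le (hX : finrank K X = 4 + b) (hb : 3 ≤ b)
    (hF : IsGeneral a b lam F) :
    finrank K ↥(baseSpace b F ⊓ (F (Fin.castAdd t 2)).sub (b + 2)) +
      finrank K ↥(baseSpace b F ⊓ (F (Fin.castAdd t 3)).sub (b + 2)) ≤ 4 := by
  have := finrank_add_le_finrank_inf
    (inf_le_left : baseSpace b F ⊓ (F (Fin.castAdd t 2)).sub (b + 2) ≤ baseSpace b F)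
    (inf_le_left : baseSpace b F ⊓ (F (Fin.castAdd t 3)).sub (b + 2) ≤ baseSpace b F)
  rwa [← inf_inf_distrib_left, ← inf_assoc, hF.baseSpace_inf_inf_eq_bot hX hb, finrank_bot,
    hF.finrank_baseSpace hX hb, zero_add] at this

theorem finrank_baseSpace_inf_sub₂ (hX : finrank K X = 4 + b) (hb : 3 ≤ b)
    (hF : IsGeneral a b lam F) :
    finrank K ↥(baseSpace b F ⊓ (F (Fin.castAdd t 2)).sub (b + 2)) = 2 := by
  have := hF.finrank_baseSpace_inf_add_le hX hb
  have := hF.two_le_finrank_baseSpace_inf hX hb (F (Fin.castAdd t 2))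
  have := hF.two_le_finrank_baseSpace_inf hX hb (F (Fin.castAdd t 3))
  lia

theorem finrank_baseSpace_inf_sub₃ (hX : finrank K X = 4 + b) (hb : 3 ≤ b)
    (hF : IsGeneral a b lam F) :
    finrank K ↥(baseSpace b F ⊓ (F (Fin.castAdd t 3)).sub (b + 2)) = 2 := by
  have := hF.finrank_baseSpace_inf_add_le hX hb
  have := hF.two_le_finrank_baseSpace_inf hX hb (F (Fin.castAdd t 2))
  have := hF.two_le_finrank_baseSpace_inf hX hb (F (Fin.castAdd t 3))
  lia

theorem mem_solutions_base_iff (hX : finrank K X = 4 + b) (hb : 3 ≤ b) (hF : IsGeneral a b lam F)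
    {E : Fin 4 → CompleteFlag K (baseSpace b F)}
    (hE : ∀ i, IsInduced (traceChain (F (Fin.castAdd t i)) (baseSpace b F)) (E i))
    (h : Submodule K (baseSpace b F)) :
    h ∈ solutions 2 (fun _ : Fin 4 => ofRows [1]) E ↔
      IsBasePlane b F (h.map (baseSpace b F).subtype) := by
  have hdim {i : Fin 4} {m : ℕ}
      (him : finrank K ↥(baseSpace b F ⊓ (F (Fin.castAdd t i)).sub m) = 2) :
      finrank K ↥(h ⊓ (E i).sub 2) =
        finrank K ↥(h.map (baseSpace b F).subtype ⊓ (F (Fin.castAdd t i)).sub m) := by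
    rw [← (hE i).finrank_inf_sub, him]
  have h₁ : finrank K ↥(baseSpace b F ⊓ (F (Fin.castAdd t 1)).sub 5) = 2 := by
    rw [baseSpace_inf_sub₁ hb, hF.finrank_sub₁_inf_sub₀ hX hb]
  have h₂ := hF.finrank_baseSpace_inf_sub₂ hX hb
  have h₃ := hF.finrank_baseSpace_inf_sub₃ hX hb
  have hle := (Submodule.map_subtype_le (baseSpace b F) h).trans (baseSpace_le_sub hb)
  have hmeets : (finrank K h = 2 ∧ ∀ i, 1 ≤ finrank K ↥(h ⊓ (E i).sub 2)) ↔
      IsBasePlane b F (h.map (baseSpace b F).subtype) := by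
    rw [Fin.forall_fin_succ, Fin.forall_fin_succ, Fin.forall_fin_two,
      hdim (i := 0) (finrank_baseSpace_inf_sub₀ hX), hdim (i := Fin.succ 0) h₁,
      hdim (i := Fin.succ (Fin.succ 0)) h₂, hdim (i := Fin.succ (Fin.succ 1)) h₃,
      ← Submodule.finrank_map_subtype_eq (baseSpace b F) h]
    exact ⟨fun ⟨h2, m₀, m₁, m₂, m₃⟩ => ⟨h2, m₀, hle, m₁, m₂, m₃⟩,
      fun hh => ⟨hh.finrank_eq, hh.meet₀, hh.meet₁, hh.meet₂, hh.meet₃⟩⟩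
  rw [← hmeets]
  exact and_congr_right fun h2 => forall_congr' fun i =>
    mem_schubertVariety_two_ofRows_one_iff (hF.finrank_baseSpace hX hb) h2

end IsGeneral

namespace IsBasePlane

theorem finrank_inf_sub₀_add_finrank_inf_sub₁_le (hX : finrank K X = 4 + b) (hb : 3 ≤ b)
    (hF : NoExcessSolutions b F) (hh : IsBasePlane b F h) :
    finrank K ↥(h ⊓ (F (Fin.castAdd t 0)).sub 2) +
      finrank K ↥(h ⊓ (F (Fin.castAdd t 1)).sub 5) ≤ 2 := by
  have := finrank_add_le_finrank_inf (inf_le_left : h ⊓ (F (Fin.castAdd t 0)).sub 2 ≤ h)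
    (inf_le_left : h ⊓ (F (Fin.castAdd t 1)).sub 5 ≤ h)
  rwa [← inf_inf_distrib_left, hF.sub_two_inf_sub_five_eq_bot hX hb, inf_bot_eq, finrank_bot,
    hh.finrank_eq, zero_add] at this

theorem finrank_inf_sub₁ (hX : finrank K X = 4 + b) (hb : 3 ≤ b) (hF : NoExcessSolutions b F)
    (hh : IsBasePlane b F h) : finrank K ↥(h ⊓ (F (Fin.castAdd t 1)).sub 5) = 1 := by
  have := hh.finrank_inf_sub₀_add_finrank_inf_sub₁_le hX hb hF
  have := hh.meet₀
  have := hh.meet₁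
  lia

theorem le_baseSpace (hX : finrank K X = 4 + b) (hb : 3 ≤ b) (hF : NoExcessSolutions b F)
    (hh : IsBasePlane b F h) : h ≤ baseSpace b F := by
  have hsup : h ⊓ (F (Fin.castAdd t 0)).sub 2 ⊔ h ⊓ (F (Fin.castAdd t 1)).sub 5 = h := by
    refine Submodule.eq_of_le_of_finrank_le (sup_le inf_le_left inf_le_left) ?_
    have := Submodule.finrank_sup_add_finrank_inf_eq (h ⊓ (F (Fin.castAdd t 0)).sub 2)
      (h ⊓ (F (Fin.castAdd t 1)).sub 5)
    rw [← inf_inf_distrib_left, hF.sub_two_inf_sub_five_eq_bot hX hb, inf_bot_eq,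
      finrank_bot] at this
    have := hh.finrank_eq
    have := hh.meet₀
    have := hh.meet₁
    lia
  rw [← hsup]
  exact sup_le_sup inf_le_right (le_inf inf_le_right (inf_le_left.trans hh.le₀))

theorem finrank_inf_sub₂ (hX : finrank K X = 4 + b) (hb : 3 ≤ b) (hF : NoExcessSolutions b F)
    (hh : IsBasePlane b F h) : finrank K ↥(h ⊓ (F (Fin.castAdd t 2)).sub (b + 2)) = 1 :=
  CompleteFlag.finrank_inf_sub_succ_eq_one (hh.inf_sub₂_eq_bot hX hb hF) hh.meet₂

theorem finrank_inf_sub₃ (hX : finrank K X = 4 + b) (hb : 3 ≤ b) (hF : NoExcessSolutions b F)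
    (hh : IsBasePlane b F h) : finrank K ↥(h ⊓ (F (Fin.castAdd t 3)).sub (b + 2)) = 1 :=
  CompleteFlag.finrank_inf_sub_succ_eq_one (hh.inf_sub₃_eq_bot hX hb hF) hh.meet₃

end IsBasePlane

end BaseSpace

section LiftSpace

variable {K X : Type*} [Field K] [AddCommGroup X] [Module K X] [FiniteDimensional K X]

theorem finrank_sup_inf_add {h V S : Submodule K X} (hV : h ≤ V) :
    finrank K ↥((S ⊔ h) ⊓ V) + finrank K ↥(h ⊓ S) = finrank K h + finrank K ↥(V ⊓ S) := by
  have := Submodule.finrank_sup_add_finrank_inf_eq h (V ⊓ S)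
  rwa [← inf_assoc, inf_eq_left.mpr hV, inf_comm V S, ← sup_inf_assoc_of_le S hV,
    sup_comm h S, inf_comm S V] at this

variable {a b t : ℕ} {lam : Fin (4 + t) → ℕ → ℕ} {F : Fin (4 + t) → CompleteFlag K X}
  {h : Submodule K X}

namespace IsBasePlane

theorem finrank_sub_sup (hX : finrank K X = 4 + b) (hh : IsBasePlane b F h)
    {E : CompleteFlag K X} (hE : finrank K ↥(h ⊓ E.sub (b + 2)) = 1) :
    finrank K ↥(E.sub (b + 2) ⊔ h) = b + 3 := by
  have := Submodule.finrank_sup_add_finrank_inf_eq (E.sub (b + 2)) h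
  rw [inf_comm, hE, hh.finrank_eq, E.finrank_sub_of_le (by lia)] at this
  lia

theorem finrank_sup_inf_baseSpace (hX : finrank K X = 4 + b) (hb : 3 ≤ b)
    (hF : NoExcessSolutions b F) (hh : IsBasePlane b F h) {S : Submodule K X}
    (hS : finrank K ↥(h ⊓ S) = 1) (hVS : finrank K ↥(baseSpace b F ⊓ S) = 2) :
    finrank K ↥((S ⊔ h) ⊓ baseSpace b F) = 3 := by
  have := finrank_sup_inf_add (S := S) (hh.le_baseSpace hX hb hF)
  rw [hS, hVS, hh.finrank_eq] at this
  lia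

theorem baseSpace_le_sup (hX : finrank K X = 4 + b) (hb : 3 ≤ b) (hF : IsGeneral a b lam F) :
    baseSpace b F ≤ ((F (Fin.castAdd t 2)).sub (b + 2) ⊔ h) ⊓ baseSpace b F ⊔
      ((F (Fin.castAdd t 3)).sub (b + 2) ⊔ h) ⊓ baseSpace b F := by
  have := Submodule.finrank_sup_add_finrank_inf_eq
    (baseSpace b F ⊓ (F (Fin.castAdd t 2)).sub (b + 2))
    (baseSpace b F ⊓ (F (Fin.castAdd t 3)).sub (b + 2))
  rw [← inf_inf_distrib_left, ← inf_assoc, hF.baseSpace_inf_inf_eq_bot hX hb, finrank_bot,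
    hF.finrank_baseSpace_inf_sub₂ hX hb, hF.finrank_baseSpace_inf_sub₃ hX hb] at this
  have hsup := Submodule.eq_of_le_of_finrank_eq (sup_le inf_le_left inf_le_left)
    (this.trans (hF.finrank_baseSpace hX hb).symm)
  refine hsup.ge.trans (sup_le_sup ?_ ?_) <;>
    exact le_inf (inf_le_right.trans le_sup_left) inf_le_left

theorem liftSpace_inf_baseSpace (hX : finrank K X = 4 + b) (hb : 3 ≤ b)
    (hF : IsGeneral a b lam F) (hh : IsBasePlane b F h) :
    liftSpace b F h ⊓ baseSpace b F = h := by
  have hF' := hF.toNoExcessSolutions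
  have hle : h ≤ liftSpace b F h ⊓ baseSpace b F :=
    le_inf (le_inf le_sup_right le_sup_right) (hh.le_baseSpace hX hb hF')
  have hdim := Submodule.finrank_sup_add_finrank_inf_eq
    (((F (Fin.castAdd t 2)).sub (b + 2) ⊔ h) ⊓ baseSpace b F)
    (((F (Fin.castAdd t 3)).sub (b + 2) ⊔ h) ⊓ baseSpace b F)
  rw [(sup_le inf_le_right inf_le_right).antisymm (baseSpace_le_sup hX hb hF),
    ← inf_inf_distrib_right, hF.finrank_baseSpace hX hb,
    hh.finrank_sup_inf_baseSpace hX hb hF' (hh.finrank_inf_sub₂ hX hb hF')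
      (hF.finrank_baseSpace_inf_sub₂ hX hb),
    hh.finrank_sup_inf_baseSpace hX hb hF' (hh.finrank_inf_sub₃ hX hb hF')
      (hF.finrank_baseSpace_inf_sub₃ hX hb)] at hdim
  refine (Submodule.eq_of_le_of_finrank_le hle ?_).symm
  rw [hh.finrank_eq, liftSpace]
  lia

theorem le_finrank_liftSpace (hX : finrank K X = 4 + b) (hb : 3 ≤ b)
    (hF : NoExcessSolutions b F) (hh : IsBasePlane b F h) :
    b + 2 ≤ finrank K (liftSpace b F h) := by
  have := Submodule.finrank_sup_add_finrank_inf_eq ((F (Fin.castAdd t 2)).sub (b + 2) ⊔ h)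
    ((F (Fin.castAdd t 3)).sub (b + 2) ⊔ h)
  rw [hh.finrank_sub_sup hX (hh.finrank_inf_sub₂ hX hb hF),
    hh.finrank_sub_sup hX (hh.finrank_inf_sub₃ hX hb hF)] at this
  have := Submodule.finrank_le ((F (Fin.castAdd t 2)).sub (b + 2) ⊔ h ⊔
    ((F (Fin.castAdd t 3)).sub (b + 2) ⊔ h))
  rw [liftSpace]
  lia

theorem finrank_liftSpace (hX : finrank K X = 4 + b) (hb : 3 ≤ b) (hF : IsGeneral a b lam F)
    (hh : IsBasePlane b F h) : finrank K (liftSpace b F h) = b + 2 := by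
  have hsup := Submodule.finrank_sup_add_finrank_inf_eq (liftSpace b F h) (baseSpace b F)
  rw [hh.liftSpace_inf_baseSpace hX hb hF, hh.finrank_eq, hF.finrank_baseSpace hX hb] at hsup
  have := Submodule.finrank_le (liftSpace b F h ⊔ baseSpace b F)
  have := hh.le_finrank_liftSpace hX hb hF.toNoExcessSolutions
  lia

theorem liftSpace_sup_baseSpace (hX : finrank K X = 4 + b) (hb : 3 ≤ b)
    (hF : IsGeneral a b lam F) (hh : IsBasePlane b F h) :
    liftSpace b F h ⊔ baseSpace b F = ⊤ := by
  have hsup := Submodule.finrank_sup_add_finrank_inf_eq (liftSpace b F h) (baseSpace b F)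
  rw [hh.liftSpace_inf_baseSpace hX hb hF, hh.finrank_eq, hF.finrank_baseSpace hX hb,
    hh.finrank_liftSpace hX hb hF] at hsup
  exact Submodule.eq_top_of_finrank_eq (by lia)

theorem finrank_quotChain_add (hX : finrank K X = 4 + b) (hb : 3 ≤ b)
    (hF : IsGeneral a b lam F) (hh : IsBasePlane b F h) (E : CompleteFlag K X) (m : ℕ) :
    finrank K (quotChain E (baseSpace b F) (liftSpace b F h) m) + finrank K ↥(h ⊓ E.sub m) =
      finrank K ↥(liftSpace b F h ⊓ E.sub m) := by
  rw [← finrank_map_mkQ_add (liftSpace b F h ⊓ E.sub m) (baseSpace b F), ← inf_assoc,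
    inf_comm (baseSpace b F), hh.liftSpace_inf_baseSpace hX hb hF]
  rfl

theorem inf_sub_eq_bot_of_le (hX : finrank K X = 4 + b) (hb : 3 ≤ b) (hF : NoExcessSolutions b F)
    (hh : IsBasePlane b F h) (i : Fin t) {m : ℕ} (hm : m ≤ b) :
    h ⊓ (F (Fin.natAdd 4 i)).sub (m + 2) = ⊥ :=
  eq_bot_mono (inf_le_inf_left _ ((F _).mono (by lia))) (hh.inf_sub_eq_bot hX hb hF i)

theorem inf_sub₂_eq_bot_of_le (hX : finrank K X = 4 + b) (hb : 3 ≤ b)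
    (hF : NoExcessSolutions b F) (hh : IsBasePlane b F h) {m : ℕ} (hm : m ≤ b) :
    h ⊓ (F (Fin.castAdd t 2)).sub (m + 1) = ⊥ :=
  eq_bot_mono (inf_le_inf_left _ ((F _).mono (by lia))) (hh.inf_sub₂_eq_bot hX hb hF)

theorem inf_sub₃_eq_bot_of_le (hX : finrank K X = 4 + b) (hb : 3 ≤ b)
    (hF : NoExcessSolutions b F) (hh : IsBasePlane b F h) {m : ℕ} (hm : m ≤ b) :
    h ⊓ (F (Fin.castAdd t 3)).sub (m + 1) = ⊥ :=
  eq_bot_mono (inf_le_inf_left _ ((F _).mono (by lia))) (hh.inf_sub₃_eq_bot hX hb hF)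

theorem finrank_quotChain (hX : finrank K X = 4 + b) (hb : 3 ≤ b) (hF : IsGeneral a b lam F)
    (hh : IsBasePlane b F h) (i : Fin t) {m : ℕ} (hm : m ≤ b) :
    finrank K (quotChain (F (Fin.natAdd 4 i)) (baseSpace b F) (liftSpace b F h) (m + 2)) = m := by
  have hadd := hh.finrank_quotChain_add hX hb hF (F (Fin.natAdd 4 i)) (m + 2)
  rw [hh.inf_sub_eq_bot_of_le hX hb hF.toNoExcessSolutions i hm, finrank_bot] at hadd
  have := CompleteFlag.finrank_inf_sub_add (m := m + 2)
    ((inf_comm _ _).trans (hh.sub_two_inf_liftSpace_eq_bot hX hb hF i))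
    (by rw [hh.finrank_liftSpace hX hb hF]; lia) (by lia) (by lia)
  lia

theorem finrank_quotChain₁ (hX : finrank K X = 4 + b) (hb : 3 ≤ b) (hF : IsGeneral a b lam F)
    (hh : IsBasePlane b F h) :
    finrank K (quotChain (F (Fin.castAdd t 1)) (baseSpace b F) (liftSpace b F h) 5) = 2 := by
  have hadd := hh.finrank_quotChain_add hX hb hF (F (Fin.castAdd t 1)) 5
  rw [hh.finrank_inf_sub₁ hX hb hF.toNoExcessSolutions] at hadd
  have := CompleteFlag.finrank_inf_sub_add (m := 5)
    ((inf_comm _ _).trans (hh.sub₁_two_inf_liftSpace_eq_bot hX hb hF.toNoExcessSolutions))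
    (by rw [hh.finrank_liftSpace hX hb hF]; lia) (by lia) (by lia)
  lia

theorem finrank_quotChain₀ (hX : finrank K X = 4 + b) (hb : 3 ≤ b) (hF : IsGeneral a b lam F)
    (hh : IsBasePlane b F h) :
    finrank K (quotChain (F (Fin.castAdd t 0)) (baseSpace b F) (liftSpace b F h) (b + 1)) =
      b - 3 := by
  have hadd := hh.finrank_quotChain_add hX hb hF (F (Fin.castAdd t 0)) (b + 1)
  rw [inf_eq_left.mpr hh.le₀, hh.finrank_eq] at hadd
  have hsup : liftSpace b F h ⊔ (F (Fin.castAdd t 0)).sub (b + 1) = ⊤ := by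
    rw [eq_top_iff, ← hh.liftSpace_sup_baseSpace hX hb hF]
    exact sup_le_sup_left (baseSpace_le_sub hb) _
  have := Submodule.finrank_sup_add_finrank_inf_eq (liftSpace b F h)
    ((F (Fin.castAdd t 0)).sub (b + 1))
  rw [hsup, finrank_top, hX, hh.finrank_liftSpace hX hb hF,
    CompleteFlag.finrank_sub_of_le _ (by lia)] at this
  lia

theorem finrank_quotChain₂ (hX : finrank K X = 4 + b) (hb : 3 ≤ b) (hF : IsGeneral a b lam F)
    (hh : IsBasePlane b F h) {m : ℕ} (hm : m ≤ b) :
    finrank K (quotChain (F (Fin.castAdd t 2)) (baseSpace b F) (liftSpace b F h) (m + 1)) = m := by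
  have hF' := hF.toNoExcessSolutions
  have hadd := hh.finrank_quotChain_add hX hb hF (F (Fin.castAdd t 2)) (m + 1)
  have hL : liftSpace b F h ⊓ (F (Fin.castAdd t 2)).sub (m + 1) =
      ((F (Fin.castAdd t 3)).sub (b + 2) ⊔ h) ⊓ (F (Fin.castAdd t 2)).sub (m + 1) := by
    rw [liftSpace, inf_right_comm,
      inf_eq_right.mpr (((F _).mono (by lia : m + 1 ≤ b + 2)).trans le_sup_left), inf_comm]
  rw [hh.inf_sub₂_eq_bot_of_le hX hb hF' hm, finrank_bot, hL] at hadd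
  have := CompleteFlag.finrank_inf_sub_add (m := m + 1)
    ((inf_comm _ _).trans (hh.sub₂_one_inf_sup_eq_bot hX hb hF))
    (by rw [hh.finrank_sub_sup hX (hh.finrank_inf_sub₃ hX hb hF')]; lia) (by lia) (by lia)
  lia

theorem finrank_quotChain₃ (hX : finrank K X = 4 + b) (hb : 3 ≤ b) (hF : IsGeneral a b lam F)
    (hh : IsBasePlane b F h) {m : ℕ} (hm : m ≤ b) :
    finrank K (quotChain (F (Fin.castAdd t 3)) (baseSpace b F) (liftSpace b F h) (m + 1)) = m := by
  have hF' := hF.toNoExcessSolutions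
  have hadd := hh.finrank_quotChain_add hX hb hF (F (Fin.castAdd t 3)) (m + 1)
  have hL : liftSpace b F h ⊓ (F (Fin.castAdd t 3)).sub (m + 1) =
      ((F (Fin.castAdd t 2)).sub (b + 2) ⊔ h) ⊓ (F (Fin.castAdd t 3)).sub (m + 1) := by
    rw [liftSpace, inf_assoc,
      inf_eq_right.mpr (((F _).mono (by lia : m + 1 ≤ b + 2)).trans le_sup_left)]
  rw [hh.inf_sub₃_eq_bot_of_le hX hb hF' hm, finrank_bot, hL] at hadd
  have := CompleteFlag.finrank_inf_sub_add (m := m + 1)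
    ((inf_comm _ _).trans (hh.sub₃_one_inf_sup_eq_bot hX hb hF))
    (by rw [hh.finrank_sub_sup hX (hh.finrank_inf_sub₂ hX hb hF')]; lia) (by lia) (by lia)
  lia

theorem finrank_inf_sub_eq (hX : finrank K X = 4 + b) (hb : 3 ≤ b) (hF : IsGeneral a b lam F)
    (hh : IsBasePlane b F h) {H : Submodule K X} (hHL : H ≤ liftSpace b F h)
    (hHV : H ⊓ baseSpace b F = h) {E : CompleteFlag K X}
    {G : CompleteFlag K (X ⧸ baseSpace b F)}
    (hG : IsInduced (quotChain E (baseSpace b F) (liftSpace b F h)) G) (m : ℕ) :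
    finrank K ↥(H ⊓ E.sub m) = finrank K ↥(H.map (baseSpace b F).mkQ ⊓
      G.sub (finrank K (quotChain E (baseSpace b F) (liftSpace b F h) m))) +
        finrank K ↥(h ⊓ E.sub m) := by
  have hLV : liftSpace b F h ⊓ baseSpace b F ≤ H :=
    (hh.liftSpace_inf_baseSpace hX hb hF).le.trans (hHV ▸ inf_le_left)
  rw [← hG m, quotChain, ← map_mkQ_inf hHL hLV,
    ← finrank_map_mkQ_add (H ⊓ E.sub m) (baseSpace b F), ← inf_assoc,
    inf_comm (baseSpace b F), hHV]

end IsBasePlane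

end LiftSpace

section Problems

/-- The total problem, of partitions `(b - a + 1, 2^a)`, `(b - a - 1)^2`, `1^(a + 1) + nu3`,
`1^(a + 1) + nu4` and `nu`. -/
def totalProblem (a b : ℕ) (nu3 nu4 : ℕ → ℕ) {t : ℕ} (nu : Fin t → ℕ → ℕ) :
    Fin (4 + t) → ℕ → ℕ :=
  Fin.append ![ofRows ((b - a + 1) :: List.replicate a 2), ofRows [b - a - 1, b - a - 1],
    ofRows (List.replicate (a + 1) 1) + nu3, ofRows (List.replicate (a + 1) 1) + nu4] nu

/-- The problem in the fibers, of partitions `2^(a - 1)`, `(b - a - 1)`, `nu3`, `nu4` and `nu`. -/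
def fiberProblem (a b : ℕ) (nu3 nu4 : ℕ → ℕ) {t : ℕ} (nu : Fin t → ℕ → ℕ) :
    Fin (4 + t) → ℕ → ℕ :=
  Fin.append ![ofRows (List.replicate (a - 1) 2), ofRows [b - a - 1], nu3, nu4] nu

theorem sum_range_ofRows {k : ℕ} {l : List ℕ} (hl : l.length ≤ k) :
    ∑ j ∈ Finset.range k, ofRows l j = l.sum := by
  induction l generalizing k with
  | nil => simp [ofRows]
  | cons y l ih =>
    obtain ⟨k, rfl⟩ := Nat.exists_eq_add_one_of_ne_zero (List.length_pos_of_mem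
      List.mem_cons_self |>.trans_le hl).ne'
    rw [Finset.sum_range_succ', List.sum_cons, add_comm, ← ih (Nat.le_of_succ_le_succ hl)]
    rfl

namespace IsPartitionFor

variable {k k' n n' N : ℕ} {l l' : ℕ → ℕ}

theorem mono (hl : IsPartitionFor k n l) (hk : k ≤ k') (hn : n - k ≤ n' - k') :
    IsPartitionFor k' n' l :=
  ⟨hl.1, hl.2.1.trans hn, hl.eq_zero hk⟩

theorem add (hl : IsPartitionFor k n l) (hl' : IsPartitionFor k n' l')
    (h : n - k + (n' - k) ≤ N - k) : IsPartitionFor k N (l + l') :=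
  ⟨hl.1.add hl'.1, (add_le_add hl.2.1 hl'.2.1).trans h,
    congrArg₂ (· + ·) hl.2.2 hl'.2.2⟩

theorem sum_range_eq (hl : IsPartitionFor k n l) (hk : k ≤ k') :
    ∑ j ∈ Finset.range k', l j = ∑ j ∈ Finset.range k, l j :=
  (Finset.sum_subset (Finset.range_subset_range.mpr hk) fun _ _ hj =>
    hl.eq_zero (not_lt.mp fun h => hj (Finset.mem_range.mpr h))).symm

end IsPartitionFor

variable {a b t : ℕ} {nu3 nu4 : ℕ → ℕ} {nu : Fin t → ℕ → ℕ}

theorem add_two_le_of_fiberProblem (hab : a < b) (hb : 3 ≤ b)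
    (hnu : IsSchubertProblem a b (fiberProblem a b nu3 nu4 nu)) : a + 2 ≤ b := by
  have h₀ : IsPartitionFor a b (ofRows (List.replicate (a - 1) 2)) := hnu.1 (Fin.castAdd t 0)
  have := h₀.le_sub 0
  rw [ofRows_replicate] at this
  split_ifs at this <;> lia

theorem isPartitionFor_column_add {l : ℕ → ℕ} (hab : a ≤ b) (hl : IsPartitionFor a b l) :
    IsPartitionFor (2 + a) (4 + b) (ofRows (List.replicate (a + 1) 1) + l) := by
  have hcol : IsPartitionFor (2 + a) (3 + a) (ofRows (List.replicate (a + 1) 1)) :=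
    isPartitionFor_ofRows (by simp [List.pairwise_replicate]) (by simp)
      (by simp only [List.mem_replicate]; lia)
  exact hcol.add (hl.mono (n' := 2 + b) (by lia) (by lia)) (by lia)

theorem isPartitionFor_totalProblem (hab : a + 2 ≤ b)
    (h₂ : IsPartitionFor a b nu3) (h₃ : IsPartitionFor a b nu4)
    (h : ∀ i, IsPartitionFor a b (nu i)) :
    ∀ i, IsPartitionFor (2 + a) (4 + b) (totalProblem a b nu3 nu4 nu i) := by
  refine (forall_append_four (P := fun _ => IsPartitionFor (2 + a) (4 + b))).mpr
    ⟨isPartitionFor_ofRows ?_ ?_ ?_, isPartitionFor_ofRows ?_ ?_ ?_,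
      isPartitionFor_column_add (by lia) h₂, isPartitionFor_column_add (by lia) h₃,
      fun i => (h i).mono (by lia) (by lia)⟩
  · simp only [List.pairwise_cons, List.pairwise_replicate, List.mem_replicate]
    lia
  · simp only [List.length_cons, List.length_replicate]
    lia
  · simp only [List.mem_cons, List.mem_replicate]
    lia
  · simp
  · simp
  · simp only [List.mem_cons, List.not_mem_nil]
    lia

theorem sum_totalProblem (ha : 0 < a) (hab : a < b) (h₂ : IsPartitionFor a b nu3)
    (h₃ : IsPartitionFor a b nu4) (h : ∀ i, IsPartitionFor a b (nu i)) :
    ∑ i, ∑ j ∈ Finset.range (2 + a), totalProblem a b nu3 nu4 nu i j =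
      ∑ i, ∑ j ∈ Finset.range a, fiberProblem a b nu3 nu4 nu i j + (2 * b + 4) := by
  have htotal := sum_append_four (fun l : ℕ → ℕ => ∑ j ∈ Finset.range (2 + a), l j)
    (ofRows ((b - a + 1) :: List.replicate a 2)) (ofRows [b - a - 1, b - a - 1])
    (ofRows (List.replicate (a + 1) 1) + nu3) (ofRows (List.replicate (a + 1) 1) + nu4) nu
  have hfiber := sum_append_four (fun l : ℕ → ℕ => ∑ j ∈ Finset.range a, l j)
    (ofRows (List.replicate (a - 1) 2)) (ofRows [b - a - 1]) nu3 nu4 nu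
  have hcol : (List.replicate (a + 1) 1).length ≤ 2 + a := by
    rw [List.length_replicate]
    lia
  have hk : a ≤ 2 + a := by lia
  simp only [Pi.add_apply, Finset.sum_add_distrib, h₂.sum_range_eq hk, h₃.sum_range_eq hk,
    (h _).sum_range_eq hk, sum_range_ofRows hcol] at htotal
  rw [sum_range_ofRows (by simp), sum_range_ofRows (by simp)] at htotal
  rw [sum_range_ofRows (by simp), sum_range_ofRows (by simpa)] at hfiber
  rw [totalProblem, fiberProblem, htotal, hfiber]
  simp only [List.sum_cons, List.sum_nil, List.sum_replicate, smul_eq_mul]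
  lia

theorem isSchubertProblem_totalProblem (ha : 0 < a) (hab : a + 2 ≤ b)
    (hnu : IsSchubertProblem a b (fiberProblem a b nu3 nu4 nu)) :
    IsSchubertProblem (2 + a) (4 + b) (totalProblem a b nu3 nu4 nu) := by
  obtain ⟨hpart, hsize⟩ := hnu
  obtain ⟨-, -, h₂, h₃, h⟩ := (forall_append_four (P := fun _ => IsPartitionFor a b)).mp hpart
  refine ⟨isPartitionFor_totalProblem hab h₂ h₃ h, ?_⟩
  rw [sum_totalProblem ha (by lia) h₂ h₃ h, hsize]
  obtain ⟨c, rfl⟩ := Nat.exists_eq_add_of_le (by lia : a ≤ b)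
  have hc : 4 + (a + c) - (2 + a) = c + 2 := by lia
  rw [hc, Nat.add_sub_cancel_left]
  ring

end Problems

section Solutions

variable {K X : Type*} [Field K] [AddCommGroup X] [Module K X] [FiniteDimensional K X]
  {a b t : ℕ} {nu3 nu4 : ℕ → ℕ} {nu : Fin t → ℕ → ℕ} {F : Fin (4 + t) → CompleteFlag K X}
  {H : Submodule K X}

theorem one_le_finrank_inf_sub₁_inf_sub₀ (hX : finrank K X = 4 + b) (ha : 0 < a)
    (hab : a + 2 ≤ b) (hH : H ∈ solutions (2 + a) (totalProblem a b nu3 nu4 nu) F) :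
    1 ≤ finrank K ↥(H ⊓ ((F (Fin.castAdd t 1)).sub 5 ⊓ (F (Fin.castAdd t 0)).sub (b + 1))) := by
  obtain ⟨hd, h₀, h₁, -⟩ := mem_solutions_append_four_iff.mp hH
  have h₀ := ((mem_schubertVariety_hook_iff hX hab ha hd).mp h₀).2
  have h₁ := finrank_inf_sub_of_mem_two_rows hX hab h₁
  have hsum := finrank_add_le_finrank_inf
    (inf_le_left : H ⊓ (F (Fin.castAdd t 1)).sub 5 ≤ H)
    (inf_le_left : H ⊓ (F (Fin.castAdd t 0)).sub (b + 1) ≤ H)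
  rw [← inf_inf_distrib_left] at hsum
  lia

namespace IsGeneral

variable {lam : Fin (4 + t) → ℕ → ℕ}

theorem finrank_inf_sub₁_inf_sub₀_le_one (hF : IsGeneral a b lam F)
    (hH : H ∈ solutions (2 + a) lam F) :
    finrank K ↥(H ⊓ ((F (Fin.castAdd t 1)).sub 5 ⊓ (F (Fin.castAdd t 0)).sub (b + 1))) ≤ 1 := by
  have hstep := (F (Fin.castAdd t 1)).finrank_inf_sub_succ_le
    (H ⊓ (F (Fin.castAdd t 0)).sub (b + 1)) 4
  rwa [inf_right_comm _ _ ((F (Fin.castAdd t 1)).sub 4), hF.inf_main H hH, finrank_bot,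
    inf_right_comm, inf_assoc] at hstep

theorem finrank_inf_baseSpace_le_two (hX : finrank K X = 4 + b) (hb : 3 ≤ b)
    (hF : IsGeneral a b lam F) (hH : H ∈ solutions (2 + a) lam F) :
    finrank K ↥(H ⊓ baseSpace b F) ≤ 2 := by
  by_contra! hlt
  have hsum := Submodule.finrank_sup_add_finrank_inf_eq (H ⊓ baseSpace b F)
    ((F (Fin.castAdd t 1)).sub 5 ⊓ (F (Fin.castAdd t 0)).sub (b + 1))
  rw [inf_assoc, inf_eq_right.mpr sub₁_inf_sub₀_le_baseSpace,
    hF.finrank_sub₁_inf_sub₀ hX hb] at hsum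
  have hsup : H ⊓ baseSpace b F ⊔
      (F (Fin.castAdd t 1)).sub 5 ⊓ (F (Fin.castAdd t 0)).sub (b + 1) = baseSpace b F := by
    refine Submodule.eq_of_le_of_finrank_le (sup_le inf_le_right sub₁_inf_sub₀_le_baseSpace) ?_
    have := hF.finrank_inf_sub₁_inf_sub₀_le_one hH
    rw [hF.finrank_baseSpace hX hb]
    lia
  refine hF.not_le_main H hH ((sub_two_le_baseSpace.trans hsup.ge).trans ?_)
  exact sup_le (inf_le_left.trans le_sup_right) (inf_le_left.trans le_sup_left)

variable (hX : finrank K X = 4 + b) (ha : 0 < a) (hab : a + 2 ≤ b) (hb : 3 ≤ b)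
  (hF : IsGeneral a b (totalProblem a b nu3 nu4 nu) F)
  (hH : H ∈ solutions (2 + a) (totalProblem a b nu3 nu4 nu) F)

include hX ha hab hb hF hH

theorem finrank_inf_baseSpace : finrank K ↥(H ⊓ baseSpace b F) = 2 := by
  obtain ⟨hd, h₀, -⟩ := mem_solutions_append_four_iff.mp hH
  rw [mem_schubertVariety_hook_iff hX hab ha hd] at h₀
  refine (hF.finrank_inf_baseSpace_le_two hX hb hH).antisymm ?_
  have hline := one_le_finrank_inf_sub₁_inf_sub₀ hX ha hab hH
  have hsum := Submodule.finrank_sup_add_finrank_inf_eq (H ⊓ (F (Fin.castAdd t 0)).sub 2)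
    (H ⊓ ((F (Fin.castAdd t 1)).sub 5 ⊓ (F (Fin.castAdd t 0)).sub (b + 1)))
  have hdisj : H ⊓ (F (Fin.castAdd t 0)).sub 2 ⊓
      (H ⊓ ((F (Fin.castAdd t 1)).sub 5 ⊓ (F (Fin.castAdd t 0)).sub (b + 1))) = ⊥ :=
    eq_bot_mono (inf_le_inf inf_le_right (inf_le_right.trans inf_le_left))
      (hF.sub_two_inf_sub_five_eq_bot hX hb)
  have hle := Submodule.finrank_mono (sup_le (inf_le_inf_left H (sub_two_le_baseSpace (F := F)))
    (inf_le_inf_left H (sub₁_inf_sub₀_le_baseSpace (b := b))))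
  rw [hdisj, finrank_bot] at hsum
  lia

theorem one_le_finrank_inf_baseSpace_inf {S : Submodule K X} (hS : a + 1 ≤ finrank K ↥(H ⊓ S)) :
    1 ≤ finrank K ↥(H ⊓ baseSpace b F ⊓ S) := by
  have hsum := finrank_add_le_finrank_inf (inf_le_left : H ⊓ baseSpace b F ≤ H)
    (inf_le_left : H ⊓ S ≤ H)
  rw [← inf_inf_distrib_left, ← inf_assoc, hF.finrank_inf_baseSpace hX ha hab hb hH, hH.1] at hsum
  lia

theorem isBasePlane_inf : IsBasePlane b F (H ⊓ baseSpace b F) := by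
  obtain ⟨hd, h₀, -, h₂, h₃, -⟩ := mem_solutions_append_four_iff.mp hH
  rw [mem_schubertVariety_hook_iff hX hab ha hd] at h₀
  refine ⟨hF.finrank_inf_baseSpace hX ha hab hb hH, ?_, inf_le_right.trans (baseSpace_le_sub hb),
    ?_, ?_, ?_⟩
  · rw [inf_assoc, inf_eq_right.mpr sub_two_le_baseSpace]
    exact h₀.1
  · refine (one_le_finrank_inf_sub₁_inf_sub₀ hX ha hab hH).trans (Submodule.finrank_mono ?_)
    exact le_inf (inf_le_inf_left H sub₁_inf_sub₀_le_baseSpace) (inf_le_right.trans inf_le_left)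
  · exact hF.one_le_finrank_inf_baseSpace_inf hX ha hab hb hH
      (finrank_inf_sub_of_mem_column_add hX (by lia) h₂)
  · exact hF.one_le_finrank_inf_baseSpace_inf hX ha hab hb hH
      (finrank_inf_sub_of_mem_column_add hX (by lia) h₃)

theorem le_sup_inf_baseSpace {S : Submodule K X} (hS : a + 1 ≤ finrank K ↥(H ⊓ S))
    (hline : finrank K ↥(H ⊓ baseSpace b F ⊓ S) = 1) : H ≤ S ⊔ H ⊓ baseSpace b F := by
  have hsum := Submodule.finrank_sup_add_finrank_inf_eq (H ⊓ S) (H ⊓ baseSpace b F)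
  rw [← inf_inf_distrib_left, inf_comm S, ← inf_assoc, hline,
    hF.finrank_inf_baseSpace hX ha hab hb hH] at hsum
  have hsup : H ⊓ S ⊔ H ⊓ baseSpace b F = H :=
    Submodule.eq_of_le_of_finrank_le (sup_le inf_le_left inf_le_left) (by rw [hH.1]; lia)
  exact hsup.ge.trans (sup_le_sup_right inf_le_right _)

theorem le_liftSpace : H ≤ liftSpace b F (H ⊓ baseSpace b F) := by
  obtain ⟨-, -, -, h₂, h₃, -⟩ := mem_solutions_append_four_iff.mp hH
  have hh := hF.isBasePlane_inf hX ha hab hb hH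
  have hF' := hF.toNoExcessSolutions
  exact le_inf
    (hF.le_sup_inf_baseSpace hX ha hab hb hH (finrank_inf_sub_of_mem_column_add hX (by lia) h₂)
      (hh.finrank_inf_sub₂ hX hb hF'))
    (hF.le_sup_inf_baseSpace hX ha hab hb hH (finrank_inf_sub_of_mem_column_add hX (by lia) h₃)
      (hh.finrank_inf_sub₃ hX hb hF'))

end IsGeneral

theorem NoExcessSolutions.finrank_quotient_baseSpace (hX : finrank K X = 4 + b) (hb : 3 ≤ b)
    (hF : NoExcessSolutions b F) : finrank K (X ⧸ baseSpace b F) = b := by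
  rw [Submodule.finrank_quotient, hF.finrank_baseSpace hX hb, hX, Nat.add_sub_cancel_left]

namespace IsBasePlane

variable {lam : Fin (4 + t) → ℕ → ℕ} {h : Submodule K X}

theorem finrank_inf_of_le_sup (hh : IsBasePlane b F h) (hH : finrank K H = 2 + a) (hhH : h ≤ H)
    {S : Submodule K X} (hS : H ≤ S ⊔ h) (hline : finrank K ↥(h ⊓ S) = 1) :
    a + 1 ≤ finrank K ↥(H ⊓ S) := by
  have hsup : H ⊓ S ⊔ h = H := by
    rw [inf_sup_assoc_of_le _ hhH, inf_eq_left.mpr hS]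
  have hsum := Submodule.finrank_sup_add_finrank_inf_eq (H ⊓ S) h
  rw [hsup, inf_right_comm, inf_eq_right.mpr hhH, hline, hh.finrank_eq] at hsum
  lia

theorem finrank_map_mkQ (hh : IsBasePlane b F h) (hH : finrank K H = 2 + a)
    (hHV : H ⊓ baseSpace b F = h) : finrank K (H.map (baseSpace b F).mkQ) = a := by
  have hadd := finrank_map_mkQ_add H (baseSpace b F)
  rw [inf_comm, hHV, hh.finrank_eq] at hadd
  lia

theorem mem_solutions_iff (hX : finrank K X = 4 + b) (ha : 0 < a) (hab : a + 2 ≤ b) (hb : 3 ≤ b)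
    (hnu : IsSchubertProblem a b (fiberProblem a b nu3 nu4 nu))
    (hF : IsGeneral a b lam F) (hh : IsBasePlane b F h) (hHL : H ≤ liftSpace b F h)
    (hHV : H ⊓ baseSpace b F = h) (hH : finrank K H = 2 + a)
    {G : Fin (4 + t) → CompleteFlag K (X ⧸ baseSpace b F)}
    (hG : ∀ i, IsInduced (quotChain (F i) (baseSpace b F) (liftSpace b F h)) (G i)) :
    H ∈ solutions (2 + a) (totalProblem a b nu3 nu4 nu) F ↔
      H.map (baseSpace b F).mkQ ∈ solutions a (fiberProblem a b nu3 nu4 nu) G := by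
  have hhH : h ≤ H := hHV ▸ inf_le_left
  have hF' := hF.toNoExcessSolutions
  have hY := hF'.finrank_quotient_baseSpace hX hb
  have hM := hh.finrank_map_mkQ hH hHV
  obtain ⟨-, -, p₂, p₃, p⟩ := (forall_append_four (P := fun _ => IsPartitionFor a b)).mp hnu.1
  have hfin := fun i m => hh.finrank_inf_sub_eq hX hb hF hHL hHV (hG i) m
  refine mem_solutions_append_four_iff.trans (.trans ?_ mem_solutions_append_four_iff.symm)
  rw [and_iff_right hH, and_iff_right hM]
  refine and_congr ?_ (and_congr ?_ (and_congr ?_ (and_congr ?_ (forall_congr' fun i => ?_))))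
  · refine mem_schubertVariety_iff_of_hook hX hY hab ha hH hM
      (hh.meet₀.trans (Submodule.finrank_mono (inf_le_inf_right _ hhH))) ?_
    rw [hfin, hh.finrank_quotChain₀ hX hb hF, hh.finrank_inf_sub₀]
  · refine mem_schubertVariety_iff_of_two_rows hX hY hab ha hH hM ?_
    rw [hfin, hh.finrank_quotChain₁ hX hb hF, hh.finrank_inf_sub₁ hX hb hF']
  · refine mem_schubertVariety_iff_of_column_add hX hY (by lia) hH hM p₂ (fun m hm => ?_)
      (hh.finrank_inf_of_le_sup hH hhH (hHL.trans inf_le_left) (hh.finrank_inf_sub₂ hX hb hF'))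
    rw [hfin, hh.finrank_quotChain₂ hX hb hF hm, hh.inf_sub₂_eq_bot_of_le hX hb hF' hm,
      finrank_bot, add_zero]
  · refine mem_schubertVariety_iff_of_column_add hX hY (by lia) hH hM p₃ (fun m hm => ?_)
      (hh.finrank_inf_of_le_sup hH hhH (hHL.trans inf_le_right) (hh.finrank_inf_sub₃ hX hb hF'))
    rw [hfin, hh.finrank_quotChain₃ hX hb hF hm, hh.inf_sub₃_eq_bot_of_le hX hb hF' hm,
      finrank_bot, add_zero]
  · refine mem_schubertVariety_iff_of_partition hX hY (by lia) hH hM (p i) fun m hm => ?_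
    rw [hfin, hh.finrank_quotChain hX hb hF i hm, hh.inf_sub_eq_bot_of_le hX hb hF' i hm,
      finrank_bot, add_zero]

end IsBasePlane

end Solutions

section Bijection

variable {K X : Type*} [Field K] [AddCommGroup X] [Module K X]

theorem map_mkQ_inf_comap {L V : Submodule K X} (hL : L ⊔ V = ⊤) (M : Submodule K (X ⧸ V)) :
    (L ⊓ M.comap V.mkQ).map V.mkQ = M := by
  rw [← Submodule.map_inf_eq_map_inf_comap, (Submodule.map_mkQ_eq_top _ _).mpr (sup_comm L V ▸ hL),
    top_inf_eq]

variable [FiniteDimensional K X] {a b t : ℕ} {F : Fin (4 + t) → CompleteFlag K X}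

/-- The flags in `V` cut out by the first four flags of `F`; an instance of the base problem when
`V` is `baseSpace b F`. -/
noncomputable def baseFlags (F : Fin (4 + t) → CompleteFlag K X) (V : Submodule K X)
    (i : Fin 4) : CompleteFlag K V :=
  inducedFlag (traceChain (F (Fin.castAdd t i)) V)

/-- The flags in `X ⧸ V` cut out by `F` on the lift of `h`; the instance of the fiber problem over
a solution `h` of the base problem when `V` is `baseSpace b F`. -/
noncomputable def fiberFlags (b : ℕ) (F : Fin (4 + t) → CompleteFlag K X) (V : Submodule K X)
    (h : Submodule K V) (i : Fin (4 + t)) : CompleteFlag K (X ⧸ V) :=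
  inducedFlag (quotChain (F i) V (liftSpace b F (h.map V.subtype)))

theorem isInduced_baseFlags (F : Fin (4 + t) → CompleteFlag K X) (V : Submodule K X) (i : Fin 4) :
    IsInduced (traceChain (F (Fin.castAdd t i)) V) (baseFlags F V i) :=
  (isFlagChain_traceChain _ _).isInduced_inducedFlag

theorem isInduced_fiberFlags {V : Submodule K X} {h : Submodule K V}
    (hL : liftSpace b F (h.map V.subtype) ⊔ V = ⊤) (i : Fin (4 + t)) :
    IsInduced (quotChain (F i) V (liftSpace b F (h.map V.subtype))) (fiberFlags b F V h i) :=
  (isFlagChain_quotChain _ hL).isInduced_inducedFlag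

theorem baseFlags_eq {V : Submodule K X} {E : Fin 4 → CompleteFlag K V}
    (hE : ∀ i, IsInduced (traceChain (F (Fin.castAdd t i)) V) (E i)) : baseFlags F V = E :=
  funext fun i => (isFlagChain_traceChain _ _).inducedFlag_eq (hE i)

theorem fiberFlags_eq {V : Submodule K X} {h : Submodule K V}
    (hL : liftSpace b F (h.map V.subtype) ⊔ V = ⊤) {G : Fin (4 + t) → CompleteFlag K (X ⧸ V)}
    (hG : ∀ i, IsInduced (quotChain (F i) V (liftSpace b F (h.map V.subtype))) (G i)) :
    fiberFlags b F V h = G :=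
  funext fun i => (isFlagChain_quotChain _ hL).inducedFlag_eq (hG i)

variable {nu3 nu4 : ℕ → ℕ} {nu : Fin t → ℕ → ℕ}

namespace IsGeneral

section

variable {H : Submodule K X} (hX : finrank K X = 4 + b) (ha : 0 < a) (hab : a + 2 ≤ b)
  (hb : 3 ≤ b) (hF : IsGeneral a b (totalProblem a b nu3 nu4 nu) F)
  (hH : H ∈ solutions (2 + a) (totalProblem a b nu3 nu4 nu) F)
include hX ha hab hb hF hH

theorem isBasePlane_map_comap :
    IsBasePlane b F ((H.comap (baseSpace b F).subtype).map (baseSpace b F).subtype) := by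
  rw [Submodule.map_comap_subtype, inf_comm]
  exact hF.isBasePlane_inf hX ha hab hb hH

theorem comap_mem_solutions : H.comap (baseSpace b F).subtype ∈
    solutions 2 (fun _ : Fin 4 => ofRows [1]) (baseFlags F (baseSpace b F)) :=
  (hF.mem_solutions_base_iff hX hb (isInduced_baseFlags F _) _).mpr
    (hF.isBasePlane_map_comap hX ha hab hb hH)

theorem map_mem_solutions (hnu : IsSchubertProblem a b (fiberProblem a b nu3 nu4 nu)) :
    H.map (baseSpace b F).mkQ ∈ solutions a (fiberProblem a b nu3 nu4 nu)
      (fiberFlags b F (baseSpace b F) (H.comap (baseSpace b F).subtype)) := by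
  have hh := hF.isBasePlane_map_comap hX ha hab hb hH
  have hmap := (Submodule.map_comap_subtype (baseSpace b F) H).trans (inf_comm _ _)
  have hL := hmap.symm ▸ hF.le_liftSpace hX ha hab hb hH
  exact (hh.mem_solutions_iff hX ha hab hb hnu hF hL hmap.symm hH.1
    (isInduced_fiberFlags (hh.liftSpace_sup_baseSpace hX hb hF))).mp hH

theorem eq_liftSpace_inf_comap :
    H = liftSpace b F ((H.comap (baseSpace b F).subtype).map (baseSpace b F).subtype) ⊓
      (H.map (baseSpace b F).mkQ).comap (baseSpace b F).mkQ := by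
  rw [Submodule.map_comap_subtype, inf_comm (baseSpace b F), Submodule.comap_map_mkQ, inf_comm,
    sup_comm, sup_inf_assoc_of_le _ (hF.le_liftSpace hX ha hab hb hH), inf_comm,
    (hF.isBasePlane_inf hX ha hab hb hH).liftSpace_inf_baseSpace hX hb hF]
  exact (sup_eq_left.mpr inf_le_left).symm

end

variable (hX : finrank K X = 4 + b) (ha : 0 < a) (hab : a + 2 ≤ b) (hb : 3 ≤ b)
  (hnu : IsSchubertProblem a b (fiberProblem a b nu3 nu4 nu))
  (hF : IsGeneral a b (totalProblem a b nu3 nu4 nu) F)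
include hX ha hab hb hnu hF

theorem exists_mem_solutions {h : Submodule K (baseSpace b F)}
    {M : Submodule K (X ⧸ baseSpace b F)}
    (hh : h ∈ solutions 2 (fun _ : Fin 4 => ofRows [1]) (baseFlags F (baseSpace b F)))
    (hM : M ∈ solutions a (fiberProblem a b nu3 nu4 nu) (fiberFlags b F (baseSpace b F) h)) :
    ∃ H ∈ solutions (2 + a) (totalProblem a b nu3 nu4 nu) F,
      H.comap (baseSpace b F).subtype = h ∧ H.map (baseSpace b F).mkQ = M := by
  have hp := (hF.mem_solutions_base_iff hX hb (isInduced_baseFlags F _) h).mp hh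
  have hL := hp.liftSpace_sup_baseSpace hX hb hF
  let H := liftSpace b F (h.map (baseSpace b F).subtype) ⊓ M.comap (baseSpace b F).mkQ
  have hinf : H ⊓ baseSpace b F = h.map (baseSpace b F).subtype := by
    rw [inf_assoc, inf_eq_right.mpr (Submodule.le_comap_mkQ _ M),
      hp.liftSpace_inf_baseSpace hX hb hF]
  have hmap : H.map (baseSpace b F).mkQ = M := map_mkQ_inf_comap hL M
  have hcomap : H.comap (baseSpace b F).subtype = h := by
    apply Submodule.map_injective_of_injective (baseSpace b F).injective_subtype
    rw [Submodule.map_comap_subtype, inf_comm, hinf]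
  have hH : finrank K H = 2 + a := by
    rw [← finrank_map_mkQ_add H (baseSpace b F), inf_comm, hinf, hmap, hp.finrank_eq, hM.1,
      add_comm]
  exact ⟨H, (hp.mem_solutions_iff hX ha hab hb hnu hF inf_le_left hinf hH
    (isInduced_fiberFlags hL)).mpr (hmap.symm ▸ hM), hcomap, hmap⟩

theorem bijOn_solutions : Set.BijOn
    (fun H => (H.comap (baseSpace b F).subtype, H.map (baseSpace b F).mkQ))
    (solutions (2 + a) (totalProblem a b nu3 nu4 nu) F)
    {p | p.1 ∈ solutions 2 (fun _ : Fin 4 => ofRows [1]) (baseFlags F (baseSpace b F)) ∧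
      p.2 ∈ solutions a (fiberProblem a b nu3 nu4 nu) (fiberFlags b F (baseSpace b F) p.1)} := by
  refine ⟨fun H hH => ⟨hF.comap_mem_solutions hX ha hab hb hH,
    hF.map_mem_solutions hX ha hab hb hH hnu⟩, fun H hH H' hH' heq => ?_, ?_⟩
  · obtain ⟨hcomap, hmap⟩ := Prod.mk.inj heq
    rw [hF.eq_liftSpace_inf_comap hX ha hab hb hH, hF.eq_liftSpace_inf_comap hX ha hab hb hH',
      hcomap, hmap]
  · rintro ⟨h, M⟩ ⟨hh, hM⟩
    obtain ⟨H, hH, hcomap, hmap⟩ := hF.exists_mem_solutions hX ha hab hb hnu hh hM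
    exact ⟨H, hH, Prod.ext hcomap hmap⟩

end IsGeneral

end Bijection

section Dominance

variable {K X : Type*} [Field K] [AddCommGroup X] [Module K X]

theorem CompleteFlag.map_refl (F : CompleteFlag K X) : F.map (LinearEquiv.refl K X) = F := by
  ext m : 2
  exact Submodule.map_id _

theorem CompleteFlag.inf_map_sub (F : CompleteFlag K X) {h : Submodule K X} {A : X ≃ₗ[K] X}
    (hA : h.map (A : X →ₗ[K] X) = h) (m : ℕ) :
    h ⊓ (F.map A).sub m = (h ⊓ F.sub m).map (A : X →ₗ[K] X) := by
  rw [map_sub, Submodule.map_inf _ A.injective, hA]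

theorem IsInduced.map {C : ℕ → Submodule K X} {E : CompleteFlag K X} (hE : IsInduced C E)
    (θ : X ≃ₗ[K] X) : IsInduced (fun m => (C m).map (θ : X →ₗ[K] X)) (E.map θ) := by
  intro m
  rw [LinearEquiv.finrank_map_eq, CompleteFlag.map_sub, ← hE m]

theorem map_eq_of_apply_eq {V W : Submodule K X} {A : X ≃ₗ[K] X} {θ : V ≃ₗ[K] W}
    (hA : ∀ v : V, A v = θ v) : V.map (A : X →ₗ[K] X) = W := by
  have hcomp : (A : X →ₗ[K] X) ∘ₗ V.subtype = W.subtype ∘ₗ (θ : V →ₗ[K] W) := LinearMap.ext hA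
  rw [← V.range_subtype, ← LinearMap.range_comp, hcomp, LinearEquiv.range_comp, W.range_subtype]

theorem exists_map_eq [FiniteDimensional K X] {V W : Submodule K X}
    (h : finrank K V = finrank K W) : ∃ B : X ≃ₗ[K] X, V.map (B : X →ₗ[K] X) = W := by
  obtain ⟨B, hB⟩ := Submodule.exists_linearEquiv_restrict_eq (LinearEquiv.ofFinrankEq V W h)
  exact ⟨B, map_eq_of_apply_eq fun v => (hB v).symm⟩

theorem traceChain_map (F : CompleteFlag K X) {V : Submodule K X} {A : X ≃ₗ[K] X}
    {θ : V ≃ₗ[K] V} (hA : ∀ v : V, A v = θ v) (m : ℕ) :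
    traceChain (F.map A) V m = (traceChain F V m).map (θ : V →ₗ[K] V) := by
  ext v
  obtain ⟨w, rfl⟩ := θ.surjective v
  simp [traceChain, CompleteFlag.map_sub, ← hA]

theorem quotChain_map (F : CompleteFlag K X) {V L : Submodule K X} {A : X ≃ₗ[K] X}
    {θ : (X ⧸ V) ≃ₗ[K] (X ⧸ V)} (hA : ∀ x, V.mkQ (A x) = θ (V.mkQ x))
    (hL : L.map (A : X →ₗ[K] X) = L) (m : ℕ) :
    quotChain (F.map A) V L m = (quotChain F V L m).map (θ : (X ⧸ V) →ₗ[K] (X ⧸ V)) := by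
  have hcomp : V.mkQ ∘ₗ (A : X →ₗ[K] X) = (θ : (X ⧸ V) →ₗ[K] (X ⧸ V)) ∘ₗ V.mkQ :=
    LinearMap.ext hA
  simp only [quotChain]
  rw [CompleteFlag.map_sub, ← Submodule.map_comp, ← hcomp, Submodule.map_comp,
    Submodule.map_inf _ A.injective, hL]

theorem baseSpace_map {b t : ℕ} (F : Fin (4 + t) → CompleteFlag K X) (B : X ≃ₗ[K] X) :
    baseSpace b (fun i => (F i).map B) = (baseSpace b F).map (B : X →ₗ[K] X) := by
  simp only [baseSpace, CompleteFlag.map_sub]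
  rw [Submodule.map_sup, Submodule.map_inf _ B.injective]

theorem exists_rightInverse_mkQ {L V : Submodule K X} (hL : L ⊔ V = ⊤) :
    ∃ ι : (X ⧸ V) →ₗ[K] X, LinearMap.range ι ≤ L ∧ Function.LeftInverse V.mkQ ι := by
  obtain ⟨g, hg⟩ := (V.mkQ.domRestrict L).exists_rightInverse_of_surjective (by
    rw [LinearMap.range_domRestrict, Submodule.map_mkQ_eq_top, sup_comm, hL])
  refine ⟨L.subtype ∘ₗ g, ?_, LinearMap.congr_fun hg⟩
  exact (LinearMap.range_comp_le_range g L.subtype).trans L.range_subtype.le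

theorem IsBasePlane.map {b t : ℕ} {F : Fin (4 + t) → CompleteFlag K X} {h : Submodule K X}
    (hh : IsBasePlane b F h) {A : Fin (4 + t) → X ≃ₗ[K] X}
    (hA : ∀ i, h.map (A i : X →ₗ[K] X) = h) : IsBasePlane b (fun i => (F i).map (A i)) h := by
  have hinf (i m) : finrank K ↥(h ⊓ ((F i).map (A i)).sub m) = finrank K ↥(h ⊓ (F i).sub m) := by
    rw [CompleteFlag.inf_map_sub _ (hA i), LinearEquiv.finrank_map_eq]
  refine ⟨hh.finrank_eq, ?_, ?_, ?_, ?_, ?_⟩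
  · exact hh.meet₀.trans_eq (hinf _ _).symm
  · exact (hA _).ge.trans (Submodule.map_mono hh.le₀)
  · exact hh.meet₁.trans_eq (hinf _ _).symm
  · exact hh.meet₂.trans_eq (hinf _ _).symm
  · exact hh.meet₃.trans_eq (hinf _ _).symm

variable [FiniteDimensional K X] {a b t : ℕ} {lam : Fin (4 + t) → ℕ → ℕ}
  {F : Fin (4 + t) → CompleteFlag K X} {A : Fin (4 + t) → X ≃ₗ[K] X} {V : Submodule K X}

theorem baseFlags_map {θ : Fin 4 → V ≃ₗ[K] V} (hA : ∀ i (v : V), A (Fin.castAdd t i) v = θ i v) :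
    baseFlags (fun i => (F i).map (A i)) V = fun i => (baseFlags F V i).map (θ i) :=
  baseFlags_eq fun i => by
    rw [funext (traceChain_map (F (Fin.castAdd t i)) (hA i))]
    exact (isInduced_baseFlags F V i).map (θ i)

theorem fiberFlags_map {h : Submodule K V} {θ : Fin (4 + t) → (X ⧸ V) ≃ₗ[K] (X ⧸ V)}
    (hL : liftSpace b F (h.map V.subtype) ⊔ V = ⊤)
    (hlift : liftSpace b (fun i => (F i).map (A i)) (h.map V.subtype) =
      liftSpace b F (h.map V.subtype))
    (hA : ∀ i x, V.mkQ (A i x) = θ i (V.mkQ x))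
    (hAL : ∀ i, (liftSpace b F (h.map V.subtype)).map (A i : X →ₗ[K] X) =
      liftSpace b F (h.map V.subtype)) :
    fiberFlags b (fun i => (F i).map (A i)) V h = fun i => (fiberFlags b F V h i).map (θ i) :=
  fiberFlags_eq (hlift.symm ▸ hL) fun i => by
    rw [hlift, funext (quotChain_map (F i) (hA i) (hAL i))]
    exact (isInduced_fiberFlags hL i).map (θ i)

theorem NoExcessSolutions.baseSpace_map_eq (hX : finrank K X = 4 + b) (hb : 3 ≤ b)
    (hF : NoExcessSolutions b F) (hF' : NoExcessSolutions b fun i => (F i).map (A i))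
    (hA : ∀ i, (baseSpace b F).map (A i : X →ₗ[K] X) = baseSpace b F) :
    baseSpace b (fun i => (F i).map (A i)) = baseSpace b F := by
  let F' i := (F i).map (A i)
  have hsub₀ : (F' (Fin.castAdd t 0)).sub 2 ≤ baseSpace b F :=
    (Submodule.map_mono sub_two_le_baseSpace).trans (hA _).le
  have hle₀ : baseSpace b F ≤ (F' (Fin.castAdd t 0)).sub (b + 1) :=
    (hA _).ge.trans (Submodule.map_mono (baseSpace_le_sub hb))
  have hsub₁ : baseSpace b F ⊓ (F' (Fin.castAdd t 1)).sub 5 =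
      (F' (Fin.castAdd t 1)).sub 5 ⊓ (F' (Fin.castAdd t 0)).sub (b + 1) := by
    refine Submodule.eq_of_le_of_finrank_eq
      (le_inf inf_le_right (inf_le_left.trans hle₀)) ?_
    rw [CompleteFlag.inf_map_sub _ (hA _), LinearEquiv.finrank_map_eq, baseSpace_inf_sub₁ hb,
      hF.finrank_sub₁_inf_sub₀ hX hb, hF'.finrank_sub₁_inf_sub₀ hX hb]
  refine Submodule.eq_of_le_of_finrank_eq (sup_le hsub₀ (hsub₁.ge.trans inf_le_left)) ?_
  rw [hF'.finrank_baseSpace hX hb, hF.finrank_baseSpace hX hb]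

theorem IsBasePlane.liftSpace_map_eq (hX : finrank K X = 4 + b) (hb : 3 ≤ b)
    (hF : IsGeneral a b lam F) (hF' : IsGeneral a b lam fun i => (F i).map (A i))
    {h : Submodule K X} (hh : IsBasePlane b F h) (hAh : ∀ i, h.map (A i : X →ₗ[K] X) = h)
    (hAL : ∀ i, (liftSpace b F h).map (A i : X →ₗ[K] X) = liftSpace b F h) :
    liftSpace b (fun i => (F i).map (A i)) h = liftSpace b F h := by
  have hle (i) (hi : liftSpace b F h ≤ (F i).sub (b + 2) ⊔ h) :
      liftSpace b F h ≤ ((F i).map (A i)).sub (b + 2) ⊔ h :=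
    calc liftSpace b F h = (liftSpace b F h).map (A i : X →ₗ[K] X) := (hAL i).symm
      _ ≤ ((F i).sub (b + 2) ⊔ h).map (A i : X →ₗ[K] X) := Submodule.map_mono hi
      _ = ((F i).map (A i)).sub (b + 2) ⊔ h := by
        rw [Submodule.map_sup, hAh, CompleteFlag.map_sub]
  exact (Submodule.eq_of_le_of_finrank_eq (le_inf (hle _ inf_le_left) (hle _ inf_le_right))
    ((hh.finrank_liftSpace hX hb hF).trans
      ((hh.map hAh).finrank_liftSpace hX hb hF').symm)).symm

theorem generally_exists_baseFlags (hX : finrank K X = 4 + b) (hb : 3 ≤ b)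
    (hne : (zariskiInterior (IsGeneral (K := K) (X := X) a b lam)).Nonempty)
    (hV : finrank K V = 4) :
    Generally fun E : Fin 4 → CompleteFlag K V =>
      ∃ F ∈ zariskiInterior (IsGeneral a b lam), baseSpace b F = V ∧ baseFlags F V = E := by
  obtain ⟨F₁, hF₁⟩ := hne
  obtain ⟨B, hB⟩ := exists_map_eq
    (((of_mem_zariskiInterior hF₁).finrank_baseSpace hX hb).trans hV.symm)
  have hF := map_mem_zariskiInterior B (fun F hF => hF.map B) hF₁
  rw [← baseSpace_map] at hB
  generalize (fun i => (F₁ i).map B) = F at hF hB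
  obtain ⟨π, hπ⟩ := V.subtype.exists_leftInverse_of_injective V.ker_subtype
  have hπι : Function.LeftInverse π V.subtype := LinearMap.congr_fun hπ
  refine ((isZariskiOpen_zariskiInterior _).generally_extendAut hπι hF
    (Fin.addCases some fun _ => none) (baseFlags F V)).mono ?_
  rintro _ ⟨θ, rfl, hF'⟩
  refine ⟨_, hF', ?_, baseFlags_map fun i v => ?_⟩
  · subst hB
    refine (of_mem_zariskiInterior hF).baseSpace_map_eq hX hb
      (of_mem_zariskiInterior hF').toNoExcessSolutions fun i => ?_
    cases (Fin.addCases some (fun _ => none) i : Option (Fin 4)) with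
    | none => exact Submodule.map_id _
    | some j => exact map_extendAut hπι (θ j) (Submodule.range_subtype _).le
  · rw [Fin.addCases_left]
    exact extendAut_incl hπι (θ i) v

theorem generally_exists_fiberFlags (hX : finrank K X = 4 + b) (hb : 3 ≤ b)
    (hF : F ∈ zariskiInterior (IsGeneral a b lam)) {h : Submodule K (baseSpace b F)}
    (hh : h ∈ solutions 2 (fun _ : Fin 4 => ofRows [1]) (baseFlags F (baseSpace b F))) :
    Generally fun G : Fin (4 + t) → CompleteFlag K (X ⧸ baseSpace b F) =>
      ∃ F' ∈ zariskiInterior (IsGeneral a b lam), baseSpace b F' = baseSpace b F ∧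
        baseFlags F' (baseSpace b F) = baseFlags F (baseSpace b F) ∧
        fiberFlags b F' (baseSpace b F) h = G := by
  have hgen := of_mem_zariskiInterior hF
  have hp := (hgen.mem_solutions_base_iff hX hb (isInduced_baseFlags F _) h).mp hh
  have hL := hp.liftSpace_sup_baseSpace hX hb hgen
  obtain ⟨ι, hrange, hι⟩ := exists_rightInverse_mkQ hL
  refine ((isZariskiOpen_zariskiInterior _).generally_extendAut hι hF some
    (fiberFlags b F (baseSpace b F) h)).mono ?_
  rintro _ ⟨θ, rfl, hF'⟩
  have hgen' := of_mem_zariskiInterior hF'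
  have hfix (i) (v : baseSpace b F) : extendAut hι (θ i) v = LinearEquiv.refl K _ v :=
    extendAut_of_eq_zero hι (θ i) ((Submodule.Quotient.mk_eq_zero _).mpr v.2)
  have hAL (i) := map_extendAut hι (θ i) hrange
  have hAh (i) : (h.map (baseSpace b F).subtype).map (extendAut hι (θ i) : X →ₗ[K] X) =
      h.map (baseSpace b F).subtype :=
    map_eq_of_apply_eq (θ := LinearEquiv.refl K _) fun v =>
      hfix i ⟨v, Submodule.map_subtype_le _ h v.2⟩
  refine ⟨_, hF', ?_, ?_, ?_⟩
  · exact hgen.baseSpace_map_eq hX hb hgen'.toNoExcessSolutions fun i =>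
      map_eq_of_apply_eq (hfix i)
  · exact (baseFlags_map fun i => hfix _).trans (funext fun i => CompleteFlag.map_refl _)
  · exact fiberFlags_map hL (hp.liftSpace_map_eq hX hb hgen hgen' hAh hAL)
      (fun i => retract_extendAut hι (θ i)) hAL

end Dominance

section Fibration

variable {K : Type*} [Field K]

/-- The subspace and the flags attached to an instance of the total problem: the space `V` of the
fibration is `baseSpace b F`. -/
noncomputable def fibrationDatum (b : ℕ) {t : ℕ}
    (F : Fin (4 + t) → CompleteFlag K (Fin (4 + b) → K)) : FibrationDatum K (4 + b) 4 (4 + t) where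
  V := baseSpace b F
  E := baseFlags F (baseSpace b F)
  G := fiberFlags b F (baseSpace b F)

theorem fibrationDatum_eq {b t : ℕ} {F : Fin (4 + t) → CompleteFlag K (Fin (4 + b) → K)}
    {V : Submodule K (Fin (4 + b) → K)} {E : Fin 4 → CompleteFlag K V}
    (hV : baseSpace b F = V) (hE : baseFlags F V = E) :
    fibrationDatum b F = ⟨V, E, fiberFlags b F V⟩ := by
  subst hV hE
  rfl

variable [Infinite K] {a b t : ℕ} {nu3 nu4 : ℕ → ℕ} {nu : Fin t → ℕ → ℕ}

theorem generally_isGeneral_totalProblem (ha : 0 < a) (hab : a + 2 ≤ b)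
    (hnu : IsSchubertProblem a b (fiberProblem a b nu3 nu4 nu)) :
    Generally fun F : Fin (4 + t) → CompleteFlag K (Fin (4 + b) → K) =>
      IsGeneral a b (totalProblem a b nu3 nu4 nu) F := by
  refine generally_isGeneral (finrank_fin_fun K) hab ha (isSchubertProblem_totalProblem ha hab hnu)
    ?_ ?_ ?_ ?_
  · rw [totalProblem, Fin.append_left]
    rfl
  · rw [totalProblem, Fin.append_left]
    obtain ⟨a, rfl⟩ := Nat.exists_eq_add_one_of_ne_zero ha.ne'
    exact (ofRows_replicate _ _ _).trans (if_pos a.lt_succ_self)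
  · rw [totalProblem, Fin.append_left]
    rfl
  · rw [totalProblem, Fin.append_left]
    rfl

theorem isFibered_totalProblem (ha : 0 < a) (hab : a + 2 ≤ b) (hb : 3 ≤ b)
    (hnu : IsSchubertProblem a b (fiberProblem a b nu3 nu4 nu)) :
    IsFibered K 2 4 a b (totalProblem a b nu3 nu4 nu) (fun _ : Fin 4 => ofRows [1])
      (fiberProblem a b nu3 nu4 nu) := by
  have hX : finrank K (Fin (4 + b) → K) = 4 + b := finrank_fin_fun K
  have hne := (generally_isGeneral_totalProblem (K := K) ha hab hnu).nonempty_zariskiInterior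
  refine ⟨_, fibrationDatum b, isZariskiOpen_zariskiInterior _, hne, fun F hF => ?_, ?_,
    fun F hF => (of_mem_zariskiInterior hF).bijOn_solutions hX ha hab hb hnu, fun V hV => ?_⟩
  · have hgen := of_mem_zariskiInterior hF
    exact ⟨hgen.finrank_baseSpace hX hb, fun H hH => hgen.comap_mem_solutions hX ha hab hb hH⟩
  · rintro F hF _ - H hH rfl
    exact (of_mem_zariskiInterior hF).map_mem_solutions hX ha hab hb hH hnu
  have hbase := generally_exists_baseFlags hX hb hne hV
  refine ⟨hbase.mono ?_, hbase.mono ?_⟩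
  · rintro E ⟨F, hF, hFV, hE⟩
    exact ⟨F, hF, _, fibrationDatum_eq hFV hE⟩
  · rintro E ⟨F, hF, rfl, rfl⟩ h hh
    refine (generally_exists_fiberFlags hX hb hF hh).mono ?_
    rintro G ⟨F', hF', hV', hE', hG⟩
    exact ⟨F', hF', _, fibrationDatum_eq hV' hE', hG⟩

end Fibration

theorem theorem3p12_general {K : Type*} [Field K] [Infinite K] {a b : ℕ} (ha : 0 < a)
    (hab : a < b) (hb : 3 ≤ b) {nu3 nu4 : ℕ → ℕ} {t : ℕ} {nu : Fin t → ℕ → ℕ}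
    (hnu : IsSchubertProblem a b (fiberProblem a b nu3 nu4 nu)) :
    IsSchubertProblem (2 + a) (4 + b) (totalProblem a b nu3 nu4 nu) ∧
    IsFibered K 2 4 a b (totalProblem a b nu3 nu4 nu) (fun _ : Fin 4 => ofRows [1])
      (fiberProblem a b nu3 nu4 nu) :=
  have hab' := add_two_le_of_fiberProblem hab hb hnu
  ⟨isSchubertProblem_totalProblem ha hab' hnu, isFibered_totalProblem ha hab' hb hnu⟩

end Schubert

theorem theorem3p12 {K : Type*} [Field K] [IsAlgClosed K] [CharZero K]
    (a b : ℕ) (ha : 0 < a) (hab : a < b) (hb : 3 ≤ b)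
    (nu3 nu4 : ℕ → ℕ) {t : ℕ} (nu : Fin t → ℕ → ℕ)
    (hnu : IsSchubertProblem a b
      (Fin.append ![ofRows (List.replicate (a - 1) 2), ofRows [b - a - 1], nu3, nu4] nu)) :
    IsSchubertProblem (2 + a) (4 + b)
      (Fin.append ![ofRows ((b - a + 1) :: List.replicate a 2), ofRows [b - a - 1, b - a - 1],
        ofRows (List.replicate (a + 1) 1) + nu3, ofRows (List.replicate (a + 1) 1) + nu4] nu) ∧
    IsFibered K 2 4 a b
      (Fin.append ![ofRows ((b - a + 1) :: List.replicate a 2), ofRows [b - a - 1, b - a - 1],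
        ofRows (List.replicate (a + 1) 1) + nu3, ofRows (List.replicate (a + 1) 1) + nu4] nu)
      (fun _ : Fin 4 => ofRows [1])
      (Fin.append ![ofRows (List.replicate (a - 1) 2), ofRows [b - a - 1], nu3, nu4] nu) := by
  have : Infinite K := IsAlgClosed.instInfinite
  exact theorem3p12_general ha hab hb hnu
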